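/- Let $G$ be a compact connected Lie group with Lie algebra $\mathfrak g$, let $\xi_1,\dots,\xi_k$ be a basis of $\mathfrak g$ with structure constants $[\xi_b,\xi_c]=f^a_{bc}\xi_a$, and let $\theta^a$ and $\Theta^a$ denote the dual basis, regarded in $\Lambda^1(\mathfrak g^*)$ and in $S^1(\mathfrak g^*)$ respectively. Let $W$ be a compact smooth manifold, possibly with boundary, with a smooth (left) action of $G$ which is locally free (all stabilizers discrete) on an open subset containing $\partial W$. For $\xi\in\mathfrak g$ let $\xi_W(x)=\frac{d}{dt}\big|_{t=0}\exp(-t\xi)x$ (so that $\xi\mapsto\xi_W$ is a Lie algebra homomorphism), and let $\iota_a$ be the contraction of forms with $(\xi_a)_W$. Let $\Omega_G(W)=(S(\mathfrak g^*)\otimes\Omega(W))^G$ with the Cartan differential $D=1\otimes d-\Theta^a\otimes\iota_a$ (repeated indices are summed), and $H_G^*(W)=\ker D/\operatorname{im}D$ its cohomology. Let $W^s\subset W$ be the set of points whose stabilizer has positive dimension and $W^0=W\setminus W^s$. Let $f:W\to[0,1]$ be a $G$-invariant smooth function that vanishes on a neighborhood of $W^s$, and let $\omega$ be a connection on $W^0\to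 W^0/G$, i.e. a smooth $G$-invariant $\mathfrak g$-valued $1$-form on $W^0$ with $\omega(\xi_W)=\xi$ for all $\xi\in\mathfrak g$. Put $\omega_f=f\omega$ (extended by $0$ to $W$) and $$\Omega_f^G=d\omega_f+\tfrac12[\omega_f,\omega_f]-(-1+f)\,\xi_a\Theta^a ,$$ with components $\omega_f^a$ and $(\Omega_f^G)^a$ in the basis $\xi_a$. Let $r_f^G:S(\mathfrak g^*)\otimes\Omega(W)\to S(\mathfrak g^*)\otimes\Omega(W)$ be $r_f^G(\alpha)=CW_f(\Psi(\alpha))$, where $\Psi=\prod_a(1-\theta^a\otimes\iota_a)$ acts on $\Lambda(\mathfrak g^*)\otimes S(\mathfrak g^*)\otimes\Omega(W)$ (with the usual sign rule) and $CW_f$ is the $\Omega(W)$-module map $\Lambda(\mathfrak g^*)\otimes S(\mathfrak g^*)\otimes\Omega(W)\to S(\mathfrak g^*)\otimes\Omega(W)$, multiplicative on $\Lambda(\mathfrak g^*)\otimes S(\mathfrak g^*)$, with $\theta^a\mapsto\omega_f^a$ and $\Theta^a\mapsto(\Omega_f^G)^a$. Then $r_f^G$ maps $\Omega_G(W)$ to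 itself and commutes with $D$ there, and the homomorphism $(r_f^G)_*:H_G^*(W)\to H_G^*(W)$ that it induces is the identity. -/

import Mathlib

open scoped Manifold ContDiff TensorProduct

set_option maxSynthPendingDepth 3

noncomputable section

namespace DegenerateChernWeil

section ExteriorAlgebra

variable {V V' : Type*} [AddCommGroup V] [Module ℝ V] [AddCommGroup V'] [Module ℝ V']

/-- A norm on the exterior algebra of a finite-dimensional real vector space: the sup norm of the
coordinates in a basis. All norms being equivalent, it only serves to speak of differentiability. -/
instance instNormedAddCommGroupExteriorAlgebra [FiniteDimensional ℝ V] :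
    NormedAddCommGroup (ExteriorAlgebra ℝ V) :=
  NormedAddCommGroup.induced _ (Finset (Fin (Module.finrank ℝ V)) → ℝ)
    (Module.finBasis ℝ V).ExteriorAlgebra.equivFun
    (Module.finBasis ℝ V).ExteriorAlgebra.equivFun.injective

instance instNormedSpaceExteriorAlgebra [FiniteDimensional ℝ V] :
    NormedSpace ℝ (ExteriorAlgebra ℝ V) :=
  NormedSpace.induced ℝ _ (Finset (Fin (Module.finrank ℝ V)) → ℝ)
    (Module.finBasis ℝ V).ExteriorAlgebra.equivFun.toLinearMap

/-- Pullback of exterior forms `Λ(V'^*) → Λ(V^*)` along a linear map `V → V'`. -/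
def pullExt (A : V →ₗ[ℝ] V') :
    ExteriorAlgebra ℝ (Module.Dual ℝ V') →ₐ[ℝ] ExteriorAlgebra ℝ (Module.Dual ℝ V) :=
  ExteriorAlgebra.map A.dualMap

/-- Contraction of an exterior form on `V` with a vector: the antiderivation of degree `-1` which
sends a covector `l` to `l v`. -/
def contractExt (v : V) :
    ExteriorAlgebra ℝ (Module.Dual ℝ V) →ₗ[ℝ] ExteriorAlgebra ℝ (Module.Dual ℝ V) :=
  CliffordAlgebra.contractLeft (Module.Dual.eval ℝ V v)

/-- The exterior derivative `∑ᵢ eⁱ ∧ ∂ᵢζ` (derivatives taken within `s`) of a form on `E`. -/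
def flatExtDeriv {E : Type*} [NormedAddCommGroup E] [NormedSpace ℝ E] [FiniteDimensional ℝ E]
    (s : Set E) (ζ : E → ExteriorAlgebra ℝ (Module.Dual ℝ E)) (y : E) :
    ExteriorAlgebra ℝ (Module.Dual ℝ E) :=
  ∑ i, ExteriorAlgebra.ι ℝ ((Module.finBasis ℝ E).coord i) *
    fderivWithin ℝ ζ s y (Module.finBasis ℝ E i)

end ExteriorAlgebra

section Forms

variable {E : Type*} [NormedAddCommGroup E] [NormedSpace ℝ E] {H : Type*} [TopologicalSpace H]
  (I : ModelWithCorners ℝ E H) (W : Type*) [TopologicalSpace W] [ChartedSpace H W]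

/-- Sections, not necessarily smooth, of the bundle `ΛT^*W`; an algebra for the pointwise exterior
product. -/
abbrev FormField : Type _ :=
  ∀ x : W, ExteriorAlgebra ℝ (Module.Dual ℝ (TangentSpace I x))

variable {W}

/-- The derivative at `y` of the inverse of the chart at `x₀`. -/
def chartInvDeriv (x₀ : W) (y : E) : E →ₗ[ℝ] TangentSpace I ((extChartAt I x₀).symm y) :=
  (mfderivWithin 𝓘(ℝ, E) I (extChartAt I x₀).symm (Set.range I) y).toLinearMap

/-- The derivative at `x` of the chart at `x`. -/
def chartDeriv (x : W) : TangentSpace I x →ₗ[ℝ] E :=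
  (mfderiv I 𝓘(ℝ, E) (extChartAt I x) x).toLinearMap

/-- The form `η` in the chart at `x₀`, i.e. its pullback under the inverse of that chart. -/
def inChart (x₀ : W) (η : FormField I W) (y : E) : ExteriorAlgebra ℝ (Module.Dual ℝ E) :=
  pullExt (chartInvDeriv I x₀ y) (η ((extChartAt I x₀).symm y))

variable [FiniteDimensional ℝ E]

/-- The form `η` is smooth at `x`. -/
def SmoothFormAt (η : FormField I W) (x : W) : Prop :=
  ContDiffWithinAt ℝ ∞ (inChart I x η) (Set.range I) (extChartAt I x x)

/-- The exterior derivative, computed at `x` in the chart at `x`. -/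
def extD (η : FormField I W) : FormField I W := fun x ↦
  pullExt (chartDeriv I x) (flatExtDeriv (Set.range I) (inChart I x η) (extChartAt I x x))

/-- The space `Ω(W)` of smooth differential forms (of all degrees). -/
def SmoothForms : Submodule ℝ (FormField I W) where
  carrier := {η | ∀ x, SmoothFormAt I η x}
  zero_mem' x := by
    have : inChart I x (0 : FormField I W) = fun _ ↦ 0 := by
      funext y; simp [inChart, -extChartAt]
    rw [SmoothFormAt, this]
    exact contDiffWithinAt_const
  add_mem' {η η'} h h' x := by
    have : inChart I x (η + η') = fun y ↦ inChart I x η y + inChart I x η' y := by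
      funext y; simp [inChart, -extChartAt]
    simpa [SmoothFormAt, this] using (h x).add (h' x)
  smul_mem' c η h x := by
    have : inChart I x (c • η) = fun y ↦ c • inChart I x η y := by
      funext y; simp [inChart, -extChartAt]
    simpa [SmoothFormAt, this] using (h x).const_smul c

theorem extD_zero : extD I (0 : FormField I W) = 0 := by
  funext x
  have : inChart I x (0 : FormField I W) = fun _ ↦ 0 := by
    funext y; simp [inChart, -extChartAt]
  simp [extD, flatExtDeriv, this]

theorem extD_add {η η' : FormField I W} (h : η ∈ SmoothForms I) (h' : η' ∈ SmoothForms I) :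
    extD I (η + η') = extD I η + extD I η' := by
  funext x
  have : inChart I x (η + η') = fun y ↦ inChart I x η y + inChart I x η' y := by
    funext y; simp [inChart, -extChartAt]
  have hx := (h x).differentiableWithinAt (by simp)
  have hx' := (h' x).differentiableWithinAt (by simp)
  have hu : UniqueDiffWithinAt ℝ (Set.range I) (extChartAt I x x) :=
    I.uniqueDiffOn _ (Set.mem_range_self _)
  simp [extD, flatExtDeriv, this, -extChartAt, fderivWithin_fun_add hu hx hx', mul_add,
    Finset.sum_add_distrib]

theorem extD_smul (c : ℝ) {η : FormField I W} (h : η ∈ SmoothForms I) :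
    extD I (c • η) = c • extD I η := by
  funext x
  have : inChart I x (c • η) = fun y ↦ c • inChart I x η y := by
    funext y; simp [inChart, -extChartAt]
  have hx := (h x).differentiableWithinAt (by simp)
  have hu : UniqueDiffWithinAt ℝ (Set.range I) (extChartAt I x x) :=
    I.uniqueDiffOn _ (Set.mem_range_self _)
  simp [extD, flatExtDeriv, this, -extChartAt, fderivWithin_fun_const_smul hu hx, Finset.smul_sum]

variable {I}

/-- Contraction of forms with a vector field. -/
def contract (X : ∀ x : W, TangentSpace I x) : FormField I W →ₗ[ℝ] FormField I W :=
  LinearMap.pi fun x ↦ contractExt (X x) ∘ₗ LinearMap.proj x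

/-- A field of linear forms, as a differential 1-form. -/
def oneForm (l : ∀ x : W, Module.Dual ℝ (TangentSpace I x)) : FormField I W :=
  fun x ↦ ExteriorAlgebra.ι ℝ (l x)

end Forms

section Polynomials

variable {E : Type*} [NormedAddCommGroup E] [NormedSpace ℝ E] {H : Type*} [TopologicalSpace H]
  (I : ModelWithCorners ℝ E H) (W : Type*) [TopologicalSpace W] [ChartedSpace H W] (k : ℕ)

/-- `S(𝔤^*) ⊗ ΛT^*W` for a Lie algebra `𝔤` with a basis of `k` elements: polynomials in central
variables `Θ¹, …, Θᵏ` (the dual basis, in `S¹(𝔤^*)`) with coefficients in the algebra of fields of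
forms. -/
abbrev PolyForm : Type _ := AddMonoidAlgebra (FormField I W) (Fin k →₀ ℕ)

variable {I W k}

/-- A form as a constant polynomial. -/
def constForm (η : FormField I W) : PolyForm I W k := AddMonoidAlgebra.single 0 η

/-- The variable `Θᵃ`. -/
def Theta (a : Fin k) : PolyForm I W k := AddMonoidAlgebra.single (Finsupp.single a 1) 1

/-- The operator `1 ⊗ h`, applying `h` to the coefficients. -/
def mapCoeff (h : FormField I W →ₗ[ℝ] FormField I W) : PolyForm I W k →ₗ[ℝ] PolyForm I W k :=
  (AddMonoidAlgebra.coeffLinearEquiv ℝ).symm.toLinearMap ∘ₗ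
    Finsupp.mapRange.linearMap h ∘ₗ (AddMonoidAlgebra.coeffLinearEquiv ℝ).toLinearMap

/-- The map `∑ Θ^m α_m ↦ ∑ P^m h(α_m)`, where `P^m = (P¹)^{m₁} ⋯ (Pᵏ)^{m_k}`. -/
def substitute (P : Fin k → PolyForm I W k) (h : FormField I W →ₗ[ℝ] FormField I W) :
    PolyForm I W k →ₗ[ℝ] PolyForm I W k :=
  Finsupp.lsum ℝ (fun m : Fin k →₀ ℕ ↦
    LinearMap.mulLeft ℝ ((List.finRange k).map fun a ↦ P a ^ m a).prod ∘ₗ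
      AddMonoidAlgebra.lsingle 0 ∘ₗ h) ∘ₗ
    (AddMonoidAlgebra.coeffLinearEquiv ℝ).toLinearMap

end Polynomials

section Action

variable {EG : Type*} [NormedAddCommGroup EG] [NormedSpace ℝ EG]
  (G : Type*) [TopologicalSpace G] [ChartedSpace EG G] [Group G]

/-- The Lie algebra of `G`. -/
abbrev LieAlg : Type _ := GroupLieAlgebra 𝓘(ℝ, EG) G

variable {G}

/-- The adjoint representation: the derivative at `1` of conjugation by `g`. -/
def Ad (g : G) : LieAlg (EG := EG) G →ₗ[ℝ] LieAlg (EG := EG) G :=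
  (mfderiv 𝓘(ℝ, EG) 𝓘(ℝ, EG) (fun h : G ↦ g * h * g⁻¹) 1).toLinearMap

variable {E : Type*} [NormedAddCommGroup E] [NormedSpace ℝ E] {H : Type*} [TopologicalSpace H]
  (I : ModelWithCorners ℝ E H) {W : Type*} [TopologicalSpace W] [ChartedSpace H W] [MulAction G W]

/-- The derivative at `x` of the action of `g`. -/
def actDeriv (g : G) (x : W) : TangentSpace I x →ₗ[ℝ] TangentSpace I (g • x) :=
  (mfderiv I I (fun z : W ↦ g • z) x).toLinearMap

/-- The vector field on `W` corresponding to `ξ ∈ 𝔤`, namely `x ↦ d/dt exp(-tξ)•x` at `t = 0`;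
with this sign `𝔤 → Vect(W)` is a homomorphism of Lie algebras. -/
def fundField (ξ : LieAlg (EG := EG) G) (x : W) : TangentSpace I x :=
  mfderiv 𝓘(ℝ, EG) I (fun g : G ↦ g⁻¹ • x) 1 ξ

/-- The action of `g` on forms: pullback under `g⁻¹`. -/
def actForm (g : G) : FormField I W →ₗ[ℝ] FormField I W :=
  LinearMap.pi fun x ↦ (pullExt (actDeriv I g⁻¹ x)).toLinearMap ∘ₗ LinearMap.proj (g⁻¹ • x)

variable {k : ℕ} (b : Module.Basis (Fin k) ℝ (LieAlg (EG := EG) G))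

/-- The coadjoint action on the generators of `S(𝔤^*)`:
`g·Θᵃ = Θᵃ ∘ Ad(g⁻¹) = ∑_c Θᵃ(Ad(g⁻¹) ξ_c) Θᶜ`. -/
def coadTheta (g : G) (a : Fin k) : PolyForm I W k :=
  ∑ c, b.coord a (Ad g⁻¹ (b c)) • Theta c

/-- The diagonal action of `g` on `S(𝔤^*) ⊗ ΛT^*W`. -/
def actPoly (g : G) : PolyForm I W k →ₗ[ℝ] PolyForm I W k :=
  substitute (coadTheta I b g) (actForm I g)

/-- The contraction `ι_a` with the vector field of `ξ_a`. -/
def iota (a : Fin k) : FormField I W →ₗ[ℝ] FormField I W := contract (fundField I (b a))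

variable [FiniteDimensional ℝ E]

/-- `Ω_G(W) = (S(𝔤^*) ⊗ Ω(W))^G`. -/
def EquivForms : Submodule ℝ (PolyForm I W k) where
  carrier := {α | (∀ m, α.coeff m ∈ SmoothForms I) ∧ ∀ g : G, actPoly I b g α = α}
  zero_mem' := ⟨fun m ↦ by simp, fun g ↦ by simp⟩
  add_mem' {α β} hα hβ :=
    ⟨fun m ↦ by simpa using add_mem (hα.1 m) (hβ.1 m), fun g ↦ by rw [map_add, hα.2, hβ.2]⟩
  smul_mem' c α hα :=
    ⟨fun m ↦ by simpa using Submodule.smul_mem _ c (hα.1 m), fun g ↦ by rw [map_smul, hα.2]⟩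

/-- The Cartan differential `D = 1 ⊗ d - Θᵃ ⊗ ι_a`. -/
def cartanD (α : PolyForm I W k) : PolyForm I W k :=
  .ofCoeff (α.coeff.mapRange (extD I) (extD_zero I)) - ∑ a, Theta a * mapCoeff (iota I b a) α

/-- The Cartan differential on `Ω_G(W)`. -/
def cartanDLin : EquivForms I b (W := W) →ₗ[ℝ] PolyForm I W k where
  toFun α := cartanD I b α
  map_add' α β := by
    have : (AddMonoidAlgebra.ofCoeff ((α + β : PolyForm I W k).coeff.mapRange (extD I)
        (extD_zero I)) : PolyForm I W k) =
        .ofCoeff ((α : PolyForm I W k).coeff.mapRange (extD I) (extD_zero I)) +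
        .ofCoeff ((β : PolyForm I W k).coeff.mapRange (extD I) (extD_zero I)) := by
      ext1; ext1 m
      simpa using extD_add I (α.2.1 m) (β.2.1 m)
    simp only [cartanD, Submodule.coe_add, this, map_add, mul_add, Finset.sum_add_distrib]
    abel
  map_smul' c α := by
    have : (AddMonoidAlgebra.ofCoeff ((c • α : PolyForm I W k).coeff.mapRange (extD I)
        (extD_zero I)) : PolyForm I W k) =
        c • .ofCoeff ((α : PolyForm I W k).coeff.mapRange (extD I) (extD_zero I)) := by
      ext1; ext1 m
      simpa using extD_smul I c (α.2.1 m)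
    simp only [cartanD, Submodule.coe_smul, this, map_smul, mul_smul_comm, RingHom.id_apply,
      smul_sub, Finset.smul_sum]

/-- The closed equivariant forms: the kernel of `D` on `Ω_G(W)`. -/
def Closed : Submodule ℝ (PolyForm I W k) where
  carrier := {α | α ∈ EquivForms I b (W := W) ∧ cartanD I b α = 0}
  zero_mem' := ⟨zero_mem _, (cartanDLin I b (W := W)).map_zero⟩
  add_mem' {α β} hα hβ := ⟨add_mem hα.1 hβ.1, by
    simpa [cartanDLin, hα.2, hβ.2] using (cartanDLin I b).map_add ⟨α, hα.1⟩ ⟨β, hβ.1⟩⟩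
  smul_mem' c α hα := ⟨Submodule.smul_mem _ c hα.1, by
    simpa [cartanDLin, hα.2] using (cartanDLin I b).map_smul c ⟨α, hα.1⟩⟩

/-- The closed equivariant forms that are `D` of an equivariant form. -/
def Exact : Submodule ℝ (Closed I b (W := W)) :=
  (LinearMap.range (cartanDLin I b)).comap (Closed I b).subtype

/-- The equivariant cohomology `H_G^*(W)` (Cartan model), all degrees together. -/
abbrev EquivCohomology (W : Type*) [TopologicalSpace W] [ChartedSpace H W] [MulAction G W] :
    Type _ :=
  Closed I b (W := W) ⧸ Exact I b (W := W)

/-- `Φ` maps `Ω_G(W)` to itself and commutes with `D` there. -/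
structure IsChainMap (Φ : PolyForm I W k →ₗ[ℝ] PolyForm I W k) : Prop where
  mapsTo : ∀ α ∈ EquivForms I b (W := W), Φ α ∈ EquivForms I b (W := W)
  comm : ∀ α ∈ EquivForms I b (W := W), cartanD I b (Φ α) = Φ (cartanD I b α)

variable {I b} in
/-- The map on closed equivariant forms given by a chain map. -/
def IsChainMap.closedMap {Φ : PolyForm I W k →ₗ[ℝ] PolyForm I W k} (h : IsChainMap I b Φ) :
    Closed I b (W := W) →ₗ[ℝ] Closed I b (W := W) :=
  Φ.restrict fun α hα ↦ ⟨h.mapsTo α hα.1, by rw [h.comm α hα.1, hα.2, map_zero]⟩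

variable {I b} in
/-- The map `Φ_*` on `H_G^*(W)` induced by a chain map. -/
def IsChainMap.induced {Φ : PolyForm I W k →ₗ[ℝ] PolyForm I W k} (h : IsChainMap I b Φ) :
    EquivCohomology I b W →ₗ[ℝ] EquivCohomology I b W :=
  Submodule.mapQ _ _ h.closedMap fun α hα ↦ by
    obtain ⟨β, hβ⟩ := hα
    refine ⟨⟨Φ β, h.mapsTo _ β.2⟩, ?_⟩
    change cartanD I b (Φ β) = Φ α
    rw [h.comm _ β.2]
    exact congrArg Φ hβ

variable (G W) in
/-- The set `W⁰` of points with zero-dimensional (that is, discrete) stabilizer; its complement is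
`Wˢ`. -/
def locallyFreeLocus : Set W := {x | DiscreteTopology (MulAction.stabilizer G x)}

/-- `ω` is a connection on `W⁰ → W⁰/G`: a smooth `𝔤`-valued 1-form on `W⁰` with
`ω(ξ_W) = ξ`, and `G`-invariant as an element of `𝔤 ⊗ Ω¹(W⁰)`. Values off `W⁰` are irrelevant. -/
structure IsConnection (conn : ∀ x : W, TangentSpace I x →ₗ[ℝ] LieAlg (EG := EG) G) : Prop where
  smooth : ∀ x ∈ locallyFreeLocus G W, ∀ l : Module.Dual ℝ (LieAlg (EG := EG) G),
    SmoothFormAt I (oneForm fun z ↦ l ∘ₗ conn z) x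
  vertical : ∀ x ∈ locallyFreeLocus G W, ∀ ξ, conn x (fundField I ξ x) = ξ
  equivariant : ∀ x ∈ locallyFreeLocus G W, ∀ (g : G) (v : TangentSpace I x),
    conn (g • x) (actDeriv I g x v) = Ad g (conn x v)

variable (G) in
/-- `f` is a smooth `G`-invariant function with values in `[0, 1]` that vanishes on a neighborhood
of `Wˢ`. -/
structure IsCutoff (f : W → ℝ) : Prop where
  smooth : ContMDiff I 𝓘(ℝ, ℝ) ∞ f
  mem_Icc : ∀ x, f x ∈ Set.Icc (0 : ℝ) 1
  invariant : ∀ (g : G) x, f (g • x) = f x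
  vanish : ∀ᶠ x in nhdsSet (locallyFreeLocus G W)ᶜ, f x = 0

variable (f : W → ℝ) (conn : ∀ x : W, TangentSpace I x →ₗ[ℝ] LieAlg (EG := EG) G)

/-- The 1-form `l(ω_f)`, for `l ∈ 𝔤^*`, where `ω_f = f ω` (which is `0` where `f = 0`). -/
def omegaF : Module.Dual ℝ (LieAlg (EG := EG) G) →ₗ[ℝ] FormField I W where
  toFun l := oneForm fun x ↦ f x • (l ∘ₗ conn x)
  map_add' l l' := by
    funext x; simp [oneForm, LinearMap.add_comp]
  map_smul' c l := by
    funext x; simp [oneForm, LinearMap.smul_comp, smul_comm c]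

/-- The components of the degenerate equivariant curvature
`Ω_f = dω_f + ½[ω_f, ω_f] - (-1 + f) ξ_a Θᵃ`; here `[ω_f, ω_f] = ω_fᵇ ∧ ω_fᶜ [ξ_b, ξ_c]`. -/
def curvF (a : Fin k) : PolyForm I W k :=
  constForm (extD I (omegaF I f conn (b.coord a)) +
    (1 / 2 : ℝ) • ∑ c, ∑ e, b.coord a ⁅b c, b e⁆ •
      (omegaF I f conn (b.coord c) * omegaF I f conn (b.coord e))) -
  constForm (fun x ↦ algebraMap ℝ _ (-1 + f x)) * Theta a

variable (G W k) in
/-- `W(𝔤) ⊗ ΛT^*W`, where `W(𝔤) = Λ(𝔤^*) ⊗ S(𝔤^*)` is the Weil algebra. -/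
abbrev WeilForm : Type _ :=
  ExteriorAlgebra ℝ (Module.Dual ℝ (LieAlg (EG := EG) G)) ⊗[ℝ] PolyForm I W k

/-- The operator `θᵃ ⊗ ι_a` on `W(𝔤) ⊗ ΛT^*W` (no summation); by the sign rule
`(θᵃ ⊗ ι_a)(w ⊗ η) = (-1)^{deg w} θᵃ w ⊗ ι_a η`. -/
def thetaIota (a : Fin k) : Module.End ℝ (WeilForm (EG := EG) G I W k) :=
  TensorProduct.map
    (LinearMap.mulLeft ℝ (ExteriorAlgebra.ι ℝ (b.coord a)) ∘ₗ
      (CliffordAlgebra.involute (Q := (0 : QuadraticForm ℝ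
        (Module.Dual ℝ (LieAlg (EG := EG) G))))).toLinearMap)
    (mapCoeff (iota I b a))

/-- `Ψ = ∏_a (1 - θᵃ ⊗ ι_a)`. -/
def Psi : Module.End ℝ (WeilForm (EG := EG) G I W k) :=
  ((List.finRange k).map fun a ↦ 1 - thetaIota I b a).prod

/-- The algebra homomorphism `Λ(𝔤^*) → S(𝔤^*) ⊗ ΛT^*W`, `θᵃ ↦ ω_fᵃ`. -/
def extOmegaF : ExteriorAlgebra ℝ (Module.Dual ℝ (LieAlg (EG := EG) G)) →ₐ[ℝ] PolyForm I W k :=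
  ExteriorAlgebra.lift ℝ ⟨AddMonoidAlgebra.lsingle 0 ∘ₗ omegaF I f conn, fun l ↦ by
    have : omegaF I f conn l * omegaF I f conn l = 0 := by
      funext x; simp [omegaF, oneForm]
    simp [AddMonoidAlgebra.single_mul_single, this]⟩

/-- The Chern-Weil construction `W(𝔤) ⊗ ΛT^*W → S(𝔤^*) ⊗ ΛT^*W`: the map of modules over the forms
with `θᵃ ↦ ω_fᵃ` and `Θᵃ ↦ Ω_fᵃ`, multiplicative on `W(𝔤)`. -/
def chernWeilF : WeilForm (EG := EG) G I W k →ₗ[ℝ] PolyForm I W k :=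
  TensorProduct.lift
    ((LinearMap.mul ℝ (PolyForm I W k)).compl₂ (substitute (curvF I b f conn) LinearMap.id) ∘ₗ
      (extOmegaF I f conn).toLinearMap)

/-- The map `r_f^G(α) = CW_f(Ψ(α))`. -/
def rF : PolyForm I W k →ₗ[ℝ] PolyForm I W k :=
  chernWeilF I b f conn ∘ₗ Psi I b ∘ₗ
    TensorProduct.mk ℝ (ExteriorAlgebra ℝ (Module.Dual ℝ (LieAlg (EG := EG) G))) _ 1

end Action

end DegenerateChernWeil

end

open scoped Manifold ContDiff TensorProduct

set_option maxSynthPendingDepth 3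

noncomputable section

/-! Verticality gives ι_c ω_fᵃ = f δᵃ_c, so D ω_fᵃ = dω_fᵃ − f Θᵃ and the curvature becomes Ω_f =
Dω_f + ½[ω_f, ω_f] + Θ (`curvF_eq`). In this form f may be replaced by tf for any real t. The
curvature then moves from Θ at t = 0 to Ω_f at t = 1, and the maps r_{tf} join the identity
(`rPath_zero`) to r_f. The theorem is the homotopy invariance of this path.

What makes r_f tractable is that substituting ω_f for θ turns Ψ into the pullback of forms along the
endomorphism v ↦ v − (fω(v))_W of TW. Indeed a rank-one change of a linear map changes its pullback
by a single term φ ∧ ι_u (`pullExt_sub_smulRight`). The curvature is even, hence central, so r_f is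
an algebra homomorphism (`rF_eq`, `rF_mul`). Since W is compact, functions h, differentials dh and
the variables Θᵃ generate S(𝔤^*) ⊗ Ω(W) (`smoothPolys_induction`), and identities between
derivations along r_f need only be checked on these generators.

The generators are not invariant, so the identities carry correction terms in the derivatives L_c of
the action along ξ_c. On all of S(𝔤^*) ⊗ Ω(W), D r_f α = r_f D α + ω_fᶜ r_f(L_c α), d/dt r_{tf} α =
D K_t α + K_t D α − t ω_fᶜ K_t(L_c α), where K_t = ω_fᵃ r_{tf} ∂/∂Θᵃ. The first is checked in
`exists_isLieDerivFamily`. On dh it expresses the commutators of the fundamental fields, and on Θ it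
is the Bianchi identity `cartanD_curvF`, which rests on the value of D²ω_f and on Jacobi. The second
is checked in `exists_homotopyFormula`. For invariant α the corrections vanish: with equivariance
(`actPoly_rF`) the first formula makes r_f a chain map, and for closed invariant α the second
integrates to r_f α − α = D ∫₀¹ K_t α dt. All paths are polynomial in t, so this integral is
algebraic (`sub_mem_range_of_isPolyPath`).

The analytic input is Cartan's formula for the derivative of the action on forms
(`hasDerivAt_actForm`) and the identification of the derivative of Ad with the bracket
(`IsCurve.hasDerivAt_Ad`). Both depend only on the velocity of a curve at 1, so straight lines in a
chart of G replace the exponential map. -/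

namespace DegenerateChernWeil

/-! ### Exterior algebra of one vector space: signs, contractions, pullbacks. -/

section PointwiseAlgebra

variable {M : Type*} [AddCommGroup M] [Module ℝ M]

/-- The grading involution of the exterior algebra. -/
abbrev gradInv : ExteriorAlgebra ℝ M →ₐ[ℝ] ExteriorAlgebra ℝ M :=
  CliffordAlgebra.involute (Q := (0 : QuadraticForm ℝ M))

theorem gradInv_ι (v : M) : gradInv (ExteriorAlgebra.ι ℝ v) = -ExteriorAlgebra.ι ℝ v :=
  CliffordAlgebra.involute_ι v

theorem gradInv_gradInv (x : ExteriorAlgebra ℝ M) : gradInv (gradInv x) = x :=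
  CliffordAlgebra.involute_involute x

theorem ι_mul_ι_swap (v w : M) :
    ExteriorAlgebra.ι ℝ v * ExteriorAlgebra.ι ℝ w =
      -(ExteriorAlgebra.ι ℝ w * ExteriorAlgebra.ι ℝ v) :=
  eq_neg_of_add_eq_zero_left (ExteriorAlgebra.ι_add_mul_swap v w)

/-- The sign rule for one covector. The involution carries the sign, so forms of mixed degree need
not be split into homogeneous parts. -/
theorem ι_mul_eq (v : M) (x : ExteriorAlgebra ℝ M) :
    ExteriorAlgebra.ι ℝ v * x = gradInv x * ExteriorAlgebra.ι ℝ v := by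
  induction x using ExteriorAlgebra.induction with
  | algebraMap r => simpa using (Algebra.commutes r (ExteriorAlgebra.ι ℝ v)).symm
  | ι w => rw [gradInv_ι, ι_mul_ι_swap, neg_mul]
  | mul x y hx hy => rw [← mul_assoc, hx, mul_assoc, hy, map_mul, mul_assoc]
  | add x y hx hy => rw [mul_add, hx, hy, map_add, add_mul]

/-- The exterior algebra is graded commutative. -/
theorem two_mul_mul_eq (x y : ExteriorAlgebra ℝ M) :
    (2 : ℝ) • (x * y) = y * (x + gradInv x) + gradInv y * (x - gradInv x) := by
  -- With even and odd parts x₀ and x₁ of `x`, the sum and difference with `gradInv x` are 2x₀ and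
  -- 2x₁; the claim is xy = y x₀ + ȳ x₁ cleared of denominators.
  induction x using ExteriorAlgebra.induction generalizing y with
  | algebraMap r =>
    simp only [AlgHom.commutes, sub_self, mul_zero, add_zero, two_smul, mul_add,
      Algebra.commutes]
  | ι v => rw [gradInv_ι, ι_mul_eq]; simp [two_smul, mul_add]
  | mul x₁ x₂ h₁ h₂ =>
    have e₂ : ∀ z, x₂ * z = (2⁻¹ : ℝ) • (z * (x₂ + gradInv x₂) + gradInv z * (x₂ - gradInv x₂)) :=
      fun z ↦ by rw [← h₂, smul_smul]; norm_num
    have e₁ : ∀ z, x₁ * z = (2⁻¹ : ℝ) • (z * (x₁ + gradInv x₁) + gradInv z * (x₁ - gradInv x₁)) :=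
      fun z ↦ by rw [← h₁, smul_smul]; norm_num
    rw [mul_assoc, e₂ y, e₁, map_smul, map_add, map_mul, map_mul, gradInv_gradInv, map_add, map_sub,
      gradInv_gradInv, map_mul, smul_smul, smul_mul_assoc, smul_mul_assoc, ← smul_add, smul_smul]
    -- `x₁` passes the even part of `x₂` unchanged and is conjugated when it passes the odd part.
    have c₁ : x₁ * (x₂ + gradInv x₂) = (x₂ + gradInv x₂) * x₁ := by
      rw [e₁]; simp only [map_add, gradInv_gradInv]
      rw [add_comm (gradInv x₂), ← mul_add, add_add_sub_cancel, ← two_smul ℝ x₁, mul_smul_comm,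
        smul_smul]; norm_num
    have c₁' : gradInv x₁ * (x₂ + gradInv x₂) = (x₂ + gradInv x₂) * gradInv x₁ := by
      have := congrArg gradInv c₁
      simpa only [map_mul, map_add, gradInv_gradInv, add_comm (gradInv x₂)] using this
    have c₂ : x₁ * (x₂ - gradInv x₂) = (x₂ - gradInv x₂) * gradInv x₁ := by
      rw [e₁]; simp only [map_sub, gradInv_gradInv]
      rw [← neg_sub x₂ (gradInv x₂), neg_mul, ← sub_eq_add_neg, ← mul_sub, add_sub_sub_cancel,
        ← two_smul ℝ (gradInv x₁), mul_smul_comm, smul_smul]; norm_num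
    have c₂' : gradInv x₁ * (x₂ - gradInv x₂) = (x₂ - gradInv x₂) * x₁ := by
      have := congrArg gradInv c₂
      simp only [map_mul, map_sub, gradInv_gradInv] at this
      rw [← neg_sub x₂ (gradInv x₂), mul_neg, neg_mul, neg_inj] at this
      exact this
    rw [show (2 : ℝ) * 2⁻¹ * 2⁻¹ = 2⁻¹ by norm_num]
    have k₁ : (y * (x₁ * x₂ + gradInv x₁ * gradInv x₂)) =
        (2⁻¹ : ℝ) • (y * ((x₁ + gradInv x₁) * (x₂ + gradInv x₂)) +
          y * ((x₁ - gradInv x₁) * (x₂ - gradInv x₂))) := by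
      rw [← mul_add, ← mul_smul_comm]; congr 1
      rw [eq_inv_smul_iff₀ two_ne_zero, two_smul]; noncomm_ring
    have k₂ : (gradInv y * (x₁ * x₂ - gradInv x₁ * gradInv x₂)) =
        (2⁻¹ : ℝ) • (gradInv y * ((x₁ + gradInv x₁) * (x₂ - gradInv x₂)) +
          gradInv y * ((x₁ - gradInv x₁) * (x₂ + gradInv x₂))) := by
      rw [← mul_add, ← mul_smul_comm]; congr 1
      rw [eq_inv_smul_iff₀ two_ne_zero, two_smul]; noncomm_ring
    rw [k₁, k₂, ← smul_add]
    congr 1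
    rw [add_mul x₁, sub_mul x₁, add_mul x₁, sub_mul x₁, c₁, c₁', c₂, c₂']
    noncomm_ring
  | add x₁ x₂ h₁ h₂ => rw [add_mul, smul_add, h₁, h₂, map_add]; noncomm_ring

theorem mul_comm_of_even {x : ExteriorAlgebra ℝ M} (hx : gradInv x = x) (y) : x * y = y * x := by
  have h := two_mul_mul_eq x y
  rw [hx, sub_self, mul_zero, add_zero, ← two_smul ℝ x, mul_smul_comm] at h
  exact smul_right_injective _ two_ne_zero h

theorem contractExt_mul {V : Type*} [AddCommGroup V] [Module ℝ V] (v : V)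
    (x y : ExteriorAlgebra ℝ (Module.Dual ℝ V)) :
    contractExt v (x * y) = contractExt v x * y + gradInv x * contractExt v y := by
  induction x using ExteriorAlgebra.induction generalizing y with
  | algebraMap r => simp [contractExt, CliffordAlgebra.contractLeft_algebraMap_mul]
  | ι l =>
    rw [gradInv_ι]
    simp only [contractExt, ExteriorAlgebra.ι]
    rw [CliffordAlgebra.contractLeft_ι_mul, CliffordAlgebra.contractLeft_ι, neg_mul,
      ← sub_eq_add_neg, Algebra.smul_def]
  | mul x₁ x₂ h₁ h₂ => rw [mul_assoc, h₁, h₂, h₁, map_mul]; noncomm_ring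
  | add x₁ x₂ h₁ h₂ => rw [add_mul, map_add, h₁, h₂, map_add, map_add]; noncomm_ring

theorem contractExt_ι {V : Type*} [AddCommGroup V] [Module ℝ V] (v : V) (l : Module.Dual ℝ V) :
    contractExt v (ExteriorAlgebra.ι ℝ l) = algebraMap ℝ _ (l v) :=
  CliffordAlgebra.contractLeft_ι _ _ _

theorem contractExt_algebraMap {V : Type*} [AddCommGroup V] [Module ℝ V] (v : V) (r : ℝ) :
    contractExt v (algebraMap ℝ _ r) = 0 :=
  CliffordAlgebra.contractLeft_algebraMap _ _ _

theorem gradInv_contractExt {V : Type*} [AddCommGroup V] [Module ℝ V] (v : V)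
    (x : ExteriorAlgebra ℝ (Module.Dual ℝ V)) :
    gradInv (contractExt v x) = -contractExt v (gradInv x) := by
  induction x using ExteriorAlgebra.induction with
  | algebraMap r => simp [contractExt_algebraMap]
  | ι l => rw [gradInv_ι, map_neg, contractExt_ι, neg_neg, AlgHom.commutes]
  | mul x₁ x₂ h₁ h₂ =>
    rw [contractExt_mul, map_add, map_mul, map_mul, h₁, h₂, map_mul, contractExt_mul]; noncomm_ring
  | add x₁ x₂ h₁ h₂ => rw [map_add, map_add, h₁, h₂, map_add, map_add, neg_add]

variable {V V' V'' : Type*} [AddCommGroup V] [Module ℝ V] [AddCommGroup V'] [Module ℝ V']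
  [AddCommGroup V''] [Module ℝ V'']

theorem pullExt_ι (A : V →ₗ[ℝ] V') (l : Module.Dual ℝ V') :
    pullExt A (ExteriorAlgebra.ι ℝ l) = ExteriorAlgebra.ι ℝ (l ∘ₗ A) := by
  rw [pullExt, ExteriorAlgebra.map_apply_ι]; rfl

theorem pullExt_pullExt (A : V →ₗ[ℝ] V') (B : V' →ₗ[ℝ] V'')
    (x : ExteriorAlgebra ℝ (Module.Dual ℝ V'')) :
    pullExt A (pullExt B x) = pullExt (B ∘ₗ A) x := by
  have : (pullExt A).comp (pullExt B) = pullExt (B ∘ₗ A) := by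
    apply ExteriorAlgebra.hom_ext
    ext l
    simp only [LinearMap.comp_apply, AlgHom.toLinearMap_apply, AlgHom.comp_apply, pullExt_ι]
    rfl
  exact DFunLike.congr_fun this x

theorem pullExt_id (x : ExteriorAlgebra ℝ (Module.Dual ℝ V)) :
    pullExt LinearMap.id x = x := by
  have : pullExt LinearMap.id = AlgHom.id ℝ (ExteriorAlgebra ℝ (Module.Dual ℝ V)) := by
    apply ExteriorAlgebra.hom_ext
    ext l
    simp only [LinearMap.comp_apply, AlgHom.toLinearMap_apply, pullExt_ι]
    rfl
  exact DFunLike.congr_fun this x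

theorem gradInv_pullExt (A : V →ₗ[ℝ] V') (x : ExteriorAlgebra ℝ (Module.Dual ℝ V')) :
    gradInv (pullExt A x) = pullExt A (gradInv x) := by
  have : gradInv.comp (pullExt A) = (pullExt A).comp gradInv := by
    apply ExteriorAlgebra.hom_ext
    ext l
    simp only [LinearMap.comp_apply, AlgHom.toLinearMap_apply, AlgHom.comp_apply, pullExt_ι,
      gradInv_ι, map_neg]
  exact DFunLike.congr_fun this x

theorem contractExt_pullExt (A : V →ₗ[ℝ] V') (v : V) (x : ExteriorAlgebra ℝ (Module.Dual ℝ V')) :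
    contractExt v (pullExt A x) = pullExt A (contractExt (A v) x) := by
  induction x using ExteriorAlgebra.induction with
  | algebraMap r => simp [contractExt_algebraMap]
  | ι l => rw [pullExt_ι, contractExt_ι, contractExt_ι, AlgHom.commutes]; rfl
  | mul x₁ x₂ h₁ h₂ =>
    rw [map_mul, contractExt_mul, h₁, h₂, contractExt_mul, map_add, map_mul, map_mul,
      gradInv_pullExt]
  | add x₁ x₂ h₁ h₂ => rw [map_add, map_add, h₁, h₂, map_add, map_add]

theorem contractExt_add (v w : V) (x : ExteriorAlgebra ℝ (Module.Dual ℝ V)) :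
    contractExt (v + w) x = contractExt v x + contractExt w x := by
  simp [contractExt]

theorem contractExt_smul (c : ℝ) (v : V) (x : ExteriorAlgebra ℝ (Module.Dual ℝ V)) :
    contractExt (c • v) x = c • contractExt v x := by
  simp [contractExt]

end PointwiseAlgebra

/-! ### Derivatives of products in the exterior algebra. -/

section Calculus

variable {M : Type*} [AddCommGroup M] [Module ℝ M] [FiniteDimensional ℝ M]

instance instFiniteDimensionalExteriorAlgebra : FiniteDimensional ℝ (ExteriorAlgebra ℝ M) :=
  Module.Basis.finiteDimensional_of_finite (Module.finBasis ℝ M).ExteriorAlgebra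

/-- A bilinear map between finite-dimensional spaces, as a continuous one. -/
def bilinCLM {X Y Z : Type*} [NormedAddCommGroup X] [NormedSpace ℝ X] [FiniteDimensional ℝ X]
    [NormedAddCommGroup Y] [NormedSpace ℝ Y] [FiniteDimensional ℝ Y]
    [NormedAddCommGroup Z] [NormedSpace ℝ Z] (B : X →ₗ[ℝ] Y →ₗ[ℝ] Z) : X →L[ℝ] Y →L[ℝ] Z :=
  LinearMap.toContinuousLinearMap (LinearMap.toContinuousLinearMap.toLinearMap ∘ₗ B)

@[simp] theorem bilinCLM_apply {X Y Z : Type*} [NormedAddCommGroup X] [NormedSpace ℝ X]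
    [FiniteDimensional ℝ X]
    [NormedAddCommGroup Y] [NormedSpace ℝ Y] [FiniteDimensional ℝ Y]
    [NormedAddCommGroup Z] [NormedSpace ℝ Z] (B : X →ₗ[ℝ] Y →ₗ[ℝ] Z) (x : X) (y : Y) :
    bilinCLM B x y = B x y := rfl

variable {F : Type*} [NormedAddCommGroup F] [NormedSpace ℝ F]

theorem contDiffWithinAt_ext_mul {u v : F → ExteriorAlgebra ℝ M} {s : Set F} {x : F} {n : ℕ∞ω}
    (hu : ContDiffWithinAt ℝ n u s x) (hv : ContDiffWithinAt ℝ n v s x) :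
    ContDiffWithinAt ℝ n (fun y ↦ u y * v y) s x :=
  (bilinCLM (LinearMap.mul ℝ (ExteriorAlgebra ℝ M))).isBoundedBilinearMap.contDiff
    |>.comp_contDiffWithinAt (hu.prodMk hv)

theorem hasFDerivWithinAt_ext_mul {u v : F → ExteriorAlgebra ℝ M} {s : Set F} {x : F}
    {u' v' : F →L[ℝ] ExteriorAlgebra ℝ M}
    (hu : HasFDerivWithinAt u u' s x) (hv : HasFDerivWithinAt v v' s x) :
    HasFDerivWithinAt (fun y ↦ u y * v y)
      (bilinCLM (LinearMap.mul ℝ (ExteriorAlgebra ℝ M)) (u x) ∘L v' +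
        (bilinCLM (LinearMap.mul ℝ (ExteriorAlgebra ℝ M))).flip (v x) ∘L u') s x := by
  have := (bilinCLM (LinearMap.mul ℝ (ExteriorAlgebra ℝ M))).hasFDerivWithinAt_of_bilinear hu hv
  refine this.congr_fderiv ?_
  ext z; simp

theorem hasDerivAt_ext_mul {u v : ℝ → ExteriorAlgebra ℝ M} {t : ℝ} {u' v' : ExteriorAlgebra ℝ M}
    (hu : HasDerivAt u u' t) (hv : HasDerivAt v v' t) :
    HasDerivAt (fun y ↦ u y * v y) (u' * v t + u t * v') t := by
  have := (bilinCLM (LinearMap.mul ℝ (ExteriorAlgebra ℝ M))).hasFDerivAt_of_bilinear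
    hu.hasFDerivAt hv.hasFDerivAt
  refine (this.hasDerivAt).congr_deriv ?_
  simp [add_comm]

theorem hasDerivAt_linear {X Y : Type*} [NormedAddCommGroup X] [NormedSpace ℝ X]
    [FiniteDimensional ℝ X] [NormedAddCommGroup Y] [NormedSpace ℝ Y] (A : X →ₗ[ℝ] Y)
    {u : ℝ → X} {u' : X} {t : ℝ} (hu : HasDerivAt u u' t) :
    HasDerivAt (fun s ↦ A (u s)) (A u') t :=
  (LinearMap.toContinuousLinearMap A).hasFDerivAt.comp_hasDerivAt t hu

end Calculus

/-! ### Forms in charts and the flat exterior derivative. -/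

section FormCalculus

open Set Filter Topology

variable {E : Type*} [NormedAddCommGroup E] [NormedSpace ℝ E] {H : Type*} [TopologicalSpace H]
  {I : ModelWithCorners ℝ E H} {W : Type*} [TopologicalSpace W] [ChartedSpace H W]

instance instFiniteDimensionalTangentSpace [FiniteDimensional ℝ E] (x : W) :
    FiniteDimensional ℝ (TangentSpace I x) :=
  inferInstanceAs (FiniteDimensional ℝ E)

variable (I W) in
/-- The grading involution on fields of forms. -/
def formInv : FormField I W →ₐ[ℝ] FormField I W :=
  AlgHom.pi fun x ↦ gradInv.comp (Pi.evalAlgHom ℝ _ x)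

theorem formInv_formInv (η : FormField I W) : formInv I W (formInv I W η) = η := by
  funext x; exact gradInv_gradInv _

variable (I) in
/-- A function, as a form of degree `0`. -/
def fnForm (h : W → ℝ) : FormField I W := fun x ↦ algebraMap ℝ _ (h x)

variable (I) in
/-- The differential of a function at a point, as a linear form. -/
def dFn (h : W → ℝ) (x : W) : Module.Dual ℝ (TangentSpace I x) := (mvfderiv I h x).toLinearMap

theorem inChart_mul (x : W) (η η' : FormField I W) :
    inChart I x (η * η') = fun y ↦ inChart I x η y * inChart I x η' y := by
  funext y; exact map_mul _ _ _

theorem inChart_formInv (x : W) (η : FormField I W) :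
    inChart I x (formInv I W η) = fun y ↦ gradInv (inChart I x η y) := by
  funext y; exact (gradInv_pullExt _ _).symm

theorem inChart_fnForm (x : W) (h : W → ℝ) :
    inChart I x (fnForm I h) = fun y ↦ algebraMap ℝ _ (h ((extChartAt I x).symm y)) := by
  funext y; exact AlgHom.commutes _ _

/-- All tangent spaces are the model space `E`, so a map between fibres at equal points can be
compared with the identity. This absorbs the round trip through a chart and its inverse, which fixes
the base point only propositionally. -/
theorem pullExt_of_eq {z z' : W} (hz : z' = z) (A : TangentSpace I z →ₗ[ℝ] TangentSpace I z')
    (hA : ∀ v : E, (A v : E) = v) (η : FormField I W) : pullExt A (η z') = η z := by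
  subst hz
  have : A = LinearMap.id := LinearMap.ext hA
  rw [this, pullExt_id]

variable (I) in
/-- The derivative at `z` of the chart at `x`. -/
def chartDerivAt (x z : W) : TangentSpace I z →ₗ[ℝ] E :=
  (mfderiv I 𝓘(ℝ, E) (extChartAt I x) z).toLinearMap

/-- A form is recovered from its expression in a chart. -/
theorem pullExt_inChart [IsManifold I 1 W] {x z : W} (hz : z ∈ (extChartAt I x).source)
    (η : FormField I W) :
    pullExt (chartDerivAt I x z) (inChart I x η (extChartAt I x z)) = η z := by
  unfold inChart
  rw [pullExt_pullExt]
  refine pullExt_of_eq ((extChartAt I x).left_inv hz) _ (fun v ↦ ?_) η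
  exact DFunLike.congr_fun (mfderivWithin_extChartAt_symm_comp_mfderiv_extChartAt' (I := I) hz) v

variable [FiniteDimensional ℝ E]

theorem SmoothFormAt.mul {η η' : FormField I W} {x : W} (h : SmoothFormAt I η x)
    (h' : SmoothFormAt I η' x) : SmoothFormAt I (η * η') x := by
  rw [SmoothFormAt, inChart_mul]; exact contDiffWithinAt_ext_mul h h'

theorem smooth_mul {η η' : FormField I W} (h : η ∈ SmoothForms I)
    (h' : η' ∈ SmoothForms I) : η * η' ∈ SmoothForms I := fun x ↦ (h x).mul (h' x)

theorem smooth_formInv {η : FormField I W} (h : η ∈ SmoothForms I) :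
    formInv I W η ∈ SmoothForms I := fun x ↦ by
  rw [SmoothFormAt, inChart_formInv]
  exact (LinearMap.toContinuousLinearMap (gradInv (M := Module.Dual ℝ E)).toLinearMap).contDiff
    |>.comp_contDiffWithinAt (h x)

theorem smoothFormAt_fnForm {h : W → ℝ} {x : W} (hh : ContMDiffAt I 𝓘(ℝ, ℝ) ∞ h x) :
    SmoothFormAt I (fnForm I h) x := by
  rw [SmoothFormAt, inChart_fnForm]
  have := (contMDiffAt_iff.1 hh).2
  exact (LinearMap.toContinuousLinearMap
    (Algebra.linearMap ℝ (ExteriorAlgebra ℝ (Module.Dual ℝ E)))).contDiff.comp_contDiffWithinAt this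

theorem smooth_fnForm {h : W → ℝ} (hh : ContMDiff I 𝓘(ℝ, ℝ) ∞ h) : fnForm I h ∈ SmoothForms I :=
  fun x ↦ smoothFormAt_fnForm (hh x)

section Flat

theorem eq_zero_of_eq_neg {X : Type*} [AddCommGroup X] [Module ℝ X] {x : X} (h : x = -x) :
    x = 0 := by
  have : (2 : ℝ) • x = 0 := by rw [two_smul]; nth_rw 2 [h]; exact add_neg_cancel x
  exact (smul_eq_zero.1 this).resolve_left two_ne_zero

theorem flatExtDeriv_mul {s : Set E} {y : E} (hs : UniqueDiffWithinAt ℝ s y)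
    {u v : E → ExteriorAlgebra ℝ (Module.Dual ℝ E)} (hu : DifferentiableWithinAt ℝ u s y)
    (hv : DifferentiableWithinAt ℝ v s y) :
    flatExtDeriv s (fun z ↦ u z * v z) y =
      flatExtDeriv s u y * v y + gradInv (u y) * flatExtDeriv s v y := by
  simp only [flatExtDeriv, (hasFDerivWithinAt_ext_mul hu.hasFDerivWithinAt
    hv.hasFDerivWithinAt).fderivWithin hs]
  rw [Finset.sum_mul, Finset.mul_sum, ← Finset.sum_add_distrib]
  refine Finset.sum_congr rfl fun i _ ↦ ?_
  simp only [add_apply, ContinuousLinearMap.comp_apply, bilinCLM_apply,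
    LinearMap.mul_apply', ContinuousLinearMap.flip_apply]
  rw [mul_add, ← mul_assoc, ι_mul_eq, mul_assoc, mul_assoc, add_comm]

theorem flatExtDeriv_gradInv {s : Set E} {y : E} (hs : UniqueDiffWithinAt ℝ s y)
    {u : E → ExteriorAlgebra ℝ (Module.Dual ℝ E)} (hu : DifferentiableWithinAt ℝ u s y) :
    flatExtDeriv s (fun z ↦ gradInv (u z)) y = -gradInv (flatExtDeriv s u y) := by
  have : HasFDerivWithinAt (fun z ↦ gradInv (u z))
      ((LinearMap.toContinuousLinearMap (gradInv (M := Module.Dual ℝ E)).toLinearMap) ∘L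
        fderivWithin ℝ u s y) s y :=
    (LinearMap.toContinuousLinearMap (gradInv (M := Module.Dual ℝ E)).toLinearMap).hasFDerivAt
      |>.comp_hasFDerivWithinAt y hu.hasFDerivWithinAt
  simp only [flatExtDeriv, this.fderivWithin hs]
  rw [map_sum, ← Finset.sum_neg_distrib]
  refine Finset.sum_congr rfl fun i _ ↦ ?_
  rw [map_mul, gradInv_ι, neg_mul, neg_neg]; rfl

theorem sum_coord_smul {X : Type*} [AddCommGroup X] [Module ℝ X] [FiniteDimensional ℝ X]
    (l : Module.Dual ℝ X) :
    ∑ i, l (Module.finBasis ℝ X i) • (Module.finBasis ℝ X).coord i = l := by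
  refine (Module.finBasis ℝ X).ext fun j ↦ ?_
  simp

theorem flatExtDeriv_algebraMap {s : Set E} {y : E} (hs : UniqueDiffWithinAt ℝ s y)
    {φ : E → ℝ} (hu : DifferentiableWithinAt ℝ φ s y) :
    flatExtDeriv s (fun z ↦ algebraMap ℝ _ (φ z)) y =
      ExteriorAlgebra.ι ℝ (fderivWithin ℝ φ s y).toLinearMap := by
  have : HasFDerivWithinAt
      (fun z ↦ algebraMap ℝ (ExteriorAlgebra ℝ (Module.Dual ℝ E)) (φ z))
      ((LinearMap.toContinuousLinearMap
    (Algebra.linearMap ℝ (ExteriorAlgebra ℝ (Module.Dual ℝ E)))) ∘L fderivWithin ℝ φ s y) s y :=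
    (LinearMap.toContinuousLinearMap
      (Algebra.linearMap ℝ (ExteriorAlgebra ℝ (Module.Dual ℝ E)))).hasFDerivAt
      |>.comp_hasFDerivWithinAt y hu.hasFDerivWithinAt
  simp only [flatExtDeriv, this.fderivWithin hs]
  conv_rhs => rw [← sum_coord_smul (fderivWithin ℝ φ s y).toLinearMap, map_sum]
  refine Finset.sum_congr rfl fun i _ ↦ ?_
  rw [map_smul, Algebra.smul_def, Algebra.commutes]
  rfl

/-- `d² = 0` on functions. -/
theorem flatExtDeriv_ι_fderivWithin {s : Set E} {y : E} (hs : UniqueDiffOn ℝ s)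
    (hc : y ∈ closure (interior s)) (hy : y ∈ s)
    {φ : E → ℝ} (hφ : ContDiffWithinAt ℝ ∞ φ s y) :
    flatExtDeriv s (fun z ↦ ExteriorAlgebra.ι ℝ (fderivWithin ℝ φ s z).toLinearMap) y = 0 := by
  have hd : DifferentiableWithinAt ℝ (fderivWithin ℝ φ s) s y :=
    (hφ.fderivWithin_right (m := 1) hs (by norm_cast) hy).differentiableWithinAt
      (by norm_num)
  -- At boundary points the symmetry of the second derivative comes from nearby interior points;
  -- this is the role of `hc`.
  have hsymm : IsSymmSndFDerivWithinAt ℝ φ s y :=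
    hφ.isSymmSndFDerivWithinAt
      (by
          rw [minSmoothness_of_isRCLikeNormedField]
          exact WithTop.coe_le_coe.2 (le_top : (2 : ℕ∞) ≤ ⊤)) hs hc hy
  let A : (E →L[ℝ] ℝ) →ₗ[ℝ] ExteriorAlgebra ℝ (Module.Dual ℝ E) :=
    ExteriorAlgebra.ι ℝ ∘ₗ ContinuousLinearMap.coeLM ℝ
  have : HasFDerivWithinAt (fun z ↦ ExteriorAlgebra.ι ℝ (fderivWithin ℝ φ s z).toLinearMap)
      ((LinearMap.toContinuousLinearMap A) ∘L fderivWithin ℝ (fderivWithin ℝ φ s) s y) s y :=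
    (LinearMap.toContinuousLinearMap A).hasFDerivAt.comp_hasFDerivWithinAt y hd.hasFDerivWithinAt
  simp only [flatExtDeriv, this.fderivWithin (hs y hy)]
  set e := Module.finBasis ℝ E
  set B := fderivWithin ℝ (fderivWithin ℝ φ s) s y
  have key : ∀ i, (((LinearMap.toContinuousLinearMap A) ∘L B) (e i)) =
      ∑ j, B (e i) (e j) • ExteriorAlgebra.ι ℝ (e.coord j) := fun i ↦ by
    change ExteriorAlgebra.ι ℝ ((B (e i)).toLinearMap) = _
    conv_lhs => rw [← sum_coord_smul (B (e i)).toLinearMap, map_sum]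
    simp only [map_smul]
    rfl
  simp only [key, Finset.mul_sum, mul_smul_comm]
  -- The Hessian is symmetric and covectors anticommute, so exchanging the indices turns the sum
  -- into its negative.
  have h2 : ∑ i, ∑ j, B (e i) (e j) • (ExteriorAlgebra.ι ℝ (e.coord i) *
      ExteriorAlgebra.ι ℝ (e.coord j)) = -∑ i, ∑ j, B (e i) (e j) •
        (ExteriorAlgebra.ι ℝ (e.coord i) * ExteriorAlgebra.ι ℝ (e.coord j)) := by
    conv_lhs => rw [Finset.sum_comm]
    rw [← Finset.sum_neg_distrib]
    refine Finset.sum_congr rfl fun i _ ↦ ?_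
    rw [← Finset.sum_neg_distrib]
    refine Finset.sum_congr rfl fun j _ ↦ ?_
    rw [ι_mul_ι_swap, smul_neg, hsymm (e j) (e i)]
  exact eq_zero_of_eq_neg h2

/-- Pullback is polynomial in the linear map, which settles a fixed form by induction on generators;
a varying form is expanded in a basis with smooth coordinates. -/
theorem contDiffWithinAt_pullExt {F : Type*} [NormedAddCommGroup F] [NormedSpace ℝ F]
    {A : F → E →L[ℝ] E} {ζ : F → ExteriorAlgebra ℝ (Module.Dual ℝ E)} {s : Set F} {y : F}
    (hA : ContDiffWithinAt ℝ ∞ A s y) (hζ : ContDiffWithinAt ℝ ∞ ζ s y) :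
    ContDiffWithinAt ℝ ∞ (fun z ↦ pullExt (A z).toLinearMap (ζ z)) s y := by
  have h1 : ∀ q, ContDiffWithinAt ℝ ∞ (fun z ↦ pullExt (A z).toLinearMap q) s y := fun q ↦ by
    induction q using ExteriorAlgebra.induction with
    | algebraMap r => simpa using contDiffWithinAt_const
    | ι l =>
      simp only [pullExt_ι]
      let B : (E →L[ℝ] E) →ₗ[ℝ] ExteriorAlgebra ℝ (Module.Dual ℝ E) :=
        ExteriorAlgebra.ι ℝ ∘ₗ (LinearMap.compRight ℝ l) ∘ₗ ContinuousLinearMap.coeLM ℝ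
      exact (LinearMap.toContinuousLinearMap B).contDiff.comp_contDiffWithinAt hA
    | mul a b ha hb => simpa only [map_mul] using contDiffWithinAt_ext_mul ha hb
    | add a b ha hb => simpa only [map_add] using ha.add hb
  set e := (Module.finBasis ℝ (Module.Dual ℝ E)).ExteriorAlgebra
  have : (fun z ↦ pullExt (A z).toLinearMap (ζ z)) = fun z ↦
      ∑ J, e.coord J (ζ z) • pullExt (A z).toLinearMap (e J) := by
    funext z
    conv_lhs => rw [← e.sum_repr (ζ z), map_sum]
    simp
  rw [this]
  refine ContDiffWithinAt.sum fun J _ ↦ ContDiffWithinAt.fun_smul ?_ (h1 _)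
  exact (LinearMap.toContinuousLinearMap (e.coord J)).contDiff.comp_contDiffWithinAt hζ

end Flat

end FormCalculus

/-! ### The exterior derivative on the manifold. -/

section FormCalculusManifold

open Set Filter Topology

variable {E : Type*} [NormedAddCommGroup E] [NormedSpace ℝ E] {H : Type*} [TopologicalSpace H]
  {I : ModelWithCorners ℝ E H} {W : Type*} [TopologicalSpace W] [ChartedSpace H W]

theorem mem_closure_interior_range (x : W) :
    extChartAt I x x ∈ closure (interior (range I)) :=
  I.range_subset_closure_interior (mem_range_self _)

theorem uniqueDiffWithinAt_range (x : W) : UniqueDiffWithinAt ℝ (range I) (extChartAt I x x) :=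
  I.uniqueDiffOn _ (mem_range_self _)

/-- The differential of a function in a chart. -/
theorem dFn_comp_chartInvDeriv [IsManifold I 1 W] {h : W → ℝ} {x : W} {y : E}
    (hy : y ∈ (extChartAt I x).target)
    (hh : MDifferentiableAt I 𝓘(ℝ, ℝ) h ((extChartAt I x).symm y)) :
    dFn I h ((extChartAt I x).symm y) ∘ₗ chartInvDeriv I x y =
      (fderivWithin ℝ (h ∘ (extChartAt I x).symm) (range I) y).toLinearMap := by
  have h1 := mfderiv_comp_mfderivWithin (I := 𝓘(ℝ, E)) (I' := I) (I'' := 𝓘(ℝ, ℝ)) y hh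
    (mdifferentiableWithinAt_extChartAt_symm hy)
    (I.uniqueMDiffOn _ (extChartAt_target_subset_range x hy))
  rw [mfderivWithin_eq_fderivWithin] at h1
  ext v
  exact (DFunLike.congr_fun h1 v).symm

theorem mdifferentiable_of_contMDiff {h : W → ℝ} (hh : ContMDiff I 𝓘(ℝ, ℝ) ∞ h) :
    MDifferentiable I 𝓘(ℝ, ℝ) h := ContMDiff.mdifferentiable hh (by simp)

variable [FiniteDimensional ℝ E]

/-- The derivative at `x` is computed in the chart at `x`, so the flat Leibniz rule transfers
without any change of charts. -/
theorem extD_mul [IsManifold I 1 W] {η η' : FormField I W} {x : W} (h : SmoothFormAt I η x)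
    (h' : SmoothFormAt I η' x) :
    extD I (η * η') x = extD I η x * η' x + gradInv (η x) * extD I η' x := by
  unfold extD
  rw [inChart_mul, flatExtDeriv_mul (uniqueDiffWithinAt_range x)
    (h.differentiableWithinAt (by simp)) (h'.differentiableWithinAt (by simp)), map_add, map_mul,
    map_mul, ← gradInv_pullExt]
  have e := fun ζ : FormField I W ↦ pullExt_inChart (mem_extChartAt_source (I := I) x) ζ
  change _ * pullExt (chartDerivAt I x x) _ +
    gradInv (pullExt (chartDerivAt I x x) _) * _ = _
  rw [e, e]

theorem extD_formInv {η : FormField I W} {x : W} (h : SmoothFormAt I η x) :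
    extD I (formInv I W η) x = -gradInv (extD I η x) := by
  unfold extD
  rw [inChart_formInv, flatExtDeriv_gradInv (uniqueDiffWithinAt_range x)
    (h.differentiableWithinAt (by simp)), map_neg, gradInv_pullExt]

theorem extD_fnForm [IsManifold I 1 W] {h : W → ℝ} {x : W} (hh : MDifferentiableAt I 𝓘(ℝ, ℝ) h x) :
    extD I (fnForm I h) x = ExteriorAlgebra.ι ℝ (dFn I h x) := by
  have e : (extChartAt I x).symm (extChartAt I x x) = x := extChartAt_to_inv x
  have hd : DifferentiableWithinAt ℝ (h ∘ (extChartAt I x).symm) (range I) (extChartAt I x x) :=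
    (mdifferentiableAt_iff _ _).1 hh |>.2
  have hh' : MDifferentiableAt I 𝓘(ℝ, ℝ) h ((extChartAt I x).symm (extChartAt I x x)) := by rwa [e]
  have h3 : extD I (fnForm I h) x = pullExt (chartDerivAt I x x)
      (inChart I x (fun z ↦ ExteriorAlgebra.ι ℝ (dFn I h z)) (extChartAt I x x)) := by
    unfold extD
    have h4 := flatExtDeriv_algebraMap (uniqueDiffWithinAt_range x) hd
    simp only [Function.comp_apply] at h4
    rw [inChart_fnForm, h4]
    unfold inChart
    rw [pullExt_ι (chartInvDeriv I x _), dFn_comp_chartInvDeriv (mem_extChartAt_target x) hh']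
    rfl
  rw [h3, pullExt_inChart (mem_extChartAt_source x)]

/-- In general `extD` uses a different chart at each point. For a function its value is the
intrinsic differential, so one chart describes it on a whole neighborhood and it can be
differentiated again. -/
theorem inChart_extD_fnForm [IsManifold I 1 W] {h : W → ℝ} (hh : MDifferentiable I 𝓘(ℝ, ℝ) h)
    (x : W) {y : E} (hy : y ∈ (extChartAt I x).target) :
    inChart I x (extD I (fnForm I h)) y =
      ExteriorAlgebra.ι ℝ (fderivWithin ℝ (h ∘ (extChartAt I x).symm) (range I) y).toLinearMap := by
  unfold inChart
  rw [extD_fnForm (hh _), pullExt_ι, dFn_comp_chartInvDeriv hy (hh _)]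

theorem inChart_extD_fnForm_eventuallyEq [IsManifold I 1 W] {h : W → ℝ}
    (hh : MDifferentiable I 𝓘(ℝ, ℝ) h) (x : W) :
    inChart I x (extD I (fnForm I h)) =ᶠ[𝓝[range I] (extChartAt I x x)] fun y ↦
      ExteriorAlgebra.ι ℝ (fderivWithin ℝ (h ∘ (extChartAt I x).symm) (range I) y).toLinearMap := by
  filter_upwards [extChartAt_target_mem_nhdsWithin x] with y hy
  exact inChart_extD_fnForm hh x hy

theorem smooth_extD_fnForm [IsManifold I 1 W] {h : W → ℝ} (hh : ContMDiff I 𝓘(ℝ, ℝ) ∞ h) :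
    extD I (fnForm I h) ∈ SmoothForms I := fun x ↦ by
  have h1 : ContDiffWithinAt ℝ ∞ (h ∘ (extChartAt I x).symm) (range I) (extChartAt I x x) :=
    (contMDiffAt_iff.1 (hh x)).2
  have h2 := h1.fderivWithin_right (m := ∞) I.uniqueDiffOn (by simp) (mem_range_self _)
  let A : (E →L[ℝ] ℝ) →ₗ[ℝ] ExteriorAlgebra ℝ (Module.Dual ℝ E) :=
    ExteriorAlgebra.ι ℝ ∘ₗ ContinuousLinearMap.coeLM ℝ
  exact ((LinearMap.toContinuousLinearMap A).contDiff.comp_contDiffWithinAt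
    h2).congr_of_eventuallyEq_of_mem
      (inChart_extD_fnForm_eventuallyEq (mdifferentiable_of_contMDiff hh) x) (mem_range_self _)

theorem extD_extD_fnForm [IsManifold I 1 W] {h : W → ℝ} (hh : ContMDiff I 𝓘(ℝ, ℝ) ∞ h) :
    extD I (extD I (fnForm I h)) = 0 := by
  funext x
  have h1 : ContDiffWithinAt ℝ ∞ (h ∘ (extChartAt I x).symm) (range I) (extChartAt I x x) :=
    (contMDiffAt_iff.1 (hh x)).2
  have h2 := flatExtDeriv_ι_fderivWithin I.uniqueDiffOn (mem_closure_interior_range x)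
    (mem_range_self _) h1
  change pullExt (chartDeriv I x) _ = 0
  rw [← map_zero (pullExt (chartDeriv I x)), ← h2]
  congr 1
  unfold flatExtDeriv
  rw [(inChart_extD_fnForm_eventuallyEq (mdifferentiable_of_contMDiff hh) x).fderivWithin_eq_of_mem
    (mem_range_self _)]

/-- A smooth form is smooth in every chart. -/
theorem contDiffWithinAt_inChart [IsManifold I ∞ W] {η : FormField I W} (hη : η ∈ SmoothForms I)
    (x₀ : W) {y : E} (hy : y ∈ (extChartAt I x₀).target) :
    ContDiffWithinAt ℝ ∞ (inChart I x₀ η) (range I) y := by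
  have : IsManifold I 1 W := .of_le (n := ∞) (by simp)
  set x := (extChartAt I x₀).symm y with hx
  -- The transition map. Near `y` the expression in the chart at `x₀` is the pullback under the
  -- derivative of `τ` of the expression in the chart at `x`.
  set τ : E → E := extChartAt I x ∘ (extChartAt I x₀).symm with hτ
  have hyr : y ∈ range I := extChartAt_target_subset_range x₀ hy
  have hysrc : y ∈ ((extChartAt I x₀).symm ≫ extChartAt I x).source :=
    ⟨hy, mem_extChartAt_source (I := I) x⟩
  have hτs : ContDiffWithinAt ℝ ∞ τ (range I) y := contDiffWithinAt_ext_coord_change x x₀ hysrc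
  have hDτ : ContDiffWithinAt ℝ ∞ (fderivWithin ℝ τ (range I)) (range I) y :=
    hτs.fderivWithin_right I.uniqueDiffOn (by simp) hyr
  have hτy : τ y = extChartAt I x x := rfl
  have hmaps : MapsTo τ (range I) (range I) := fun z _ ↦ by
    simp only [hτ, Function.comp_apply, extChartAt_coe]; exact mem_range_self _
  have hζ : ContDiffWithinAt ℝ ∞ (inChart I x η ∘ τ) (range I) y :=
    ContDiffWithinAt.comp y (t := range I) (by rw [hτy]; exact hη x) hτs hmaps
  refine (contDiffWithinAt_pullExt hDτ hζ).congr_of_eventuallyEq_of_mem ?_ hyr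
  have hcont : ContinuousWithinAt (extChartAt I x₀).symm (range I) y :=
    (continuousOn_extChartAt_symm x₀ y hy).mono_of_mem_nhdsWithin
      (extChartAt_target_mem_nhdsWithin_of_mem hy)
  filter_upwards [extChartAt_target_mem_nhdsWithin_of_mem hy,
    hcont.preimage_mem_nhdsWithin (extChartAt_source_mem_nhds (I := I) x)] with y' hy' hz'
  have h1 := mfderiv_comp_mfderivWithin (I := 𝓘(ℝ, E)) (I' := I) (I'' := 𝓘(ℝ, E)) y'
    (mdifferentiableAt_extChartAt (by rwa [mem_preimage, extChartAt_source] at hz'))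
    (mdifferentiableWithinAt_extChartAt_symm hy')
    (I.uniqueMDiffOn _ (extChartAt_target_subset_range x₀ hy'))
  rw [mfderivWithin_eq_fderivWithin] at h1
  have h2 : (fderivWithin ℝ τ (range I) y').toLinearMap =
      chartDerivAt I x ((extChartAt I x₀).symm y') ∘ₗ chartInvDeriv I x₀ y' := by
    ext v; exact DFunLike.congr_fun h1 v
  rw [h2, ← pullExt_pullExt]
  change _ = pullExt _ (pullExt _ (inChart I x η (extChartAt I x ((extChartAt I x₀).symm y'))))
  rw [pullExt_inChart hz']
  rfl

end FormCalculusManifold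

/-! ### Generation of smooth forms by functions and their differentials. -/

section Generation

open Set Filter Topology

variable {E : Type*} [NormedAddCommGroup E] [NormedSpace ℝ E] {H : Type*} [TopologicalSpace H]
  {I : ModelWithCorners ℝ E H} {W : Type*} [TopologicalSpace W] [ChartedSpace H W]
  [FiniteDimensional ℝ E]

variable (I W) in
/-- The algebra generated by the smooth functions and their differentials. -/
def generatedForms : Subalgebra ℝ (FormField I W) :=
  Algebra.adjoin ℝ {ζ | ∃ h : W → ℝ, ContMDiff I 𝓘(ℝ, ℝ) ∞ h ∧
    (ζ = fnForm I h ∨ ζ = extD I (fnForm I h))}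

theorem fnForm_mem_generatedForms {h : W → ℝ} (hh : ContMDiff I 𝓘(ℝ, ℝ) ∞ h) :
    fnForm I h ∈ generatedForms I W := Algebra.subset_adjoin ⟨h, hh, .inl rfl⟩

theorem extD_fnForm_mem_generatedForms {h : W → ℝ} (hh : ContMDiff I 𝓘(ℝ, ℝ) ∞ h) :
    extD I (fnForm I h) ∈ generatedForms I W := Algebra.subset_adjoin ⟨h, hh, .inr rfl⟩

theorem extD_mul' [IsManifold I 1 W] {η η' : FormField I W} (h : η ∈ SmoothForms I)
    (h' : η' ∈ SmoothForms I) :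
    extD I (η * η') = extD I η * η' + formInv I W η * extD I η' := by
  funext x; exact extD_mul (h x) (h' x)

theorem extD_formInv' {η : FormField I W} (h : η ∈ SmoothForms I) :
    extD I (formInv I W η) = -formInv I W (extD I η) := by
  funext x; exact extD_formInv (h x)

variable [IsManifold I ∞ W] [T2Space W]

/-- These are the forms with constant coefficients in a chart. For a covector, the corresponding
linear function of the chart is cut off by a bump function and differentiated. -/
theorem exists_mem_generatedForms_chart (x₀ : W) (q : ExteriorAlgebra ℝ (Module.Dual ℝ E)) :
    ∃ γ ∈ generatedForms I W, ∀ᶠ z in 𝓝 x₀, γ z = pullExt (chartDerivAt I x₀ z) q := by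
  have : IsManifold I 1 W := .of_le (n := ∞) (by simp)
  induction q using ExteriorAlgebra.induction with
  | algebraMap r =>
    exact ⟨fnForm I fun _ ↦ r, fnForm_mem_generatedForms contMDiff_const,
      .of_forall fun z ↦ (AlgHom.commutes _ r).symm⟩
  | ι l =>
    obtain ⟨χ⟩ : Nonempty (SmoothBumpFunction I x₀) := inferInstance
    let L : E →L[ℝ] ℝ := LinearMap.toContinuousLinearMap l
    have hs : ContMDiff I 𝓘(ℝ, ℝ) ∞ fun z ↦ χ z • L (extChartAt I x₀ z) :=
      χ.contMDiff_smul (L.contMDiff.comp_contMDiffOn contMDiffOn_extChartAt)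
    refine ⟨_, extD_fnForm_mem_generatedForms hs, ?_⟩
    -- The bump function has to be 1 near `z`, not only at `z`, for its differential to drop out.
    filter_upwards [χ.eventuallyEq_one.eventually_nhds,
      (chartAt H x₀).open_source.mem_nhds (mem_chart_source H x₀)] with z hz hz'
    rw [extD_fnForm (mdifferentiable_of_contMDiff hs z), pullExt_ι]
    congr 1
    have h1 : HasMFDerivAt I 𝓘(ℝ, ℝ) (L ∘ extChartAt I x₀) z
        (L ∘L mfderiv I 𝓘(ℝ, E) (extChartAt I x₀) z) :=
      HasMFDerivAt.comp z L.hasMFDerivAt (mdifferentiableAt_extChartAt hz').hasMFDerivAt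
    have h2 : (fun z ↦ χ z • L (extChartAt I x₀ z)) =ᶠ[𝓝 z] L ∘ extChartAt I x₀ := by
      filter_upwards [hz] with w hw
      simp [hw]
    have h3 := (h1.congr_of_eventuallyEq h2).mfderiv
    ext v
    exact DFunLike.congr_fun h3 v
  | mul a b ha hb =>
    obtain ⟨γ, hγ, h⟩ := ha
    obtain ⟨γ', hγ', h'⟩ := hb
    refine ⟨γ * γ', mul_mem hγ hγ', ?_⟩
    filter_upwards [h, h'] with z hz hz'
    rw [Pi.mul_apply, hz, hz', map_mul]
  | add a b ha hb =>
    obtain ⟨γ, hγ, h⟩ := ha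
    obtain ⟨γ', hγ', h'⟩ := hb
    refine ⟨γ + γ', add_mem hγ hγ', ?_⟩
    filter_upwards [h, h'] with z hz hz'
    rw [Pi.add_apply, hz, hz', map_add]

/-- A smooth form agrees locally with one generated by functions and their differentials. -/
theorem exists_mem_generatedForms_eventuallyEq {η : FormField I W} (hη : η ∈ SmoothForms I)
    (x₀ : W) : ∃ γ ∈ generatedForms I W, ∀ᶠ z in 𝓝 x₀, γ z = η z := by
  have : IsManifold I 1 W := .of_le (n := ∞) (by simp)
  set e := (Module.finBasis ℝ (Module.Dual ℝ E)).ExteriorAlgebra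
  obtain ⟨χ⟩ : Nonempty (SmoothBumpFunction I x₀) := inferInstance
  choose γ hγ hγz using fun J ↦ exists_mem_generatedForms_chart (I := I) x₀ (e J)
  have hsm : ∀ J, ContMDiff I 𝓘(ℝ, ℝ) ∞ fun z ↦
      χ z • e.coord J (inChart I x₀ η (extChartAt I x₀ z)) := fun J ↦ by
    refine χ.contMDiff_smul ?_
    intro z hz
    have h1 := contDiffWithinAt_inChart hη x₀
      ((extChartAt I x₀).map_source (by rwa [extChartAt_source] : z ∈ (extChartAt I x₀).source))
    have h2 := (LinearMap.toContinuousLinearMap (e.coord J)).contDiff.comp_contDiffWithinAt h1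
    exact ContMDiffWithinAt.comp (t := range I) z h2.contMDiffWithinAt
      (contMDiffAt_extChartAt' hz).contMDiffWithinAt fun w _ ↦ by
        rw [extChartAt_coe]; exact mem_range_self _
  refine ⟨∑ J, fnForm I _ * γ J, sum_mem fun J _ ↦ mul_mem (fnForm_mem_generatedForms (hsm J))
    (hγ J), ?_⟩
  filter_upwards [χ.eventuallyEq_one, extChartAt_source_mem_nhds (I := I) x₀,
    eventually_all.2 hγz] with z hz hz' hzγ
  rw [← pullExt_inChart hz' η, ← e.sum_repr (inChart I x₀ η (extChartAt I x₀ z)), map_sum,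
    Finset.sum_apply]
  refine Finset.sum_congr rfl fun J _ ↦ ?_
  rw [Pi.mul_apply, hzγ, map_smul, Algebra.smul_def, fnForm, hz]
  simp

/-- On a compact manifold the smooth forms are generated by functions and their differentials. -/
theorem smoothForms_le_generatedForms [CompactSpace W] {η : FormField I W}
    (hη : η ∈ SmoothForms I) : η ∈ generatedForms I W := by
  choose γ hγ hγz using exists_mem_generatedForms_eventuallyEq hη
  choose U hU hUo hxU using fun x ↦ eventually_nhds_iff.1 (hγz x)
  obtain ⟨ρ, hρ⟩ := SmoothPartitionOfUnity.exists_isSubordinate I isClosed_univ U hUo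
    (fun x _ ↦ mem_iUnion.2 ⟨x, hxU x⟩)
  -- By compactness only finitely many members of the partition are nonzero, so the locally finite
  -- sum is an honest element of the algebra.
  have hfin : {i | (Function.support (ρ i)).Nonempty}.Finite :=
    ρ.locallyFinite.finite_nonempty_of_compact
  have key : η = ∑ i ∈ hfin.toFinset, fnForm I (ρ i) * γ i := by
    funext x
    have hsum : ∑ i ∈ hfin.toFinset, ρ i x = 1 := by
      rw [← ρ.sum_eq_one (mem_univ x)]
      refine (finsum_eq_sum_of_support_subset _ fun i hi ↦ ?_).symm
      simp only [Finite.coe_toFinset, mem_ofPred_eq]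
      exact ⟨x, hi⟩
    rw [Finset.sum_apply, ← one_smul ℝ (η x), ← hsum, Finset.sum_smul]
    refine Finset.sum_congr rfl fun i _ ↦ ?_
    rw [Pi.mul_apply, fnForm, ← Algebra.smul_def]
    by_cases h : ρ i x = 0
    · rw [h, zero_smul, zero_smul]
    · rw [hU i x (hρ i (subset_tsupport _ h))]
  rw [key]
  exact sum_mem fun i _ ↦ mul_mem (fnForm_mem_generatedForms (ρ i).contMDiff) (hγ i)

/-- The working principle for forms: two operators obeying the same Leibniz rule agree once they
agree on functions and their differentials. -/
theorem smoothForms_induction [CompactSpace W] {P : FormField I W → Prop}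
    (fn : ∀ h : W → ℝ, ContMDiff I 𝓘(ℝ, ℝ) ∞ h → P (fnForm I h))
    (d : ∀ h : W → ℝ, ContMDiff I 𝓘(ℝ, ℝ) ∞ h → P (extD I (fnForm I h)))
    (mul : ∀ η η', η ∈ SmoothForms I → η' ∈ SmoothForms I → P η → P η' → P (η * η'))
    (add : ∀ η η', η ∈ SmoothForms I → η' ∈ SmoothForms I → P η → P η' → P (η + η'))
    {η : FormField I W} (hη : η ∈ SmoothForms I) : P η := by
  have : IsManifold I 1 W := .of_le (n := ∞) (by simp)
  have key : ∀ ζ ∈ generatedForms I W, ζ ∈ SmoothForms I ∧ P ζ := fun ζ hζ ↦ by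
    induction hζ using Algebra.adjoin_induction with
    | mem x hx =>
      obtain ⟨h, hh, rfl | rfl⟩ := hx
      · exact ⟨smooth_fnForm hh, fn h hh⟩
      · exact ⟨smooth_extD_fnForm hh, d h hh⟩
    | algebraMap r => exact ⟨smooth_fnForm contMDiff_const, fn (fun _ ↦ r) contMDiff_const⟩
    | add x y _ _ hx hy => exact ⟨add_mem hx.1 hy.1, add x y hx.1 hy.1 hx.2 hy.2⟩
    | mul x y _ _ hx hy => exact ⟨smooth_mul hx.1 hy.1, mul x y hx.1 hy.1 hx.2 hy.2⟩
  exact (key η (smoothForms_le_generatedForms hη)).2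

/-- The exterior derivative of a smooth form is smooth. -/
theorem smooth_extD [CompactSpace W] {η : FormField I W} (hη : η ∈ SmoothForms I) :
    extD I η ∈ SmoothForms I := by
  have : IsManifold I 1 W := .of_le (n := ∞) (by simp)
  refine smoothForms_induction (P := fun η ↦ extD I η ∈ SmoothForms I)
    (fun h hh ↦ smooth_extD_fnForm hh) (fun h hh ↦ ?_) (fun η η' h h' k k' ↦ ?_)
    (fun η η' h h' k k' ↦ ?_) hη
  · rw [extD_extD_fnForm hh]; exact zero_mem _
  · rw [extD_mul' h h']
    exact add_mem (smooth_mul k h') (smooth_mul (smooth_formInv h) k')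
  · rw [extD_add I h h']; exact add_mem k k'

/-- In the Leibniz expansion of a product the mixed terms cancel, because `extD` anticommutes with
the grading involution. -/
theorem extD_extD [CompactSpace W] {η : FormField I W} (hη : η ∈ SmoothForms I) :
    extD I (extD I η) = 0 := by
  have : IsManifold I 1 W := .of_le (n := ∞) (by simp)
  refine smoothForms_induction (P := fun η ↦ extD I (extD I η) = 0)
    (fun h hh ↦ extD_extD_fnForm hh) (fun h hh ↦ ?_) (fun η η' h h' k k' ↦ ?_)
    (fun η η' h h' k k' ↦ ?_) hη
  · rw [extD_extD_fnForm hh, extD_zero]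
  · rw [extD_mul' h h', extD_add I (smooth_mul (smooth_extD h) h')
      (smooth_mul (smooth_formInv h) (smooth_extD h')), extD_mul' (smooth_extD h) h',
      extD_mul' (smooth_formInv h) (smooth_extD h'), k, k', extD_formInv' h, formInv_formInv]
    simp
  · rw [extD_add I h h', extD_add I (smooth_extD h) (smooth_extD h'), k, k', add_zero]

end Generation

/-! ### Interchanging the time derivative with space derivatives. -/

section MixedPartials

open Set Filter Topology

variable {E : Type*} [NormedAddCommGroup E] [NormedSpace ℝ E]
  {F : Type*} [NormedAddCommGroup F] [NormedSpace ℝ F]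

theorem eventually_differentiableWithinAt {s : Set E} {y₀ : E} {φ : E → F} (hy₀ : y₀ ∈ s)
    (hφ : ContDiffWithinAt ℝ ∞ φ s y₀) :
    ∀ᶠ y in 𝓝[s] y₀, DifferentiableWithinAt ℝ φ s y := by
  have h := (hφ.of_le (m := 1) (by simp)).eventually (by simp)
  rw [insert_eq_of_mem hy₀] at h
  filter_upwards [h] with y hy using hy.differentiableWithinAt (by simp)

theorem hasDerivAt_of_prod {s : Set E} {φ : ℝ × E → F} {t : ℝ} {y : E} (hy : y ∈ s)
    (h : DifferentiableWithinAt ℝ φ (univ ×ˢ s) (t, y)) :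
    HasDerivAt (fun r ↦ φ (r, y)) (fderivWithin ℝ φ (univ ×ˢ s) (t, y) (1, 0)) t := by
  have h1 : HasDerivWithinAt (fun r : ℝ ↦ (r, y)) (1, 0) univ t :=
    (hasDerivWithinAt_id t univ).prodMk (hasDerivWithinAt_const t univ y)
  exact (h.hasFDerivWithinAt.comp_hasDerivWithinAt t h1
    (fun r _ ↦ mk_mem_prod (mem_univ _) hy)).hasDerivAt univ_mem

theorem fderivWithin_of_prod {s : Set E} (hs : UniqueDiffOn ℝ s) {φ : ℝ × E → F} {t : ℝ} {y : E}
    (hy : y ∈ s) (h : DifferentiableWithinAt ℝ φ (univ ×ˢ s) (t, y)) :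
    fderivWithin ℝ (fun z ↦ φ (t, z)) s y =
      fderivWithin ℝ φ (univ ×ˢ s) (t, y) ∘L ContinuousLinearMap.inr ℝ ℝ E := by
  have h1 : HasFDerivWithinAt (fun z : E ↦ (t, z)) (ContinuousLinearMap.inr ℝ ℝ E) s y :=
    (hasFDerivWithinAt_const t y s).prodMk (hasFDerivWithinAt_id y s)
  exact (h.hasFDerivWithinAt.comp y h1 (fun r hr ↦ ⟨mem_univ _, hr⟩)).fderivWithin (hs y hy)

variable {s : Set E} {y₀ : E} {φ : ℝ × E → F}

theorem deriv_eventuallyEq_of_prod (hy₀ : y₀ ∈ s)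
    (hφ : ContDiffWithinAt ℝ ∞ φ (univ ×ˢ s) (0, y₀)) :
    (fun y ↦ deriv (fun t ↦ φ (t, y)) 0) =ᶠ[𝓝[s] y₀] fun y ↦
      fderivWithin ℝ φ (univ ×ˢ s) (0, y) (1, 0) := by
  have h := eventually_differentiableWithinAt (mk_mem_prod (mem_univ _) hy₀) hφ
  have hc : Tendsto (fun y : E ↦ ((0 : ℝ), y)) (𝓝[s] y₀) (𝓝[univ ×ˢ s] (0, y₀)) := by
    refine tendsto_nhdsWithin_of_tendsto_nhds_of_eventually_within _ ?_ ?_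
    · exact (Continuous.tendsto (by fun_prop) y₀).mono_left nhdsWithin_le_nhds
    · filter_upwards [self_mem_nhdsWithin] with y hy using ⟨mem_univ _, hy⟩
  filter_upwards [hc.eventually h, self_mem_nhdsWithin] with y hy hys
  exact (hasDerivAt_of_prod hys hy).deriv

theorem contDiffWithinAt_fderivWithin_prod (hs : UniqueDiffOn ℝ s) (hy₀ : y₀ ∈ s)
    (hφ : ContDiffWithinAt ℝ ∞ φ (univ ×ˢ s) (0, y₀)) :
    ContDiffWithinAt ℝ ∞ (fderivWithin ℝ φ (univ ×ˢ s)) (univ ×ˢ s) (0, y₀) :=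
  hφ.fderivWithin_right (uniqueDiffOn_univ.prod hs) (by simp) (mk_mem_prod (mem_univ _) hy₀)

theorem contDiffWithinAt_deriv_of_prod (hs : UniqueDiffOn ℝ s) (hy₀ : y₀ ∈ s)
    (hφ : ContDiffWithinAt ℝ ∞ φ (univ ×ˢ s) (0, y₀)) :
    ContDiffWithinAt ℝ ∞ (fun y ↦ deriv (fun t ↦ φ (t, y)) 0) s y₀ := by
  refine ContDiffWithinAt.congr_of_eventuallyEq_of_mem ?_
    (deriv_eventuallyEq_of_prod hy₀ hφ) hy₀
  refine ContDiffWithinAt.clm_apply ?_ contDiffWithinAt_const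
  exact ContDiffWithinAt.comp (t := univ ×ˢ s) y₀ (contDiffWithinAt_fderivWithin_prod hs hy₀ hφ)
    (contDiffWithinAt_const.prodMk contDiffWithinAt_id) (fun y hy ↦ ⟨mem_univ _, hy⟩)

/-- Symmetry of the second derivative of `φ` on ℝ × `s`, tested on the time direction (1, 0) and a
space direction (0, v). -/
theorem hasDerivAt_fderivWithin_of_prod (hs : UniqueDiffOn ℝ s) (hy₀ : y₀ ∈ s)
    (hφ : ContDiffWithinAt ℝ ∞ φ (univ ×ˢ s) (0, y₀))
    (hc : y₀ ∈ closure (interior s)) :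
    HasDerivAt (fun t ↦ fderivWithin ℝ (fun y ↦ φ (t, y)) s y₀)
      (fderivWithin ℝ (fun y ↦ deriv (fun t ↦ φ (t, y)) 0) s y₀) 0 := by
  have hmem : ((0 : ℝ), y₀) ∈ (univ : Set ℝ) ×ˢ s := mk_mem_prod (mem_univ _) hy₀
  have hψ := (contDiffWithinAt_fderivWithin_prod hs hy₀ hφ).differentiableWithinAt (by simp)
  have hsymm : IsSymmSndFDerivWithinAt ℝ φ (univ ×ˢ s) (0, y₀) :=
    hφ.isSymmSndFDerivWithinAt (by
      rw [minSmoothness_of_isRCLikeNormedField]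
      exact WithTop.coe_le_coe.2 (le_top : (2 : ℕ∞) ≤ ⊤)) (uniqueDiffOn_univ.prod hs)
      (by rw [interior_prod_eq, interior_univ, closure_prod_eq, closure_univ]
          exact ⟨mem_univ _, hc⟩) hmem
  set ψ := fderivWithin ℝ φ (univ ×ˢ s) with hψdef
  have h1 : HasDerivAt (fun t ↦ ψ (t, y₀)) (fderivWithin ℝ ψ (univ ×ˢ s) (0, y₀) (1, 0)) 0 :=
    hasDerivAt_of_prod hy₀ hψ
  have h2 : HasDerivAt (fun t ↦ ψ (t, y₀) ∘L ContinuousLinearMap.inr ℝ ℝ E)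
      (fderivWithin ℝ ψ (univ ×ˢ s) (0, y₀) (1, 0) ∘L ContinuousLinearMap.inr ℝ ℝ E) 0 :=
    ((ContinuousLinearMap.compL ℝ E (ℝ × E) F).flip
      (ContinuousLinearMap.inr ℝ ℝ E)).hasFDerivAt.comp_hasDerivAt 0 h1
  have h3 : (fun t ↦ fderivWithin ℝ (fun y ↦ φ (t, y)) s y₀) =ᶠ[𝓝 0] fun t ↦
      ψ (t, y₀) ∘L ContinuousLinearMap.inr ℝ ℝ E := by
    have h := eventually_differentiableWithinAt hmem hφ
    have hc : Tendsto (fun t : ℝ ↦ (t, y₀)) (𝓝 0) (𝓝[univ ×ˢ s] (0, y₀)) := by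
      refine tendsto_nhdsWithin_of_tendsto_nhds_of_eventually_within _
        (Continuous.tendsto (by fun_prop) 0) (.of_forall fun t ↦ ⟨mem_univ _, hy₀⟩)
    filter_upwards [hc.eventually h] with t ht
    exact fderivWithin_of_prod hs hy₀ ht
  refine (h2.congr_of_eventuallyEq h3).congr_deriv ?_
  have h4 : HasFDerivWithinAt (fun y ↦ ψ (0, y))
      (fderivWithin ℝ ψ (univ ×ˢ s) (0, y₀) ∘L ContinuousLinearMap.inr ℝ ℝ E) s y₀ :=
    hψ.hasFDerivWithinAt.comp y₀
      ((hasFDerivWithinAt_const 0 y₀ s).prodMk (hasFDerivWithinAt_id y₀ s))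
      (fun r hr ↦ ⟨mem_univ _, hr⟩)
  have h5 : HasFDerivWithinAt (fun y ↦ ψ (0, y) (1, 0))
      (((ContinuousLinearMap.apply ℝ F ((1 : ℝ), (0 : E)))) ∘L
        (fderivWithin ℝ ψ (univ ×ˢ s) (0, y₀) ∘L ContinuousLinearMap.inr ℝ ℝ E)) s y₀ :=
    (ContinuousLinearMap.apply ℝ F ((1 : ℝ), (0 : E))).hasFDerivAt.comp_hasFDerivWithinAt y₀ h4
  have hev := deriv_eventuallyEq_of_prod hy₀ hφ
  rw [(h5.congr_of_eventuallyEq hev (hev.self_of_nhdsWithin hy₀)).fderivWithin (hs y₀ hy₀)]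
  ext v
  exact hsymm (1, 0) (0, v)

end MixedPartials

/-! ### One-parameter families of functions on a manifold. -/

section Families

open Set Filter Topology

variable {E : Type*} [NormedAddCommGroup E] [NormedSpace ℝ E] {H : Type*} [TopologicalSpace H]
  {I : ModelWithCorners ℝ E H} {W : Type*} [TopologicalSpace W] [ChartedSpace H W]
  {F : Type*} [NormedAddCommGroup F] [NormedSpace ℝ F]

variable (I) in
/-- The differential of a vector valued function, as a map on the model space. -/
def modelDeriv (u : W → F) (x : W) : E →L[ℝ] F := mfderiv I 𝓘(ℝ, F) u x

theorem modelDeriv_eq {u : W → F} {x : W} (hu : MDifferentiableAt I 𝓘(ℝ, F) u x) :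
    modelDeriv I u x = fderivWithin ℝ (u ∘ (extChartAt I x).symm) (range I) (extChartAt I x x) :=
  hu.mfderiv

variable [IsManifold I ∞ W]

theorem contDiffWithinAt_family_chart {Φ : ℝ → W → F} {x : W}
    (hΦ : ContMDiffAt (𝓘(ℝ, ℝ).prod I) 𝓘(ℝ, F) ∞ (fun p : ℝ × W ↦ Φ p.1 p.2) (0, x)) :
    ContDiffWithinAt ℝ ∞ (fun p : ℝ × E ↦ Φ p.1 ((extChartAt I x).symm p.2)) (univ ×ˢ range I)
      (0, extChartAt I x x) := by
  rw [← contMDiffWithinAt_iff_contDiffWithinAt]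
  have h1 : ContMDiffWithinAt 𝓘(ℝ, ℝ × E) (𝓘(ℝ, ℝ).prod I) ∞
      (fun p : ℝ × E ↦ (p.1, (extChartAt I x).symm p.2)) (univ ×ˢ range I)
      (0, extChartAt I x x) := by
    refine contDiffWithinAt_fst.contMDiffWithinAt.prodMk ?_
    exact ContMDiffWithinAt.comp (t := range I) (0, extChartAt I x x)
      (contMDiffWithinAt_extChartAt_symm_range x (mem_extChartAt_target x))
      contDiffWithinAt_snd.contMDiffWithinAt (fun p hp ↦ hp.2)
  refine ContMDiffAt.comp_contMDiffWithinAt_of_eq (y := (0, x)) hΦ h1 ?_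
  simp

theorem contMDiffAt_deriv_family {Φ : ℝ → W → F} {x : W}
    (hΦ : ContMDiffAt (𝓘(ℝ, ℝ).prod I) 𝓘(ℝ, F) ∞ (fun p : ℝ × W ↦ Φ p.1 p.2) (0, x)) :
    ContMDiffAt I 𝓘(ℝ, F) ∞ (fun z ↦ deriv (fun t ↦ Φ t z) 0) x := by
  have h1 := contDiffWithinAt_deriv_of_prod I.uniqueDiffOn (mem_range_self _)
    (contDiffWithinAt_family_chart hΦ)
  have h2 := ContMDiffWithinAt.comp (t := range I) (s := univ) x h1.contMDiffWithinAt
      (contMDiffAt_extChartAt (I := I) (n := ∞)).contMDiffWithinAt fun w _ ↦ by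
        rw [extChartAt_coe]; exact mem_range_self _
  rw [contMDiffWithinAt_univ] at h2
  refine h2.congr_of_eventuallyEq ?_
  filter_upwards [extChartAt_source_mem_nhds (I := I) x] with z hz
  simp only [Function.comp_apply, (extChartAt I x).left_inv hz]

/-- Used for the translates of a function on W along a curve in G, and for products and conjugations
in G read in the chart at 1. -/
theorem hasDerivAt_modelDeriv_family {Φ : ℝ → W → F} {x : W}
    (hΦ : ContMDiffAt (𝓘(ℝ, ℝ).prod I) 𝓘(ℝ, F) ∞ (fun p : ℝ × W ↦ Φ p.1 p.2) (0, x))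
    (hΦ' : ∀ᶠ t in 𝓝 0, MDifferentiableAt I 𝓘(ℝ, F) (Φ t) x) :
    HasDerivAt (fun t ↦ modelDeriv I (Φ t) x)
      (modelDeriv I (fun z ↦ deriv (fun t ↦ Φ t z) 0) x) 0 := by
  have h1 := hasDerivAt_fderivWithin_of_prod I.uniqueDiffOn (mem_range_self _)
    (contDiffWithinAt_family_chart hΦ) (mem_closure_interior_range x)
  rw [modelDeriv_eq ((contMDiffAt_deriv_family hΦ).mdifferentiableAt (by simp))]
  refine h1.congr_of_eventuallyEq ?_
  filter_upwards [hΦ'] with t ht using modelDeriv_eq ht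

end Families

/-! ### Curves through the identity of G. -/

section Curves

open Set Filter Topology

variable {EG : Type*} [NormedAddCommGroup EG] [NormedSpace ℝ EG]
  {G : Type*} [TopologicalSpace G] [ChartedSpace EG G] [Group G]
  {F : Type*} [NormedAddCommGroup F] [NormedSpace ℝ F]

/-- A vector of the Lie algebra, as a vector of the model space. -/
def toModel (ξ : LieAlg (EG := EG) G) : EG := ξ

/-- A curve in `G` through `1` with velocity `ξ`: a straight line in the chart at `1`. -/
def lineCurve (ξ : LieAlg (EG := EG) G) (t : ℝ) : G :=
  (extChartAt 𝓘(ℝ, EG) (1 : G)).symm (extChartAt 𝓘(ℝ, EG) (1 : G) 1 + t • (toModel ξ))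

@[simp] theorem lineCurve_zero (ξ : LieAlg (EG := EG) G) : lineCurve ξ 0 = 1 := by
  unfold lineCurve
  rw [zero_smul, add_zero, extChartAt_to_inv]

theorem contMDiffAt_lineCurve [IsManifold 𝓘(ℝ, EG) ∞ G] (ξ : LieAlg (EG := EG) G) :
    ContMDiffAt 𝓘(ℝ, ℝ) 𝓘(ℝ, EG) ∞ (lineCurve ξ) 0 := by
  have h1 : ContMDiffAt 𝓘(ℝ, EG) 𝓘(ℝ, EG) ∞ (extChartAt 𝓘(ℝ, EG) (1 : G)).symm
      (extChartAt 𝓘(ℝ, EG) (1 : G) 1) := by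
    have := contMDiffWithinAt_extChartAt_symm_range (I := 𝓘(ℝ, EG)) (n := ∞) (1 : G)
      (mem_extChartAt_target 1)
    rwa [ModelWithCorners.range_eq_univ, contMDiffWithinAt_univ] at this
  refine ContMDiffAt.comp_of_eq h1 (ContDiffAt.contMDiffAt ?_) (by simp)
  fun_prop

/-- `c` is a smooth curve in `G` through `1` with velocity `v`. -/
structure IsCurve (c : ℝ → G) (v : LieAlg (EG := EG) G) : Prop where
  smooth : ContMDiffAt 𝓘(ℝ, ℝ) 𝓘(ℝ, EG) ∞ c 0
  zero : c 0 = 1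
  velocity : HasDerivAt (fun t ↦ extChartAt 𝓘(ℝ, EG) (1 : G) (c t)) (toModel v) 0

theorem IsCurve.hasDerivAt {c : ℝ → G} {v : LieAlg (EG := EG) G} (hc : IsCurve c v) {u : G → F}
    (hu : MDifferentiableAt 𝓘(ℝ, EG) 𝓘(ℝ, F) u 1) :
    HasDerivAt (fun t ↦ u (c t)) (modelDeriv 𝓘(ℝ, EG) u (1 : G) v) 0 := by
  have h1 : DifferentiableWithinAt ℝ (u ∘ (extChartAt 𝓘(ℝ, EG) (1 : G)).symm) (range 𝓘(ℝ, EG))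
      (extChartAt 𝓘(ℝ, EG) (1 : G) 1) := ((mdifferentiableAt_iff _ _).1 hu).2
  have h2 := h1.hasFDerivWithinAt
  rw [← modelDeriv_eq hu, ModelWithCorners.range_eq_univ, hasFDerivWithinAt_univ] at h2
  refine (HasFDerivAt.comp_hasDerivAt_of_eq (0 : ℝ) h2 hc.velocity
    (by rw [hc.zero])).congr_of_eventuallyEq ?_
  have h3 : ∀ᶠ t in 𝓝 (0 : ℝ), c t ∈ (extChartAt 𝓘(ℝ, EG) (1 : G)).source :=
    hc.smooth.continuousAt.eventually
      (by rw [hc.zero]; exact extChartAt_source_mem_nhds (I := 𝓘(ℝ, EG)) (1 : G))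
  filter_upwards [h3] with t ht
  simp only [Function.comp_apply, (extChartAt 𝓘(ℝ, EG) (1 : G)).left_inv ht]

theorem isCurve_lineCurve [IsManifold 𝓘(ℝ, EG) ∞ G] (ξ : LieAlg (EG := EG) G) :
    IsCurve (lineCurve ξ) ξ := by
  refine ⟨contMDiffAt_lineCurve ξ, lineCurve_zero ξ, ?_⟩
  have h3 : HasDerivAt (fun t : ℝ ↦ extChartAt 𝓘(ℝ, EG) (1 : G) 1 + t • (toModel ξ)) (toModel ξ)
      0 := by
    simpa using ((hasDerivAt_id (0 : ℝ)).smul_const (toModel ξ)).const_add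
      (extChartAt 𝓘(ℝ, EG) (1 : G) 1)
  refine h3.congr_of_eventuallyEq ?_
  have h4 : ∀ᶠ t in 𝓝 (0 : ℝ), extChartAt 𝓘(ℝ, EG) (1 : G) 1 + t • (toModel ξ) ∈
      (extChartAt 𝓘(ℝ, EG) (1 : G)).target :=
    h3.continuousAt.eventually (by
      simp only [zero_smul, add_zero]; exact extChartAt_target_mem_nhds (1 : G))
  filter_upwards [h4] with t ht
  exact (extChartAt 𝓘(ℝ, EG) (1 : G)).right_inv ht

end Curves

/-! ### The action of G on forms. -/

section ActionOnForms

open Set Filter Topology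

variable {G : Type*} [Group G]
  {E : Type*} [NormedAddCommGroup E] [NormedSpace ℝ E] {H : Type*} [TopologicalSpace H]
  {I : ModelWithCorners ℝ E H} {W : Type*} [TopologicalSpace W] [ChartedSpace H W] [MulAction G W]

theorem actForm_apply (g : G) (η : FormField I W) (x : W) :
    actForm I g η x = pullExt (actDeriv I g⁻¹ x) (η (g⁻¹ • x)) := rfl

theorem actForm_mul (g : G) (η η' : FormField I W) :
    actForm I g (η * η') = actForm I g η * actForm I g η' := by
  funext x; exact map_mul (pullExt (actDeriv I g⁻¹ x)) _ _

theorem actForm_fnForm (g : G) (h : W → ℝ) :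
    actForm I g (fnForm I h) = fnForm I fun x ↦ h (g⁻¹ • x) := by
  funext x; exact AlgHom.commutes _ _

theorem actForm_one_eq (g : G) : actForm I g (1 : FormField I W) = 1 := by
  funext x; exact map_one (pullExt (actDeriv I g⁻¹ x))

theorem actForm_formInv (g : G) (η : FormField I W) :
    actForm I g (formInv I W η) = formInv I W (actForm I g η) := by
  funext x; exact (gradInv_pullExt _ _).symm

theorem actForm_one (η : FormField I W) : actForm I (1 : G) η = η := by
  funext x
  rw [actForm_apply]
  refine pullExt_of_eq (by simp) _ (fun v ↦ ?_) η
  have h : (fun z : W ↦ (1 : G)⁻¹ • z) = id := by funext z; simp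
  have : mfderiv I I (fun z : W ↦ (1 : G)⁻¹ • z) x = mfderiv I I id x := by rw [h]
  exact DFunLike.congr_fun (this.trans mfderiv_id) v

theorem contract_mul (X : ∀ x : W, TangentSpace I x) (η η' : FormField I W) :
    contract X (η * η') = contract X η * η' + formInv I W η * contract X η' := by
  funext x; exact contractExt_mul _ _ _

theorem contract_fnForm (X : ∀ x : W, TangentSpace I x) (h : W → ℝ) :
    contract X (fnForm I h) = 0 := by
  funext x; exact contractExt_algebraMap _ _

theorem formInv_contract (X : ∀ x : W, TangentSpace I x) (η : FormField I W) :
    formInv I W (contract X η) = -contract X (formInv I W η) := by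
  funext x; exact gradInv_contractExt _ _

theorem formInv_fnForm (h : W → ℝ) : formInv I W (fnForm I h) = fnForm I h := by
  funext x; exact AlgHom.commutes _ _

variable [FiniteDimensional ℝ E]

theorem contract_extD_fnForm [IsManifold I 1 W] (X : ∀ x : W, TangentSpace I x) {h : W → ℝ}
    (hh : MDifferentiable I 𝓘(ℝ, ℝ) h) :
    contract X (extD I (fnForm I h)) = fnForm I fun x ↦ dFn I h x (X x) := by
  funext x
  change contractExt (X x) (extD I (fnForm I h) x) = _
  rw [extD_fnForm (hh x), contractExt_ι]; rfl

section

variable [IsManifold I ∞ W]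

theorem actForm_extD_fnForm (hG : ∀ g : G, ContMDiff I I ∞ fun z : W ↦ g • z) (g : G)
    {h : W → ℝ} (hh : ContMDiff I 𝓘(ℝ, ℝ) ∞ h) :
    actForm I g (extD I (fnForm I h)) = extD I (fnForm I fun x ↦ h (g⁻¹ • x)) := by
  have : IsManifold I 1 W := .of_le (n := ∞) (by simp)
  funext x
  rw [actForm_apply, extD_fnForm (mdifferentiable_of_contMDiff hh _),
    extD_fnForm (h := fun x ↦ h (g⁻¹ • x))
      (mdifferentiable_of_contMDiff (hh.comp (hG g⁻¹)) x), pullExt_ι]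
  congr 1
  ext v
  exact (mfderiv_comp_apply x (mdifferentiable_of_contMDiff hh _)
    ((hG g⁻¹).mdifferentiable (by simp) x) v).symm

variable [T2Space W] [CompactSpace W]

theorem smooth_actForm (hG : ∀ g : G, ContMDiff I I ∞ fun z : W ↦ g • z) (g : G)
    {η : FormField I W} (hη : η ∈ SmoothForms I) :
    actForm I g η ∈ SmoothForms I := by
  have : IsManifold I 1 W := .of_le (n := ∞) (by simp)
  refine smoothForms_induction (P := fun η ↦ actForm I g η ∈ SmoothForms I)
    (fun h hh ↦ ?_) (fun h hh ↦ ?_) (fun η η' h h' k k' ↦ ?_) (fun η η' h h' k k' ↦ ?_) hη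
  · rw [actForm_fnForm]; exact smooth_fnForm (hh.comp (hG g⁻¹))
  · rw [actForm_extD_fnForm hG g hh]
    exact smooth_extD_fnForm (hh.comp (hG g⁻¹))
  · rw [actForm_mul]; exact smooth_mul k k'
  · rw [map_add]; exact add_mem k k'

/-- The exterior derivative commutes with the action. -/
theorem extD_actForm (hG : ∀ g : G, ContMDiff I I ∞ fun z : W ↦ g • z) (g : G)
    {η : FormField I W} (hη : η ∈ SmoothForms I) :
    extD I (actForm I g η) = actForm I g (extD I η) := by
  have : IsManifold I 1 W := .of_le (n := ∞) (by simp)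
  refine smoothForms_induction (P := fun η ↦ extD I (actForm I g η) = actForm I g (extD I η))
    (fun h hh ↦ ?_) (fun h hh ↦ ?_) (fun η η' h h' k k' ↦ ?_) (fun η η' h h' k k' ↦ ?_) hη
  · rw [actForm_fnForm, actForm_extD_fnForm hG g hh]
  · rw [extD_extD_fnForm hh, actForm_extD_fnForm hG g hh,
      extD_extD_fnForm (h := fun x ↦ h (g⁻¹ • x)) (hh.comp (hG g⁻¹)), map_zero]
  · rw [actForm_mul, extD_mul' (smooth_actForm hG g h) (smooth_actForm hG g h'), k, k',
      ← actForm_formInv, extD_mul' h h', map_add, actForm_mul, actForm_mul]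
  · rw [map_add, extD_add I (smooth_actForm hG g h) (smooth_actForm hG g h'), k, k',
      extD_add I h h', map_add]

end

end ActionOnForms

/-! ### Lie derivatives along the fundamental vector fields. -/

section LieDerivative

open Set Filter Topology

variable {EG : Type*} [NormedAddCommGroup EG] [NormedSpace ℝ EG]
  {G : Type*} [TopologicalSpace G] [ChartedSpace EG G] [Group G] [LieGroup 𝓘(ℝ, EG) ∞ G]
  {E : Type*} [NormedAddCommGroup E] [NormedSpace ℝ E] {H : Type*} [TopologicalSpace H]
  {I : ModelWithCorners ℝ E H} {W : Type*} [TopologicalSpace W] [ChartedSpace H W] [MulAction G W]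
  [ContMDiffSMul 𝓘(ℝ, EG) I ∞ G W]

theorem contMDiff_inv_smul (x : W) : ContMDiff 𝓘(ℝ, EG) I ∞ fun g : G ↦ g⁻¹ • x :=
  (contMDiff_inv 𝓘(ℝ, EG) ∞).smul contMDiff_const

/-- The fundamental field differentiates g ↦ g⁻¹x and forms are pulled back under g⁻¹, so no sign
appears here or in Cartan's formula. -/
theorem hasDerivAt_comp_inv_smul {h : W → ℝ} (hh : ContMDiff I 𝓘(ℝ, ℝ) ∞ h)
    (ξ : LieAlg (EG := EG) G) (x : W) :
    HasDerivAt (fun t ↦ h ((lineCurve ξ t)⁻¹ • x)) (dFn I h x (fundField I ξ x)) 0 := by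
  have h1 : ContMDiff 𝓘(ℝ, EG) 𝓘(ℝ, ℝ) ∞ fun g : G ↦ h (g⁻¹ • x) :=
    hh.comp (contMDiff_inv_smul x)
  refine ((isCurve_lineCurve ξ).hasDerivAt (mdifferentiable_of_contMDiff h1 1)).congr_deriv ?_
  exact mfderiv_comp_apply_of_eq (x := (1 : G)) (y := x) (g := h) (f := fun g : G ↦ g⁻¹ • x)
    (mdifferentiable_of_contMDiff hh x)
    ((contMDiff_inv_smul (EG := EG) x).mdifferentiable (by simp) 1) (by simp) ξ

theorem contMDiffAt_family_inv_smul {h : W → ℝ} (hh : ContMDiff I 𝓘(ℝ, ℝ) ∞ h)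
    (ξ : LieAlg (EG := EG) G) (x : W) :
    ContMDiffAt (𝓘(ℝ, ℝ).prod I) 𝓘(ℝ, ℝ) ∞
      (fun p : ℝ × W ↦ h ((lineCurve ξ p.1)⁻¹ • p.2)) (0, x) := by
  have : IsManifold 𝓘(ℝ, EG) ∞ G := inferInstance
  have h1 : ContMDiffAt (𝓘(ℝ, ℝ).prod I) 𝓘(ℝ, EG) ∞ (fun p : ℝ × W ↦ (lineCurve ξ p.1)⁻¹)
      (0, x) :=
    (contMDiff_inv 𝓘(ℝ, EG) ∞).contMDiffAt.comp (0, x)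
      (show ContMDiffAt _ _ ∞ (lineCurve ξ ∘ Prod.fst) _ from
        ContMDiffAt.comp (0, x) (contMDiffAt_lineCurve ξ) contMDiffAt_fst)
  exact hh.contMDiffAt.comp (0, x) (h1.smul contMDiffAt_snd)

theorem deriv_family_inv_smul {h : W → ℝ} (hh : ContMDiff I 𝓘(ℝ, ℝ) ∞ h)
    (ξ : LieAlg (EG := EG) G) :
    (fun z : W ↦ deriv (fun t ↦ h ((lineCurve ξ t)⁻¹ • z)) 0) =
      fun z ↦ dFn I h z (fundField I ξ z) :=
  funext fun z ↦ (hasDerivAt_comp_inv_smul hh ξ z).deriv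

variable [IsManifold I ∞ W]

/-- The derivative of a smooth function along a fundamental vector field is smooth. -/
theorem contMDiff_dFn_fundField {h : W → ℝ} (hh : ContMDiff I 𝓘(ℝ, ℝ) ∞ h)
    (ξ : LieAlg (EG := EG) G) :
    ContMDiff I 𝓘(ℝ, ℝ) ∞ fun z ↦ dFn I h z (fundField I ξ z) := fun x ↦ by
  rw [← deriv_family_inv_smul hh ξ]
  exact contMDiffAt_deriv_family (Φ := fun t z ↦ h ((lineCurve ξ t)⁻¹ • z))
    (contMDiffAt_family_inv_smul hh ξ x)

variable [FiniteDimensional ℝ E] [T2Space W] [CompactSpace W]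

/-- Smoothness of the field in charts is not needed: its contraction with dh is a derivative of h,
which is smooth by `contMDiff_dFn_fundField`. -/
theorem smooth_contract (ξ : LieAlg (EG := EG) G) {η : FormField I W} (hη : η ∈ SmoothForms I) :
    contract (fundField I ξ) η ∈ SmoothForms I := by
  have : IsManifold I 1 W := .of_le (n := ∞) (by simp)
  refine smoothForms_induction (P := fun η ↦ contract (fundField I ξ) η ∈ SmoothForms I)
    (fun h hh ↦ ?_) (fun h hh ↦ ?_) (fun η η' h h' k k' ↦ ?_) (fun η η' h h' k k' ↦ ?_) hη
  · rw [contract_fnForm]; exact zero_mem _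
  · rw [contract_extD_fnForm _ (mdifferentiable_of_contMDiff hh)]
    exact smooth_fnForm (contMDiff_dFn_fundField hh ξ)
  · rw [contract_mul]; exact add_mem (smooth_mul k h') (smooth_mul (smooth_formInv h) k')
  · rw [map_add]; exact add_mem k k'

variable (I) in
/-- The Lie derivative of a form along a fundamental vector field, by Cartan's formula. -/
def lieForm (ξ : LieAlg (EG := EG) G) (η : FormField I W) : FormField I W :=
  extD I (contract (fundField I ξ) η) + contract (fundField I ξ) (extD I η)

/-- The anticommutator of two odd derivations is an even derivation. -/
theorem lieForm_mul (ξ : LieAlg (EG := EG) G) {η η' : FormField I W} (h : η ∈ SmoothForms I)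
    (h' : η' ∈ SmoothForms I) :
    lieForm I ξ (η * η') = lieForm I ξ η * η' + η * lieForm I ξ η' := by
  have : IsManifold I 1 W := .of_le (n := ∞) (by simp)
  unfold lieForm
  rw [contract_mul, extD_add I (smooth_mul (smooth_contract ξ h) h')
    (smooth_mul (smooth_formInv h) (smooth_contract ξ h')), extD_mul' (smooth_contract ξ h) h',
    extD_mul' (smooth_formInv h) (smooth_contract ξ h'), extD_mul' h h', map_add, contract_mul,
    contract_mul, extD_formInv' h, formInv_formInv, formInv_contract]
  noncomm_ring

/-- Cartan's formula: the derivative of the action on forms at `1` is the Lie derivative. -/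
theorem hasDerivAt_actForm (ξ : LieAlg (EG := EG) G) {η : FormField I W}
    (hη : η ∈ SmoothForms I) (x : W) :
    HasDerivAt (fun t ↦ actForm I (lineCurve ξ t) η x) (lieForm I ξ η x) 0 := by
  have : IsManifold I 1 W := .of_le (n := ∞) (by simp)
  refine smoothForms_induction (P := fun η ↦
      HasDerivAt (fun t ↦ actForm I (lineCurve ξ t) η x) (lieForm I ξ η x) 0)
    (fun h hh ↦ ?_) (fun h hh ↦ ?_) (fun η η' h h' k k' ↦ ?_) (fun η η' h h' k k' ↦ ?_) hη
  · have h1 := hasDerivAt_linear (Algebra.linearMap ℝ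
      (ExteriorAlgebra ℝ (Module.Dual ℝ (TangentSpace I x)))) (hasDerivAt_comp_inv_smul hh ξ x)
    simp only [actForm_fnForm]
    refine h1.congr_deriv ?_
    rw [lieForm, contract_fnForm, extD_zero, zero_add,
      contract_extD_fnForm _ (mdifferentiable_of_contMDiff hh)]
    rfl
  · have hu := contMDiff_dFn_fundField hh ξ
    have hG : ∀ g : G, ContMDiff I I ∞ fun z : W ↦ g • z :=
      ContMDiffSMul.contMDiff_const_smul (I := 𝓘(ℝ, EG))
    -- The translate of dh is the differential of the translate of h, so the claim is the
    -- interchange of d/dt with d.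
    have h1 := hasDerivAt_modelDeriv_family (Φ := fun t z ↦ h ((lineCurve ξ t)⁻¹ • z))
      (contMDiffAt_family_inv_smul hh ξ x)
      (.of_forall fun t ↦ mdifferentiable_of_contMDiff (hh.comp (hG (lineCurve ξ t)⁻¹)) x)
    rw [deriv_family_inv_smul hh ξ] at h1
    let A : (E →L[ℝ] ℝ) →ₗ[ℝ] ExteriorAlgebra ℝ (Module.Dual ℝ (TangentSpace I x)) :=
      ExteriorAlgebra.ι ℝ ∘ₗ (show (E →L[ℝ] ℝ) →ₗ[ℝ] Module.Dual ℝ (TangentSpace I x) from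
        ContinuousLinearMap.coeLM ℝ)
    have h2 := hasDerivAt_linear A h1
    have h3 : (fun t ↦ actForm I (lineCurve ξ t) (extD I (fnForm I h)) x) = fun t ↦
        A (modelDeriv I (fun z ↦ h ((lineCurve ξ t)⁻¹ • z)) x) := by
      funext t
      rw [actForm_extD_fnForm hG _ hh, extD_fnForm (h := fun z ↦ h ((lineCurve ξ t)⁻¹ • z))
        (mdifferentiable_of_contMDiff (hh.comp (hG (lineCurve ξ t)⁻¹)) x)]
      rfl
    rw [h3]
    refine h2.congr_deriv ?_
    rw [lieForm, contract_extD_fnForm _ (mdifferentiable_of_contMDiff hh), extD_extD_fnForm hh,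
      map_zero, add_zero, extD_fnForm (mdifferentiable_of_contMDiff hu x)]
    rfl
  · simp only [actForm_mul]
    refine (hasDerivAt_ext_mul k k').congr_deriv ?_
    rw [lieForm_mul ξ h h', lineCurve_zero, actForm_one, actForm_one]
    rfl
  · simp only [map_add]
    refine (k.add k').congr_deriv ?_
    simp only [lieForm, map_add, extD_add I h h',
      extD_add I (smooth_contract ξ h) (smooth_contract ξ h'), Pi.add_apply]
    abel

end LieDerivative

/-! ### Products of curves in a Lie group. -/

section LieGroupCalculus

open Set Filter Topology VectorField

variable {EG : Type*} [NormedAddCommGroup EG] [NormedSpace ℝ EG]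
  {G : Type*} [TopologicalSpace G] [ChartedSpace EG G] [Group G]
  {F : Type*} [NormedAddCommGroup F] [NormedSpace ℝ F]

theorem hasDerivAt_diag {K : ℝ × ℝ → F} (hK : DifferentiableAt ℝ K (0, 0)) {a b : F}
    (ha : HasDerivAt (fun s ↦ K (s, 0)) a 0) (hb : HasDerivAt (fun s ↦ K (0, s)) b 0) :
    HasDerivAt (fun s ↦ K (s, s)) (a + b) 0 := by
  have h := hK.hasFDerivAt
  have e1 := h.comp_hasDerivAt_of_eq (0 : ℝ)
    ((hasDerivAt_id (0 : ℝ)).prodMk (hasDerivAt_const (0 : ℝ) (0 : ℝ))) rfl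
  have e2 := h.comp_hasDerivAt_of_eq (0 : ℝ)
    ((hasDerivAt_const (0 : ℝ) (0 : ℝ)).prodMk (hasDerivAt_id (0 : ℝ))) rfl
  have e3 := h.comp_hasDerivAt_of_eq (0 : ℝ)
    ((hasDerivAt_id (0 : ℝ)).prodMk (hasDerivAt_id (0 : ℝ))) rfl
  rw [ha.unique e1, hb.unique e2, ← map_add, Prod.mk_add_mk, add_zero, zero_add]
  exact e3

variable [LieGroup 𝓘(ℝ, EG) ∞ G]

theorem IsCurve.contMDiffAt_inv {c : ℝ → G} {v : LieAlg (EG := EG) G} (hc : IsCurve c v) :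
    ContMDiffAt 𝓘(ℝ, ℝ) 𝓘(ℝ, EG) ∞ (fun t ↦ (c t)⁻¹) 0 :=
  (contMDiff_inv 𝓘(ℝ, EG) ∞).contMDiffAt.comp 0 hc.smooth

/-- Differentiability of `(s, t) ↦ u (c s * z * (c' t))`. -/
theorem differentiableAt_two_curves {c c' : ℝ → G}
    (hc : ContMDiffAt 𝓘(ℝ, ℝ) 𝓘(ℝ, EG) ∞ c 0) (hc' : ContMDiffAt 𝓘(ℝ, ℝ) 𝓘(ℝ, EG) ∞ c' 0)
    (z : G) {u : G → F} (hu : ContMDiffAt 𝓘(ℝ, EG) 𝓘(ℝ, F) ∞ u (c 0 * z * c' 0)) :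
    DifferentiableAt ℝ (fun p : ℝ × ℝ ↦ u (c p.1 * z * c' p.2)) (0, 0) := by
  have h1 : ContMDiffAt 𝓘(ℝ, ℝ × ℝ) 𝓘(ℝ, EG) ∞ (c ∘ Prod.fst) ((0 : ℝ), (0 : ℝ)) :=
    ContMDiffAt.comp ((0 : ℝ), (0 : ℝ)) hc contDiffAt_fst.contMDiffAt
  have h2 : ContMDiffAt 𝓘(ℝ, ℝ × ℝ) 𝓘(ℝ, EG) ∞ (c' ∘ Prod.snd) ((0 : ℝ), (0 : ℝ)) :=
    ContMDiffAt.comp ((0 : ℝ), (0 : ℝ)) hc' contDiffAt_snd.contMDiffAt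
  have h3 : ContMDiffAt 𝓘(ℝ, ℝ × ℝ) 𝓘(ℝ, F) ∞ (fun p : ℝ × ℝ ↦ u (c p.1 * z * c' p.2)) (0, 0) :=
    ContMDiffAt.comp ((0 : ℝ), (0 : ℝ)) (f := fun p : ℝ × ℝ ↦ c p.1 * z * c' p.2) hu
      ((h1.mul contMDiffAt_const).mul h2)
  exact h3.contDiffAt.differentiableAt (by simp)

theorem contMDiffAt_chart {z : G} (hz : z ∈ (chartAt EG (1 : G)).source) :
    ContMDiffAt 𝓘(ℝ, EG) 𝓘(ℝ, EG) ∞ (extChartAt 𝓘(ℝ, EG) (1 : G)) z :=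
  contMDiffAt_extChartAt' hz

/-- Differentiate c(s)c(s)⁻¹ = 1, treating the two occurrences of s as separate variables. -/
theorem IsCurve.inv {c : ℝ → G} {v : LieAlg (EG := EG) G} (hc : IsCurve c v) :
    IsCurve (fun t ↦ (c t)⁻¹) (-v) := by
  refine ⟨hc.contMDiffAt_inv, by simp [hc.zero], ?_⟩
  obtain ⟨d, hd⟩ : ∃ d, HasDerivAt (fun t ↦ extChartAt 𝓘(ℝ, EG) (1 : G) (c t)⁻¹) d 0 := by
    have h1 : ContMDiffAt 𝓘(ℝ, ℝ) 𝓘(ℝ, EG) ∞ (extChartAt 𝓘(ℝ, EG) (1 : G) ∘ fun t ↦ (c t)⁻¹)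
      0 := ContMDiffAt.comp 0 (contMDiffAt_chart
        (by rw [hc.zero, inv_one]; exact mem_chart_source EG 1)) hc.contMDiffAt_inv
    exact ⟨_, (h1.contDiffAt.differentiableAt (by simp)).hasDerivAt⟩
  have h2 := hasDerivAt_diag (K := fun p : ℝ × ℝ ↦
      extChartAt 𝓘(ℝ, EG) (1 : G) (c p.1 * 1 * (c p.2)⁻¹))
    (differentiableAt_two_curves hc.smooth hc.contMDiffAt_inv 1
      (contMDiffAt_chart (by simp [hc.zero])))
    (by simpa [hc.zero, -extChartAt] using hc.velocity)
    (by simpa [hc.zero, -extChartAt] using hd)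
  simp only [mul_one, mul_inv_cancel] at h2
  have h3 := h2.unique (hasDerivAt_const _ _)
  have h4 := eq_neg_of_add_eq_zero_right h3
  rw [h4] at hd
  exact hd

end LieGroupCalculus

/-! ### The derivative of the adjoint representation. -/

section AdjointDerivative

open Set Filter Topology VectorField

theorem chart_source_mem {EG G : Type*} [TopologicalSpace EG] [TopologicalSpace G]
    [ChartedSpace EG G] [Group G] : (chartAt EG (1 : G)).source ∈ 𝓝 (1 : G) :=
  (chartAt EG (1 : G)).open_source.mem_nhds (mem_chart_source EG 1)

variable {EG : Type*} [NormedAddCommGroup EG] [NormedSpace ℝ EG]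
  {G : Type*} [TopologicalSpace G] [ChartedSpace EG G] [Group G]

/-- The derivative of `x ↦ z * x` at `1`, in the chart at `1`. -/
def leftVel (v : LieAlg (EG := EG) G) (z : G) : EG :=
  modelDeriv 𝓘(ℝ, EG) (fun x : G ↦ extChartAt 𝓘(ℝ, EG) (1 : G) (z * x)) 1 (toModel v)

/-- The derivative of `x ↦ x * z` at `1`, in the chart at `1`. -/
def rightVel (v : LieAlg (EG := EG) G) (z : G) : EG :=
  modelDeriv 𝓘(ℝ, EG) (fun x : G ↦ extChartAt 𝓘(ℝ, EG) (1 : G) (x * z)) 1 (toModel v)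

variable [LieGroup 𝓘(ℝ, EG) ∞ G]

theorem mdifferentiableAt_chart_mul_left {z : G} (hz : z ∈ (chartAt EG (1 : G)).source) :
    MDifferentiableAt 𝓘(ℝ, EG) 𝓘(ℝ, EG) (fun x : G ↦ extChartAt 𝓘(ℝ, EG) (1 : G) (z * x)) 1 := by
  have h : ContMDiffAt 𝓘(ℝ, EG) 𝓘(ℝ, EG) ∞ (extChartAt 𝓘(ℝ, EG) (1 : G) ∘ fun x : G ↦ z * x) 1 :=
    ContMDiffAt.comp 1 (contMDiffAt_chart (by rwa [mul_one])) contMDiff_mul_left.contMDiffAt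
  exact h.mdifferentiableAt (by simp)

theorem mdifferentiableAt_chart_mul_right {z : G} (hz : z ∈ (chartAt EG (1 : G)).source) :
    MDifferentiableAt 𝓘(ℝ, EG) 𝓘(ℝ, EG) (fun x : G ↦ extChartAt 𝓘(ℝ, EG) (1 : G) (x * z)) 1 := by
  have h : ContMDiffAt 𝓘(ℝ, EG) 𝓘(ℝ, EG) ∞ (extChartAt 𝓘(ℝ, EG) (1 : G) ∘ fun x : G ↦ x * z) 1 :=
    ContMDiffAt.comp 1 (contMDiffAt_chart (by rwa [one_mul])) contMDiff_mul_right.contMDiffAt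
  exact h.mdifferentiableAt (by simp)

variable {c : ℝ → G} {v : LieAlg (EG := EG) G}

theorem IsCurve.hasDerivAt_left (hc : IsCurve c v) {z : G}
    (hz : z ∈ (chartAt EG (1 : G)).source) :
    HasDerivAt (fun s ↦ extChartAt 𝓘(ℝ, EG) (1 : G) (z * c s)) (leftVel v z) 0 :=
  hc.hasDerivAt (mdifferentiableAt_chart_mul_left hz)

theorem IsCurve.hasDerivAt_right (hc : IsCurve c v) {z : G}
    (hz : z ∈ (chartAt EG (1 : G)).source) :
    HasDerivAt (fun s ↦ extChartAt 𝓘(ℝ, EG) (1 : G) (c s * z)) (rightVel v z) 0 :=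
  hc.hasDerivAt (mdifferentiableAt_chart_mul_right hz)

/-- The two occurrences of the curve contribute separately by `hasDerivAt_diag`; the minus sign is
the velocity of the inverse curve. -/
theorem IsCurve.hasDerivAt_conj (hc : IsCurve c v) {z : G}
    (hz : z ∈ (chartAt EG (1 : G)).source) :
    HasDerivAt (fun s ↦ extChartAt 𝓘(ℝ, EG) (1 : G) (c s * z * (c s)⁻¹))
      (rightVel v z - leftVel v z) 0 := by
  have h := hasDerivAt_diag (K := fun p : ℝ × ℝ ↦
      extChartAt 𝓘(ℝ, EG) (1 : G) (c p.1 * z * (c p.2)⁻¹))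
    (differentiableAt_two_curves hc.smooth hc.contMDiffAt_inv z
      (contMDiffAt_chart (by simpa [hc.zero] using hz)))
    (by simpa [hc.zero, -extChartAt] using hc.hasDerivAt_right hz)
    (by simpa [hc.zero, -extChartAt] using hc.inv.hasDerivAt_left hz)
  refine h.congr_deriv ?_
  rw [sub_eq_add_neg]
  congr 1
  exact map_neg (modelDeriv 𝓘(ℝ, EG) (fun x : G ↦ extChartAt 𝓘(ℝ, EG) (1 : G) (z * x)) 1)
    (toModel v)

theorem toModel_Ad (g : G) (w : LieAlg (EG := EG) G) :
    toModel (Ad g w) =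
      modelDeriv 𝓘(ℝ, EG) (fun z : G ↦ extChartAt 𝓘(ℝ, EG) (1 : G) (g * z * g⁻¹)) 1
        (toModel w) := by
  have h1 : ContMDiff 𝓘(ℝ, EG) 𝓘(ℝ, EG) ∞ fun z : G ↦ g * z * g⁻¹ :=
    contMDiff_mul_right.comp contMDiff_mul_left
  have h2 := mfderiv_comp_apply_of_eq (x := (1 : G)) (y := (1 : G))
    (g := extChartAt 𝓘(ℝ, EG) (1 : G)) (f := fun z : G ↦ g * z * g⁻¹)
    (mdifferentiableAt_extChartAt (mem_chart_source EG (1 : G))) (h1.mdifferentiable (by simp) 1)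
    (by simp) w
  rw [mfderiv_extChartAt_self] at h2
  exact h2.symm

theorem contMDiffAt_family_conj (hc : IsCurve c v) :
    ContMDiffAt (𝓘(ℝ, ℝ).prod 𝓘(ℝ, EG)) 𝓘(ℝ, EG) ∞
      (fun p : ℝ × G ↦ extChartAt 𝓘(ℝ, EG) (1 : G) (c p.1 * p.2 * (c p.1)⁻¹)) (0, 1) := by
  have h1 : ContMDiffAt (𝓘(ℝ, ℝ).prod 𝓘(ℝ, EG)) 𝓘(ℝ, EG) ∞ (c ∘ Prod.fst) ((0 : ℝ), (1 : G)) :=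
    ContMDiffAt.comp ((0 : ℝ), (1 : G)) hc.smooth contMDiffAt_fst
  have h2 : ContMDiffAt (𝓘(ℝ, ℝ).prod 𝓘(ℝ, EG)) 𝓘(ℝ, EG) ∞
      ((fun s ↦ (c s)⁻¹) ∘ Prod.fst) ((0 : ℝ), (1 : G)) :=
    ContMDiffAt.comp ((0 : ℝ), (1 : G)) hc.contMDiffAt_inv contMDiffAt_fst
  exact ContMDiffAt.comp ((0 : ℝ), (1 : G)) (f := fun p : ℝ × G ↦ c p.1 * p.2 * (c p.1)⁻¹)
    (contMDiffAt_chart (by simp)) ((h1.mul contMDiffAt_snd).mul h2)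

theorem contMDiffAt_family_right (hc : IsCurve c v) :
    ContMDiffAt (𝓘(ℝ, ℝ).prod 𝓘(ℝ, EG)) 𝓘(ℝ, EG) ∞
      (fun p : ℝ × G ↦ extChartAt 𝓘(ℝ, EG) (1 : G) (c p.1 * p.2)) (0, 1) := by
  have h1 : ContMDiffAt (𝓘(ℝ, ℝ).prod 𝓘(ℝ, EG)) 𝓘(ℝ, EG) ∞ (c ∘ Prod.fst) ((0 : ℝ), (1 : G)) :=
    ContMDiffAt.comp ((0 : ℝ), (1 : G)) hc.smooth contMDiffAt_fst
  exact ContMDiffAt.comp ((0 : ℝ), (1 : G)) (f := fun p : ℝ × G ↦ c p.1 * p.2)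
    (contMDiffAt_chart (by simp [hc.zero])) (h1.mul contMDiffAt_snd)

theorem contMDiffAt_family_left (hc : IsCurve c v) :
    ContMDiffAt (𝓘(ℝ, ℝ).prod 𝓘(ℝ, EG)) 𝓘(ℝ, EG) ∞
      (fun p : ℝ × G ↦ extChartAt 𝓘(ℝ, EG) (1 : G) (p.2 * c p.1)) (0, 1) := by
  have h1 : ContMDiffAt (𝓘(ℝ, ℝ).prod 𝓘(ℝ, EG)) 𝓘(ℝ, EG) ∞ (c ∘ Prod.fst) ((0 : ℝ), (1 : G)) :=
    ContMDiffAt.comp ((0 : ℝ), (1 : G)) hc.smooth contMDiffAt_fst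
  exact ContMDiffAt.comp ((0 : ℝ), (1 : G)) (f := fun p : ℝ × G ↦ p.2 * c p.1)
    (contMDiffAt_chart (by simp [hc.zero])) (contMDiffAt_snd.mul h1)

theorem mdifferentiableAt_leftVel (v : LieAlg (EG := EG) G) :
    MDifferentiableAt 𝓘(ℝ, EG) 𝓘(ℝ, EG) (leftVel v) (1 : G) := by
  have hc := isCurve_lineCurve (G := G) v
  refine (ContMDiffAt.congr_of_eventuallyEq (contMDiffAt_deriv_family (F := EG)
    (Φ := fun s z ↦ extChartAt 𝓘(ℝ, EG) (1 : G) (z * lineCurve v s))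
    (contMDiffAt_family_left hc)) ?_).mdifferentiableAt (n := ∞) (by simp)
  filter_upwards [chart_source_mem (EG := EG)] with z hz
  exact (hc.hasDerivAt_left hz).deriv.symm

theorem mdifferentiableAt_rightVel (v : LieAlg (EG := EG) G) :
    MDifferentiableAt 𝓘(ℝ, EG) 𝓘(ℝ, EG) (rightVel v) (1 : G) := by
  have hc := isCurve_lineCurve (G := G) v
  refine (ContMDiffAt.congr_of_eventuallyEq (contMDiffAt_deriv_family (F := EG)
    (Φ := fun s z ↦ extChartAt 𝓘(ℝ, EG) (1 : G) (lineCurve v s * z))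
    (contMDiffAt_family_right hc)) ?_).mdifferentiableAt (n := ∞) (by simp)
  filter_upwards [chart_source_mem (EG := EG)] with z hz
  exact (hc.hasDerivAt_right hz).deriv.symm

theorem modelDeriv_congr {E F H W : Type*} [NormedAddCommGroup E] [NormedSpace ℝ E]
    [TopologicalSpace H] {I : ModelWithCorners ℝ E H} [TopologicalSpace W] [ChartedSpace H W]
    [NormedAddCommGroup F] [NormedSpace ℝ F] {u u' : W → F} {x : W} (h : u =ᶠ[𝓝 x] u') :
    modelDeriv I u x = modelDeriv I u' x := by
  have := h.mfderiv_eq (I := I) (I' := 𝓘(ℝ, F))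
  exact this

/-- The derivative of the adjoint representation along a curve. -/
theorem IsCurve.hasDerivAt_Ad_aux (hc : IsCurve c v) (w : LieAlg (EG := EG) G) :
    HasDerivAt (fun t ↦ toModel (Ad (c t) w))
      (modelDeriv 𝓘(ℝ, EG) (rightVel v) (1 : G) (toModel w) -
        modelDeriv 𝓘(ℝ, EG) (leftVel v) (1 : G) (toModel w)) 0 := by
  -- Ad(c(t))w is the derivative at z = 1, along w, of c(t)zc(t)⁻¹ in the chart; interchanging
  -- derivatives leaves the z-derivative of the right velocity minus the left one.
  have h1 := hasDerivAt_modelDeriv_family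
    (Φ := fun s z ↦ extChartAt 𝓘(ℝ, EG) (1 : G) (c s * z * (c s)⁻¹))
    (contMDiffAt_family_conj hc) (.of_forall fun t ↦ by
      have h : ContMDiffAt 𝓘(ℝ, EG) 𝓘(ℝ, EG) ∞
          (extChartAt 𝓘(ℝ, EG) (1 : G) ∘ fun x : G ↦ c t * x * (c t)⁻¹) 1 :=
        ContMDiffAt.comp 1 (contMDiffAt_chart (by simp))
          (contMDiff_mul_right.comp contMDiff_mul_left).contMDiffAt
      exact h.mdifferentiableAt (by simp))
  have h2 : (fun z ↦ deriv (fun t ↦ extChartAt 𝓘(ℝ, EG) (1 : G) (c t * z * (c t)⁻¹)) 0) =ᶠ[𝓝 1]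
      rightVel v - leftVel v := by
    filter_upwards [chart_source_mem (EG := EG)] with z hz
    exact (hc.hasDerivAt_conj hz).deriv
  rw [modelDeriv_congr h2] at h1
  have h3 : modelDeriv 𝓘(ℝ, EG) (rightVel v - leftVel v) (1 : G) =
      modelDeriv 𝓘(ℝ, EG) (rightVel v) (1 : G) - modelDeriv 𝓘(ℝ, EG) (leftVel v) (1 : G) :=
    mfderiv_sub (mdifferentiableAt_rightVel v) (mdifferentiableAt_leftVel v)
  rw [h3] at h1
  have h4 := (ContinuousLinearMap.apply ℝ EG (toModel w)).hasFDerivAt.comp_hasDerivAt 0 h1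
  simp only [toModel_Ad]
  exact h4

/-- An invariant vector field in the chart at `1`. -/
theorem mpullbackWithin_mulInvariantVectorField (v : LieAlg (EG := EG) G) {y : EG}
    (hy : y ∈ (extChartAt 𝓘(ℝ, EG) (1 : G)).target) :
    mpullbackWithin 𝓘(ℝ, EG) 𝓘(ℝ, EG) (extChartAt 𝓘(ℝ, EG) (1 : G)).symm
      (mulInvariantVectorField v) (range 𝓘(ℝ, EG)) y =
      leftVel v ((extChartAt 𝓘(ℝ, EG) (1 : G)).symm y) := by
  have : IsManifold 𝓘(ℝ, EG) 1 G := .of_le (n := ∞) (by simp)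
  rw [mpullbackWithin_apply, ContinuousLinearMap.inverse_eq
    (mfderivWithin_extChartAt_symm_comp_mfderiv_extChartAt hy)
    (mfderiv_extChartAt_comp_mfderivWithin_extChartAt_symm hy)]
  have hz : (extChartAt 𝓘(ℝ, EG) (1 : G)).symm y ∈ (chartAt EG (1 : G)).source := by
    rw [← extChartAt_source 𝓘(ℝ, EG)]; exact (extChartAt 𝓘(ℝ, EG) (1 : G)).map_target hy
  set z := (extChartAt 𝓘(ℝ, EG) (1 : G)).symm y
  exact (mfderiv_comp_apply_of_eq (x := (1 : G)) (y := z)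
    (g := extChartAt 𝓘(ℝ, EG) (1 : G)) (f := fun x : G ↦ z * x)
    (mdifferentiableAt_extChartAt hz)
    ((contMDiff_mul_left (I := 𝓘(ℝ, EG)) (n := ∞)).mdifferentiable (by simp) 1) (by simp) v).symm

theorem leftVel_one (v : LieAlg (EG := EG) G) : leftVel v (1 : G) = toModel v := by
  have : IsManifold 𝓘(ℝ, EG) 1 G := .of_le (n := ∞) (by simp)
  unfold leftVel
  simp only [one_mul]
  exact DFunLike.congr_fun (mfderiv_extChartAt_self (I := 𝓘(ℝ, EG)) (x := (1 : G))) v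

/-- The bracket of 𝔤 is that of left-invariant fields, whose expression in the chart at 1 is
`leftVel`; the bracket is then the flat one. -/
theorem toModel_lie (v w : LieAlg (EG := EG) G) :
    toModel ⁅v, w⁆ = modelDeriv 𝓘(ℝ, EG) (leftVel w) (1 : G) (toModel v) -
      modelDeriv 𝓘(ℝ, EG) (leftVel v) (1 : G) (toModel w) := by
  have : IsManifold 𝓘(ℝ, EG) 1 G := .of_le (n := ∞) (by simp)
  have key : ∀ u : LieAlg (EG := EG) G,
      mpullbackWithin 𝓘(ℝ, EG) 𝓘(ℝ, EG) (extChartAt 𝓘(ℝ, EG) (1 : G)).symm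
      (mulInvariantVectorField u) (range 𝓘(ℝ, EG)) =ᶠ[𝓝 (extChartAt 𝓘(ℝ, EG) (1 : G) 1)]
      (leftVel u ∘ (extChartAt 𝓘(ℝ, EG) (1 : G)).symm) := fun u ↦ by
    filter_upwards [extChartAt_target_mem_nhds (I := 𝓘(ℝ, EG)) (1 : G)] with y hy
    exact mpullbackWithin_mulInvariantVectorField u hy
  have key2 : ∀ u : LieAlg (EG := EG) G, modelDeriv 𝓘(ℝ, EG) (leftVel u) (1 : G) =
      fderiv ℝ (leftVel u ∘ (extChartAt 𝓘(ℝ, EG) (1 : G)).symm)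
        (extChartAt 𝓘(ℝ, EG) (1 : G) 1) := fun u ↦ by
    rw [modelDeriv_eq (mdifferentiableAt_leftVel u), ModelWithCorners.range_eq_univ,
      fderivWithin_univ]
  have e1 : toModel ⁅v, w⁆ = lieBracket ℝ
      (leftVel v ∘ (extChartAt 𝓘(ℝ, EG) (1 : G)).symm)
      (leftVel w ∘ (extChartAt 𝓘(ℝ, EG) (1 : G)).symm) (extChartAt 𝓘(ℝ, EG) (1 : G) 1) := by
    have e2 : toModel ⁅v, w⁆ = lieBracketWithin ℝ
        (mpullbackWithin 𝓘(ℝ, EG) 𝓘(ℝ, EG) (extChartAt 𝓘(ℝ, EG) (1 : G)).symm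
          (mulInvariantVectorField v) (range 𝓘(ℝ, EG)))
        (mpullbackWithin 𝓘(ℝ, EG) 𝓘(ℝ, EG) (extChartAt 𝓘(ℝ, EG) (1 : G)).symm
          (mulInvariantVectorField w) (range 𝓘(ℝ, EG))) univ
        (extChartAt 𝓘(ℝ, EG) (1 : G) 1) := by
      unfold toModel
      rw [GroupLieAlgebra.bracket_def, ← mlieBracketWithin_univ, mlieBracketWithin_apply,
        mfderiv_extChartAt_self]
      refine (DFunLike.congr_fun
        (show (ContinuousLinearMap.id ℝ EG).inverse = ContinuousLinearMap.id ℝ EG from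
          ContinuousLinearMap.inverse_id) _).trans ?_
      rw [preimage_univ, univ_inter, ModelWithCorners.range_eq_univ]
      rfl
    refine e2.trans ?_
    have e3 := Filter.EventuallyEq.lieBracket_vectorField_eq (𝕜 := ℝ) (key v) (key w)
    exact (congrFun (lieBracketWithin_univ (𝕜 := ℝ) (E := EG)) _).trans e3
  rw [e1, lieBracket, key2, key2]
  simp only [Function.comp_apply, extChartAt_to_inv, leftVel_one]

/-- Both sides are the mixed second derivative of multiplication at (1, 1) in the chart, with `v` in
the left factor and `w` in the right one. -/
theorem modelDeriv_rightVel (v w : LieAlg (EG := EG) G) :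
    modelDeriv 𝓘(ℝ, EG) (rightVel v) (1 : G) (toModel w) =
      modelDeriv 𝓘(ℝ, EG) (leftVel w) (1 : G) (toModel v) := by
  have hc := isCurve_lineCurve (G := G) v
  have hsrc : ∀ᶠ t in 𝓝 (0 : ℝ), lineCurve v t ∈ (chartAt EG (1 : G)).source :=
    hc.smooth.continuousAt.eventually (by rw [hc.zero]; exact chart_source_mem)
  have h1 := hasDerivAt_modelDeriv_family
    (Φ := fun s z ↦ extChartAt 𝓘(ℝ, EG) (1 : G) (lineCurve v s * z))
    (contMDiffAt_family_right hc) (by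
      filter_upwards [hsrc] with t ht using mdifferentiableAt_chart_mul_left ht)
  have h2 : (fun z ↦ deriv (fun t ↦ extChartAt 𝓘(ℝ, EG) (1 : G) (lineCurve v t * z)) 0) =ᶠ[𝓝 1]
      rightVel v := by
    filter_upwards [chart_source_mem (EG := EG)] with z hz
    exact (hc.hasDerivAt_right hz).deriv
  rw [modelDeriv_congr h2] at h1
  exact ((ContinuousLinearMap.apply ℝ EG (toModel w)).hasFDerivAt.comp_hasDerivAt 0 h1).unique
    (hc.hasDerivAt (mdifferentiableAt_leftVel w))

/-- The derivative of the adjoint representation is the Lie bracket. -/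
theorem IsCurve.hasDerivAt_Ad (hc : IsCurve c v) (w : LieAlg (EG := EG) G) :
    HasDerivAt (fun t ↦ toModel (Ad (c t) w)) (toModel ⁅v, w⁆) 0 := by
  rw [toModel_lie, ← modelDeriv_rightVel]
  exact hc.hasDerivAt_Ad_aux w

end AdjointDerivative

/-! ### Algebra of the adjoint representation. -/

section AdjointRepresentation

open Set Filter Topology

variable {EG : Type*} [NormedAddCommGroup EG] [NormedSpace ℝ EG]
  {G : Type*} [TopologicalSpace G] [ChartedSpace EG G] [Group G]

theorem Ad_one (w : LieAlg (EG := EG) G) : Ad (1 : G) w = w := by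
  have h : (fun z : G ↦ 1 * z * 1⁻¹) = id := by funext z; simp
  have : mfderiv 𝓘(ℝ, EG) 𝓘(ℝ, EG) (fun z : G ↦ 1 * z * 1⁻¹) 1 =
      mfderiv 𝓘(ℝ, EG) 𝓘(ℝ, EG) id (1 : G) := by rw [h]
  exact DFunLike.congr_fun (this.trans mfderiv_id) w

variable [LieGroup 𝓘(ℝ, EG) ∞ G]

theorem contMDiff_conj (g : G) : ContMDiff 𝓘(ℝ, EG) 𝓘(ℝ, EG) ∞ fun z : G ↦ g * z * g⁻¹ :=
  contMDiff_mul_right.comp contMDiff_mul_left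

theorem hasDerivAt_bilin {X Y Z : Type*} [NormedAddCommGroup X] [NormedSpace ℝ X]
    [FiniteDimensional ℝ X] [NormedAddCommGroup Y] [NormedSpace ℝ Y] [FiniteDimensional ℝ Y]
    [NormedAddCommGroup Z] [NormedSpace ℝ Z] (B : X →ₗ[ℝ] Y →ₗ[ℝ] Z) {u : ℝ → X} {v : ℝ → Y}
    {u' : X} {v' : Y} {t : ℝ} (hu : HasDerivAt u u' t) (hv : HasDerivAt v v' t) :
    HasDerivAt (fun s ↦ B (u s) (v s)) (B (u t) v' + B u' (v t)) t := by
  have := (bilinCLM B).hasFDerivAt_of_bilinear hu.hasFDerivAt hv.hasFDerivAt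
  refine this.hasDerivAt.congr_deriv ?_
  simp

theorem Ad_mul (g h : G) (w : LieAlg (EG := EG) G) : Ad (g * h) w = Ad g (Ad h w) := by
  have e : (fun z : G ↦ g * h * z * (g * h)⁻¹) = (fun z ↦ g * z * g⁻¹) ∘ fun z ↦ h * z * h⁻¹ := by
    funext z; simp [mul_assoc]
  have : mfderiv 𝓘(ℝ, EG) 𝓘(ℝ, EG) (fun z : G ↦ g * h * z * (g * h)⁻¹) 1 =
      mfderiv 𝓘(ℝ, EG) 𝓘(ℝ, EG) ((fun z ↦ g * z * g⁻¹) ∘ fun z : G ↦ h * z * h⁻¹) 1 := by rw [e]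
  exact (DFunLike.congr_fun this w).trans
    (mfderiv_comp_apply_of_eq (x := (1 : G)) (y := (1 : G)) (g := fun z : G ↦ g * z * g⁻¹)
      (f := fun z : G ↦ h * z * h⁻¹) ((contMDiff_conj g).mdifferentiable (by simp) 1)
      ((contMDiff_conj h).mdifferentiable (by simp) 1) (by simp) w)

theorem Ad_inv_Ad (g : G) (w : LieAlg (EG := EG) G) : Ad g⁻¹ (Ad g w) = w := by
  rw [← Ad_mul, inv_mul_cancel, Ad_one]

theorem IsCurve.conj {c : ℝ → G} {v : LieAlg (EG := EG) G} (hc : IsCurve c v) (g : G) :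
    IsCurve (fun t ↦ g * c t * g⁻¹) (Ad g v) := by
  refine ⟨(contMDiff_conj g).contMDiffAt.comp 0 hc.smooth, by simp [hc.zero], ?_⟩
  have h : ContMDiffAt 𝓘(ℝ, EG) 𝓘(ℝ, EG) ∞
      (extChartAt 𝓘(ℝ, EG) (1 : G) ∘ fun x : G ↦ g * x * g⁻¹) 1 :=
    ContMDiffAt.comp 1 (contMDiffAt_chart (by simp)) (contMDiff_conj g).contMDiffAt
  refine (hc.hasDerivAt (h.mdifferentiableAt (by simp))).congr_deriv ?_
  exact (toModel_Ad g v).symm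

variable [FiniteDimensional ℝ EG]

theorem IsCurve.hasDerivAt_linear_Ad {F : Type*} [NormedAddCommGroup F] [NormedSpace ℝ F]
    {c : ℝ → G} {v : LieAlg (EG := EG) G} (hc : IsCurve c v) (w : LieAlg (EG := EG) G)
    (l : LieAlg (EG := EG) G →ₗ[ℝ] F) :
    HasDerivAt (fun t ↦ l (Ad (c t) w)) (l ⁅v, w⁆) 0 :=
  hasDerivAt_linear (X := EG) l (hc.hasDerivAt_Ad w)

/-- Differentiate Ad(g)Ad(c(t))w = Ad(g c(t) g⁻¹)Ad(g)w; the conjugated curve has velocity Ad(g)v.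
-/
theorem Ad_lie (g : G) (v w : LieAlg (EG := EG) G) : Ad g ⁅v, w⁆ = ⁅Ad g v, Ad g w⁆ := by
  have hc := isCurve_lineCurve (G := G) v
  have h1 := hasDerivAt_linear (X := EG) (Y := EG) (Ad g) (hc.hasDerivAt_Ad w)
  have h2 := (hc.conj g).hasDerivAt_Ad (Ad g w)
  refine h1.unique (h2.congr_of_eventuallyEq (.of_forall fun t ↦ ?_))
  have : Ad g (Ad (lineCurve v t) w) = Ad (g * lineCurve v t * g⁻¹) (Ad g w) := by
    rw [Ad_mul, Ad_mul, Ad_inv_Ad]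
  exact this

end AdjointRepresentation

/-! ### Equivariance of fundamental fields and contractions. -/

section Equivariance

open Set Filter Topology

variable {EG : Type*} [NormedAddCommGroup EG] [NormedSpace ℝ EG]
  {G : Type*} [TopologicalSpace G] [ChartedSpace EG G] [Group G]
  {E : Type*} [NormedAddCommGroup E] [NormedSpace ℝ E] {H : Type*} [TopologicalSpace H]
  {I : ModelWithCorners ℝ E H} {W : Type*} [TopologicalSpace W] [ChartedSpace H W] [MulAction G W]

variable (I) in
/-- The fundamental vector field at `x`, as a linear map. -/
def fundLin (x : W) : LieAlg (EG := EG) G →ₗ[ℝ] TangentSpace I x where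
  toFun ξ := fundField I ξ x
  map_add' ξ ξ' := map_add (mfderiv 𝓘(ℝ, EG) I (fun g : G ↦ g⁻¹ • x) 1) ξ ξ'
  map_smul' r ξ := map_smul (mfderiv 𝓘(ℝ, EG) I (fun g : G ↦ g⁻¹ • x) 1) r ξ

theorem fundLin_apply (x : W) (ξ : LieAlg (EG := EG) G) : fundLin I x ξ = fundField I ξ x := rfl

variable [LieGroup 𝓘(ℝ, EG) ∞ G] [ContMDiffSMul 𝓘(ℝ, EG) I ∞ G W]

/-- Differentiate g h⁻¹ x = (g h g⁻¹)⁻¹(g x) in h at 1. -/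
theorem actDeriv_fundField (g : G) (x : W) (ξ : LieAlg (EG := EG) G) :
    actDeriv I g x (fundField I ξ x) = fundField I (Ad g ξ) (g • x) := by
  have hG : ∀ g : G, ContMDiff I I ∞ fun z : W ↦ g • z :=
    ContMDiffSMul.contMDiff_const_smul (I := 𝓘(ℝ, EG))
  have h1 := mfderiv_comp_apply_of_eq (x := (1 : G)) (y := x) (g := fun z : W ↦ g • z)
    (f := fun h : G ↦ h⁻¹ • x) ((hG g).mdifferentiable (by simp) x)
    ((contMDiff_inv_smul (EG := EG) x).mdifferentiable (by simp) 1) (by simp) ξ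
  have h2 := mfderiv_comp_apply_of_eq (x := (1 : G)) (y := (1 : G))
    (g := fun h : G ↦ h⁻¹ • (g • x)) (f := fun h : G ↦ g * h * g⁻¹)
    ((contMDiff_inv_smul (EG := EG) (I := I) (g • x)).mdifferentiable (by simp) 1)
    ((contMDiff_conj (EG := EG) g).mdifferentiable (by simp) 1) (by simp) ξ
  have e : (fun z : W ↦ g • z) ∘ (fun h : G ↦ h⁻¹ • x) =
      (fun h : G ↦ h⁻¹ • (g • x)) ∘ fun h : G ↦ g * h * g⁻¹ := by
    funext h; simp [mul_smul]
  have h3 : mfderiv 𝓘(ℝ, EG) I ((fun z : W ↦ g • z) ∘ (fun h : G ↦ h⁻¹ • x)) 1 =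
      mfderiv 𝓘(ℝ, EG) I ((fun h : G ↦ h⁻¹ • (g • x)) ∘ fun h : G ↦ g * h * g⁻¹) 1 := by rw [e]
  exact h1.symm.trans ((DFunLike.congr_fun h3 ξ).trans h2)

theorem contract_actForm (g : G) (ξ : LieAlg (EG := EG) G) (ζ : FormField I W) :
    contract (fundField I ξ) (actForm I g ζ) =
      actForm I g (contract (fundField I (Ad g⁻¹ ξ)) ζ) := by
  funext x
  change contractExt (fundField I ξ x) (pullExt (actDeriv I g⁻¹ x) (ζ (g⁻¹ • x))) =
    pullExt (actDeriv I g⁻¹ x) (contractExt (fundField I (Ad g⁻¹ ξ) (g⁻¹ • x)) (ζ (g⁻¹ • x)))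
  rw [contractExt_pullExt, actDeriv_fundField]

variable [IsManifold I ∞ W] [FiniteDimensional ℝ E] [T2Space W] [CompactSpace W]
  [FiniteDimensional ℝ EG]

/-- The commutator of a Lie derivative and a contraction. -/
theorem lieForm_contract (ξ ξ' : LieAlg (EG := EG) G) {ζ : FormField I W}
    (hζ : ζ ∈ SmoothForms I) :
    lieForm I ξ (contract (fundField I ξ') ζ) =
      contract (fundField I ξ') (lieForm I ξ ζ) + contract (fundField I ⁅ξ, ξ'⁆) ζ := by
  funext x
  have h1 := hasDerivAt_actForm ξ (smooth_contract ξ' hζ) x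
  have h2 := hasDerivAt_actForm ξ hζ x
  -- Contraction as a bilinear map of vector and form. It serves to differentiate g·(ι_ξ' ζ) =
  -- ι_{Ad(g)ξ'}(g·ζ), which yields one term from the form and one from the field.
  let B : EG →ₗ[ℝ] ExteriorAlgebra ℝ (Module.Dual ℝ (TangentSpace I x)) →ₗ[ℝ]
      ExteriorAlgebra ℝ (Module.Dual ℝ (TangentSpace I x)) :=
    LinearMap.mk₂ ℝ (fun v y ↦ contractExt (fundLin (EG := EG) (G := G) I x v) y)
      (fun v v' y ↦ (congrArg (contractExt · y) (map_add (fundLin I x) v v')).trans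
        (contractExt_add _ _ _))
      (fun r v y ↦ (congrArg (contractExt · y) (map_smul (fundLin I x) r v)).trans
        (contractExt_smul _ _ _))
      (fun v y y' ↦ map_add _ _ _) (fun r v y ↦ map_smul _ _ _)
  have h3 := (isCurve_lineCurve (G := G) ξ).hasDerivAt_Ad ξ'
  have h4 := hasDerivAt_bilin B h3 h2
  refine (h1.unique (h4.congr_of_eventuallyEq (.of_forall fun t ↦ ?_))).trans ?_
  · have : actForm I (lineCurve ξ t) (contract (fundField I ξ') ζ) =
        contract (fundField I (Ad (lineCurve ξ t) ξ')) (actForm I (lineCurve ξ t) ζ) := by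
      rw [contract_actForm, Ad_inv_Ad]
    exact congrFun this x
  · rw [lineCurve_zero, Ad_one, actForm_one]; rfl

end Equivariance

/-! ### Lie algebra axioms for the bracket of G. -/

section LieBracket

variable {EG : Type*} [NormedAddCommGroup EG] [NormedSpace ℝ EG] [FiniteDimensional ℝ EG]
  {G : Type*} [TopologicalSpace G] [ChartedSpace EG G] [Group G] [LieGroup 𝓘(ℝ, EG) ∞ G]

/-- The Lie ring structure on the tangent space at 1 asks for regularity `minSmoothness ℝ 3`, which
over the reals is C³. -/
theorem lieGroup_minSmoothness {EG : Type*} [NormedAddCommGroup EG] [NormedSpace ℝ EG]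
    {G : Type*} [TopologicalSpace G] [ChartedSpace EG G] [Group G] [LieGroup 𝓘(ℝ, EG) ∞ G] :
    LieGroup 𝓘(ℝ, EG) (minSmoothness ℝ 3) G := .of_le (n := ∞) (by
  simp only [minSmoothness_of_isRCLikeNormedField]
  exact WithTop.coe_le_coe.2 (le_top : (3 : ℕ∞) ≤ ⊤))

theorem neg_lieAlg (v w : LieAlg (EG := EG) G) : ⁅-v, w⁆ = -⁅v, w⁆ := by
  have : CompleteSpace EG := FiniteDimensional.complete ℝ EG
  have : LieGroup 𝓘(ℝ, EG) (minSmoothness ℝ 3) G := lieGroup_minSmoothness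
  exact neg_lie v w

theorem lieAlg_skew (v w : LieAlg (EG := EG) G) : -⁅w, v⁆ = ⁅v, w⁆ := by
  have : CompleteSpace EG := FiniteDimensional.complete ℝ EG
  have : LieGroup 𝓘(ℝ, EG) (minSmoothness ℝ 3) G := lieGroup_minSmoothness
  exact lie_skew v w

theorem lieAlg_jacobi (u v w : LieAlg (EG := EG) G) :
    ⁅u, ⁅v, w⁆⁆ + ⁅v, ⁅w, u⁆⁆ + ⁅w, ⁅u, v⁆⁆ = 0 := by
  have : CompleteSpace EG := FiniteDimensional.complete ℝ EG
  have : LieGroup 𝓘(ℝ, EG) (minSmoothness ℝ 3) G := lieGroup_minSmoothness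
  exact lie_jacobi u v w

variable (EG G) in
/-- The Lie bracket as a bilinear map. -/
def lieBilin : LieAlg (EG := EG) G →ₗ[ℝ] LieAlg (EG := EG) G →ₗ[ℝ] LieAlg (EG := EG) G := by
  have : CompleteSpace EG := FiniteDimensional.complete ℝ EG
  have : LieGroup 𝓘(ℝ, EG) (minSmoothness ℝ 3) G := lieGroup_minSmoothness
  exact LinearMap.mk₂ ℝ (fun v w ↦ ⁅v, w⁆) add_lie smul_lie lie_add fun r v w ↦ lie_smul r v w

theorem lieBilin_apply (v w : LieAlg (EG := EG) G) : lieBilin EG G v w = ⁅v, w⁆ := rfl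

end LieBracket

/-! ### The form ω_f and its symmetries. -/

section DegenerateConnection

open Set Filter Topology

variable {EG : Type*} [NormedAddCommGroup EG] [NormedSpace ℝ EG]
  {G : Type*} [TopologicalSpace G] [ChartedSpace EG G] [Group G]
  {E : Type*} [NormedAddCommGroup E] [NormedSpace ℝ E] {H : Type*} [TopologicalSpace H]
  {I : ModelWithCorners ℝ E H} {W : Type*} [TopologicalSpace W] [ChartedSpace H W] [MulAction G W]
  [FiniteDimensional ℝ E]

theorem SmoothFormAt.congr_of_eventuallyEq {η η' : FormField I W} {x : W}
    (h : SmoothFormAt I η x) (he : ∀ᶠ z in 𝓝 x, η' z = η z) : SmoothFormAt I η' x := by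
  refine ContDiffWithinAt.congr_of_eventuallyEq h ?_ ?_
  · have h1 : Tendsto (extChartAt I x).symm (𝓝 (extChartAt I x x)) (𝓝 x) := by
      have := continuousAt_extChartAt_symm (I := I) x
      rwa [ContinuousAt, extChartAt_to_inv] at this
    filter_upwards [nhdsWithin_le_nhds (h1.eventually he)] with y hy
    unfold inChart
    rw [hy]
  · unfold inChart
    have : η' ((extChartAt I x).symm (extChartAt I x x)) =
        η ((extChartAt I x).symm (extChartAt I x x)) := by
      have h2 := he.self_of_nhds
      rw [← extChartAt_to_inv (I := I) x] at h2
      exact h2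
    rw [this]

variable (I) in
/-- The properties of `f ω` that remain of those of the connection `ω` where `f` is zero. -/
structure IsDegenerateConnection (f : W → ℝ)
    (conn : ∀ x : W, TangentSpace I x →ₗ[ℝ] LieAlg (EG := EG) G) : Prop where
  smooth : ContMDiff I 𝓘(ℝ, ℝ) ∞ f
  invariant : ∀ (g : G) x, f (g • x) = f x
  smooth_omega : ∀ l, omegaF I f conn l ∈ SmoothForms I
  vertical : ∀ x ξ, f x • conn x (fundField I ξ x) = f x • ξ
  equivariant : ∀ x (g : G) (v : TangentSpace I x),
    f x • conn (g • x) (actDeriv I g x v) = f x • Ad g (conn x v)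

variable {f : W → ℝ} {conn : ∀ x : W, TangentSpace I x →ₗ[ℝ] LieAlg (EG := EG) G}

/-- Where f is nonzero the point lies in W⁰ and the properties of ω apply; near the complement of W⁰
the form fω vanishes identically. The vanishing condition on f enters only here, and everything
afterwards is global on W. -/
theorem IsConnection.isDegenerateConnection (hω : IsConnection I conn) (hf : IsCutoff G I f) :
    IsDegenerateConnection I f conn := by
  have h0 : ∀ x, f x ≠ 0 → x ∈ locallyFreeLocus G W := fun x hx ↦ by
    by_contra h
    exact hx (hf.vanish.self_of_nhdsSet x h)
  refine ⟨hf.smooth, hf.invariant, fun l x ↦ ?_, fun x ξ ↦ ?_, fun x g v ↦ ?_⟩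
  · by_cases hx : x ∈ locallyFreeLocus G W
    · have h1 := (smoothFormAt_fnForm (I := I) (hf.smooth x)).mul (hω.smooth x hx l)
      refine h1.congr_of_eventuallyEq (.of_forall fun z ↦ ?_)
      exact (map_smul (ExteriorAlgebra.ι ℝ) (f z) (l ∘ₗ conn z)).trans (Algebra.smul_def _ _)
    · have h1 : SmoothFormAt I (0 : FormField I W) x := (SmoothForms I).zero_mem x
      refine h1.congr_of_eventuallyEq ?_
      filter_upwards [hf.vanish.filter_mono (nhds_le_nhdsSet hx)] with z hz
      change ExteriorAlgebra.ι ℝ (f z • (l ∘ₗ conn z)) = 0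
      rw [hz, zero_smul, map_zero]
  · by_cases hx : f x = 0
    · rw [hx, zero_smul, zero_smul]
    · rw [hω.vertical x (h0 x hx)]
  · by_cases hx : f x = 0
    · rw [hx, zero_smul, zero_smul]
    · rw [hω.equivariant x (h0 x hx)]

theorem omegaF_mul (t : ℝ) (l : Module.Dual ℝ (LieAlg (EG := EG) G)) :
    omegaF I (fun x ↦ t * f x) conn l = t • omegaF I f conn l := by
  funext x
  exact (congrArg (ExteriorAlgebra.ι ℝ) (mul_smul t (f x) (l ∘ₗ conn x))).trans
    (map_smul (ExteriorAlgebra.ι ℝ) _ _)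

/-- This scaling supplies the homotopy. Any real `t` is allowed, although tf may then leave [0, 1].
-/
theorem IsDegenerateConnection.mul (h : IsDegenerateConnection I f conn) (t : ℝ) :
    IsDegenerateConnection I (fun x ↦ t * f x) conn where
  smooth := contMDiff_const.mul h.smooth
  invariant g x := by rw [h.invariant]
  smooth_omega l := by
    rw [omegaF_mul]; exact Submodule.smul_mem _ _ (h.smooth_omega l)
  vertical x ξ := by rw [mul_smul, h.vertical, mul_smul]
  equivariant x g v := by rw [mul_smul, h.equivariant, mul_smul]

theorem IsDegenerateConnection.contract_omegaF (h : IsDegenerateConnection I f conn)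
    (ξ : LieAlg (EG := EG) G) (l : Module.Dual ℝ (LieAlg (EG := EG) G)) :
    contract (fundField I ξ) (omegaF I f conn l) = fnForm I fun x ↦ l ξ * f x := by
  funext x
  change contractExt (fundField I ξ x) (ExteriorAlgebra.ι ℝ (f x • (l ∘ₗ conn x))) = _
  rw [contractExt_ι]
  change algebraMap ℝ _ (f x • l (conn x (fundField I ξ x))) = algebraMap ℝ _ (l ξ * f x)
  rw [← map_smul, h.vertical, map_smul, smul_eq_mul, mul_comm]

theorem IsDegenerateConnection.actForm_omegaF (h : IsDegenerateConnection I f conn)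
    (g : G) (l : Module.Dual ℝ (LieAlg (EG := EG) G)) :
    actForm I g (omegaF I f conn l) = omegaF I f conn (l ∘ₗ Ad g⁻¹) := by
  funext x
  change pullExt (actDeriv I g⁻¹ x) (ExteriorAlgebra.ι ℝ (f (g⁻¹ • x) • (l ∘ₗ conn (g⁻¹ • x)))) =
    ExteriorAlgebra.ι ℝ (f x • ((l ∘ₗ Ad g⁻¹) ∘ₗ conn x))
  rw [pullExt_ι, h.invariant]
  congr 1
  ext v
  change f x • l (conn (g⁻¹ • x) (actDeriv I g⁻¹ x v)) = f x • l (Ad g⁻¹ (conn x v))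
  rw [← map_smul, h.equivariant, map_smul]

variable {k : ℕ} (b : Module.Basis (Fin k) ℝ (LieAlg (EG := EG) G))

theorem dual_comp_eq_sum {M : Type*} [AddCommGroup M] [Module ℝ M] (b : Module.Basis (Fin k) ℝ M)
    (l : Module.Dual ℝ M) (A : M →ₗ[ℝ] M) : l ∘ₗ A = ∑ c, l (A (b c)) • b.coord c := by
  refine b.ext fun e ↦ ?_
  simp [Finsupp.single_apply]

variable [LieGroup 𝓘(ℝ, EG) ∞ G] [ContMDiffSMul 𝓘(ℝ, EG) I ∞ G W] [IsManifold I ∞ W] [T2Space W]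
  [CompactSpace W] [FiniteDimensional ℝ EG]

theorem hasDerivAt_dual_Ad_inv (l : Module.Dual ℝ (LieAlg (EG := EG) G))
    (ξ w : LieAlg (EG := EG) G) :
    HasDerivAt (fun t ↦ l (Ad (lineCurve ξ t)⁻¹ w)) (-l ⁅ξ, w⁆) 0 := by
  have h := (isCurve_lineCurve (G := G) ξ).inv.hasDerivAt_linear_Ad w l
  rwa [neg_lieAlg, map_neg] at h

/-- The infinitesimal form of `IsDegenerateConnection.actForm_omegaF`; the sign comes from the
inverse in Ad(g⁻¹). -/
theorem IsDegenerateConnection.lieForm_omegaF (h : IsDegenerateConnection I f conn)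
    (ξ : LieAlg (EG := EG) G) (l : Module.Dual ℝ (LieAlg (EG := EG) G)) :
    lieForm I ξ (omegaF I f conn l) = -∑ c, l ⁅ξ, b c⁆ • omegaF I f conn (b.coord c) := by
  funext x
  have h1 := hasDerivAt_actForm ξ (h.smooth_omega l) x
  have h2 : HasDerivAt (fun t ↦ ∑ c, l (Ad (lineCurve ξ t)⁻¹ (b c)) • omegaF I f conn (b.coord c) x)
      (∑ c, (-l ⁅ξ, b c⁆) • omegaF I f conn (b.coord c) x) 0 :=
    HasDerivAt.fun_sum fun c _ ↦ (hasDerivAt_dual_Ad_inv l ξ (b c)).smul_const _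
  refine (h1.unique (h2.congr_of_eventuallyEq (.of_forall fun t ↦ ?_))).trans ?_
  · dsimp only
    rw [h.actForm_omegaF, dual_comp_eq_sum b, map_sum, Finset.sum_apply]
    simp only [map_smul, Pi.smul_apply]
  · simp

end DegenerateConnection

/-! ### Polynomials in Θ with coefficients in forms. -/

section PolynomialAlgebra

open AddMonoidAlgebra

variable {E : Type*} [NormedAddCommGroup E] [NormedSpace ℝ E] {H : Type*} [TopologicalSpace H]
  {I : ModelWithCorners ℝ E H} {W : Type*} [TopologicalSpace W] [ChartedSpace H W] {k : ℕ}

theorem constForm_mul (η η' : FormField I W) :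
    (constForm (η * η') : PolyForm I W k) = constForm η * constForm η' := by
  simp [constForm, single_mul_single]

theorem constForm_add (η η' : FormField I W) :
    (constForm (η + η') : PolyForm I W k) = constForm η + constForm η' := single_add _ _ _

theorem constForm_neg (η : FormField I W) :
    (constForm (-η) : PolyForm I W k) = -constForm η := single_neg _ _

theorem constForm_zero : (constForm (0 : FormField I W) : PolyForm I W k) = 0 := single_zero _

theorem constForm_smul (r : ℝ) (η : FormField I W) :
    (constForm (r • η) : PolyForm I W k) = r • constForm η := (smul_single _ _ _).symm

theorem constForm_one : (constForm (1 : FormField I W) : PolyForm I W k) = 1 := rfl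

theorem constForm_sum {ι : Type*} (s : Finset ι) (η : ι → FormField I W) :
    (constForm (∑ i ∈ s, η i) : PolyForm I W k) = ∑ i ∈ s, constForm (η i) :=
  map_sum (singleAddHom (0 : Fin k →₀ ℕ)) η s

theorem single_eq_constForm_mul (m : Fin k →₀ ℕ) (η : FormField I W) :
    (single m η : PolyForm I W k) = constForm η * single m 1 := by
  simp [constForm, single_mul_single]

/-- The forms and the variables generate all polynomials. -/
theorem polyForm_induction {S : Set (FormField I W)} (h1 : 1 ∈ S) (h0 : 0 ∈ S)
    {P : PolyForm I W k → Prop} (const : ∀ η ∈ S, P (constForm η)) (theta : ∀ a, P (Theta a))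
    (mul : ∀ α α', (∀ m, α.coeff m ∈ S) → (∀ m, α'.coeff m ∈ S) → P α → P α' → P (α * α'))
    (add : ∀ α α', (∀ m, α.coeff m ∈ S) → (∀ m, α'.coeff m ∈ S) → P α → P α' → P (α + α'))
    {α : PolyForm I W k} (hα : ∀ m, α.coeff m ∈ S) : P α := by
  classical
  have hs : ∀ (m : Fin k →₀ ℕ) {η : FormField I W}, η ∈ S →
      ∀ m', (single m η : PolyForm I W k).coeff m' ∈ S := fun m η hη m' ↦ by
    rw [coeff_single, Finsupp.single_apply]; split_ifs <;> assumption
  have hm : ∀ m : Fin k →₀ ℕ, P (single m 1) := fun m ↦ by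
    induction m using Finsupp.induction_linear with
    | zero => exact const 1 h1
    | add m m' hm hm' =>
      have := mul _ _ (hs m h1) (hs m' h1) hm hm'
      rwa [single_mul_single, one_mul] at this
    | single a n =>
      induction n with
      | zero => rw [Finsupp.single_zero]; exact const 1 h1
      | succ n ih =>
        have := mul (single (Finsupp.single a n) 1) (Theta a) (hs _ h1) (hs _ h1) ih (theta a)
        rwa [Theta, single_mul_single, one_mul, ← Finsupp.single_add] at this
  have hs1 : ∀ m {η}, η ∈ S → P (single m η) := fun m η hη ↦ by
    rw [single_eq_constForm_mul]
    exact mul _ _ (hs 0 hη) (hs m h1) (const η hη) (hm m)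
  revert hα
  induction α using AddMonoidAlgebra.induction with
  | zero => exact fun _ ↦ by rw [← constForm_zero]; exact const 0 h0
  | single_add m η α hmα hη ih =>
    intro hα
    have e1 : η ∈ S := by
      have := hα m
      simpa [Finsupp.notMem_support_iff.1 hmα] using this
    have e2 : ∀ m', α.coeff m' ∈ S := fun m' ↦ by
      by_cases h : m' = m
      · rw [h, Finsupp.notMem_support_iff.1 hmα]; exact h0
      · have := hα m'
        simpa [Finsupp.single_apply, Ne.symm h] using this
    exact add _ _ (hs m e1) e2 (hs1 m e1) (ih e2)

theorem Theta_mul_comm (a : Fin k) (α : PolyForm I W k) : Theta a * α = α * Theta a :=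
  single_commute (fun m' ↦ add_comm _ m') (fun r ↦ Commute.one_left r) α

theorem Theta_mem_center (a : Fin k) :
    (Theta a : PolyForm I W k) ∈ Subalgebra.center ℝ (PolyForm I W k) :=
  Subalgebra.mem_center_iff.2 fun α ↦ (Theta_mul_comm a α).symm

theorem constForm_mem_center {η : FormField I W} (hη : formInv I W η = η) :
    (constForm η : PolyForm I W k) ∈ Subalgebra.center ℝ (PolyForm I W k) :=
  Subalgebra.mem_center_iff.2 fun α ↦ by
    refine (single_commute (fun m' ↦ ?_) (fun r ↦ ?_) α).symm
    · exact (zero_add m').trans (add_zero m').symm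
    · funext x
      exact mul_comm_of_even (congrFun hη x) (r x)

/-- The monomial `P^m`. -/
def monomialOf (P : Fin k → PolyForm I W k) (m : Fin k →₀ ℕ) : PolyForm I W k :=
  ((List.finRange k).map fun a ↦ P a ^ m a).prod

theorem substitute_single (P : Fin k → PolyForm I W k) (h : FormField I W →ₗ[ℝ] FormField I W)
    (m : Fin k →₀ ℕ) (η : FormField I W) :
    substitute P h (single m η) = monomialOf P m * constForm (h η) := by
  simp [substitute, monomialOf, constForm, coeffLinearEquiv]

theorem monomialOf_zero (P : Fin k → PolyForm I W k) : monomialOf P 0 = 1 := by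
  simp [monomialOf]

/-- Forms do not commute, so monomials are ordered products; centrality of one family of factors is
what allows the rearrangement. -/
theorem prod_map_mul_of_center {X ι : Type*} [Ring X] [Algebra ℝ X] (l : List ι) (p q : ι → X)
    (hp : ∀ a, p a ∈ Subalgebra.center ℝ X) :
    (l.map fun a ↦ p a * q a).prod = (l.map p).prod * (l.map q).prod := by
  induction l with
  | nil => simp
  | cons a l ih =>
    have h1 : (l.map p).prod ∈ Subalgebra.center ℝ X :=
      Subalgebra.list_prod_mem _ fun x hx ↦ by
        obtain ⟨a, -, rfl⟩ := List.mem_map.1 hx; exact hp a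
    rw [Subalgebra.mem_center_iff] at h1
    simp only [List.map_cons, List.prod_cons, ih, mul_assoc]
    rw [← mul_assoc (q a), h1 (q a), mul_assoc]

theorem monomialOf_add {P : Fin k → PolyForm I W k}
    (hP : ∀ a, P a ∈ Subalgebra.center ℝ (PolyForm I W k)) (m m' : Fin k →₀ ℕ) :
    monomialOf P (m + m') = monomialOf P m * monomialOf P m' := by
  simp only [monomialOf, Finsupp.add_apply, pow_add]
  exact prod_map_mul_of_center _ _ _ fun a ↦ pow_mem (hP a) _

theorem monomialOf_mem_center {P : Fin k → PolyForm I W k}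
    (hP : ∀ a, P a ∈ Subalgebra.center ℝ (PolyForm I W k)) (m : Fin k →₀ ℕ) :
    monomialOf P m ∈ Subalgebra.center ℝ (PolyForm I W k) :=
  Subalgebra.list_prod_mem _ fun x hx ↦ by
    obtain ⟨a, -, rfl⟩ := List.mem_map.1 hx; exact pow_mem (hP a) _

theorem monomialOf_single (P : Fin k → PolyForm I W k) (a : Fin k) :
    monomialOf P (Finsupp.single a 1) = P a := by
  have h : ∀ l : List (Fin k), l.Nodup →
      (l.map fun c ↦ P c ^ (Finsupp.single a 1 : Fin k →₀ ℕ) c).prod =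
        if a ∈ l then P a else 1 := by
    intro l hl
    induction l with
    | nil => simp
    | cons c l ih =>
      rw [List.nodup_cons] at hl
      rw [List.map_cons, List.prod_cons, ih hl.2]
      by_cases hc : a = c
      · subst hc; simp [hl.1]
      · simp [hc]
  rw [monomialOf, h _ (List.nodup_finRange k), if_pos (List.mem_finRange a)]

theorem substitute_const (P : Fin k → PolyForm I W k) (h : FormField I W →ₗ[ℝ] FormField I W)
    (η : FormField I W) : substitute P h (constForm η) = constForm (h η) := by
  rw [constForm, substitute_single, monomialOf_zero, one_mul]

theorem substitute_theta (P : Fin k → PolyForm I W k) {h : FormField I W →ₗ[ℝ] FormField I W}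
    (h1 : h 1 = 1) (a : Fin k) : substitute P h (Theta a) = P a := by
  rw [Theta, substitute_single, monomialOf_single, h1, constForm_one, mul_one]

/-- Two bilinear expressions agree if they agree on monomials. -/
theorem bilin_ext_single {X : Type*} [AddCommGroup X] [Module ℝ X]
    {B B' : PolyForm I W k →ₗ[ℝ] PolyForm I W k →ₗ[ℝ] X}
    (h : ∀ m η m' η', B (single m η) (single m' η') = B' (single m η) (single m' η'))
    (α β : PolyForm I W k) : B α β = B' α β := by
  induction α using AddMonoidAlgebra.induction_linear with
  | zero => simp
  | add α α' e e' => rw [map_add, map_add, LinearMap.add_apply, LinearMap.add_apply, e, e']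
  | single m η =>
    induction β using AddMonoidAlgebra.induction_linear with
    | zero => simp
    | add β β' e e' => rw [map_add, map_add, e, e']
    | single m' η' => exact h m η m' η'

/-- Substitution of central elements for the variables is multiplicative. -/
theorem substitute_mul {P : Fin k → PolyForm I W k}
    (hP : ∀ a, P a ∈ Subalgebra.center ℝ (PolyForm I W k))
    {h : FormField I W →ₗ[ℝ] FormField I W} (hm : ∀ η η', h (η * η') = h η * h η')
    (α β : PolyForm I W k) :
    substitute P h (α * β) = substitute P h α * substitute P h β := by
  refine bilin_ext_single (B := (LinearMap.mul ℝ (PolyForm I W k)).compr₂ (substitute P h))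
    (B' := (LinearMap.mul ℝ (PolyForm I W k)).compl₁₂ (substitute P h) (substitute P h))
    (fun m η m' η' ↦ ?_) α β
  change substitute P h (single m η * single m' η') =
    substitute P h (single m η) * substitute P h (single m' η')
  rw [single_mul_single, substitute_single, substitute_single, substitute_single,
    monomialOf_add hP, hm, constForm_mul]
  have := Subalgebra.mem_center_iff.1 (monomialOf_mem_center hP m') (constForm (h η))
  simp only [mul_assoc]
  rw [← mul_assoc (constForm (h η)), this, mul_assoc]

theorem mapCoeff_single (h : FormField I W →ₗ[ℝ] FormField I W) (m : Fin k →₀ ℕ)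
    (η : FormField I W) : mapCoeff h (single m η : PolyForm I W k) = single m (h η) := by
  simp [mapCoeff, coeffLinearEquiv]

theorem mapCoeff_coeff (h : FormField I W →ₗ[ℝ] FormField I W) (α : PolyForm I W k)
    (m : Fin k →₀ ℕ) : (mapCoeff h α).coeff m = h (α.coeff m) := by
  simp [mapCoeff, coeffLinearEquiv]

theorem mapCoeff_const (h : FormField I W →ₗ[ℝ] FormField I W)
    (η : FormField I W) : mapCoeff h (constForm η : PolyForm I W k) = constForm (h η) :=
  mapCoeff_single h 0 η

theorem substitute_mapCoeff (P : Fin k → PolyForm I W k)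
    (h h' : FormField I W →ₗ[ℝ] FormField I W) (α : PolyForm I W k) :
    substitute P h (mapCoeff h' α) = substitute P (h ∘ₗ h') α := by
  induction α using AddMonoidAlgebra.induction_linear with
  | zero => simp
  | add α α' e e' => simp only [map_add, e, e']
  | single m η => rw [mapCoeff_single, substitute_single, substitute_single]; rfl

variable (I W k) in
/-- The grading involution on polynomials with coefficients in forms. -/
def polyInv : PolyForm I W k →ₗ[ℝ] PolyForm I W k := mapCoeff (formInv I W).toLinearMap

theorem polyInv_const (η : FormField I W) :
    polyInv I W k (constForm η) = constForm (formInv I W η) := mapCoeff_const _ _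

theorem polyInv_theta (a : Fin k) : polyInv I W k (Theta a) = Theta a := by
  rw [polyInv, Theta, mapCoeff_single]; simp

theorem polyInv_mul (α β : PolyForm I W k) :
    polyInv I W k (α * β) = polyInv I W k α * polyInv I W k β := by
  refine bilin_ext_single (B := (LinearMap.mul ℝ (PolyForm I W k)).compr₂ (polyInv I W k))
    (B' := (LinearMap.mul ℝ (PolyForm I W k)).compl₁₂ (polyInv I W k) (polyInv I W k))
    (fun m η m' η' ↦ ?_) α β
  change mapCoeff _ (single m η * single m' η') =
    mapCoeff _ (single m η) * mapCoeff _ (single m' η')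
  rw [single_mul_single, mapCoeff_single, mapCoeff_single, mapCoeff_single, single_mul_single]
  congr 1
  exact map_mul (formInv I W) η η'

theorem polyInv_polyInv (α : PolyForm I W k) : polyInv I W k (polyInv I W k α) = α := by
  ext m : 2
  simp only [polyInv, mapCoeff_coeff]
  exact formInv_formInv _

/-- Graded commutation with a 1-form. -/
theorem constForm_oneForm_mul (l : ∀ x : W, Module.Dual ℝ (TangentSpace I x))
    (α : PolyForm I W k) :
    constForm (oneForm l) * α = polyInv I W k α * constForm (oneForm l) := by
  induction α using AddMonoidAlgebra.induction_linear with
  | zero => simp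
  | add α α' e e' => rw [mul_add, map_add, add_mul, e, e']
  | single m η =>
    rw [polyInv, mapCoeff_single, constForm, single_mul_single, single_mul_single, zero_add,
      add_zero]
    congr 1
    funext x
    exact ι_mul_eq (l x) (η x)

variable (I W k) in
/-- The derivative with respect to the variable `Θᵃ`. -/
def thetaDeriv (a : Fin k) : PolyForm I W k →ₗ[ℝ] PolyForm I W k :=
  Finsupp.lsum ℝ (fun m : Fin k →₀ ℕ ↦
    (m a : ℝ) • AddMonoidAlgebra.lsingle (R := ℝ) (m - Finsupp.single a 1)) ∘ₗ
    (AddMonoidAlgebra.coeffLinearEquiv ℝ).toLinearMap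

theorem thetaDeriv_single (a : Fin k) (m : Fin k →₀ ℕ) (η : FormField I W) :
    thetaDeriv I W k a (single m η) = (m a : ℝ) • single (m - Finsupp.single a 1) η := by
  simp [thetaDeriv, coeffLinearEquiv]

theorem thetaDeriv_const (a : Fin k) (η : FormField I W) :
    thetaDeriv I W k a (constForm η) = 0 := by
  rw [constForm, thetaDeriv_single]; simp

theorem thetaDeriv_theta (a c : Fin k) :
    thetaDeriv I W k a (Theta c) = if a = c then 1 else 0 := by
  rw [Theta, thetaDeriv_single]
  split_ifs with h
  · subst h; simp; rfl
  · simp [Ne.symm h]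

theorem thetaDeriv_mul (a : Fin k) (α β : PolyForm I W k) :
    thetaDeriv I W k a (α * β) = thetaDeriv I W k a α * β + α * thetaDeriv I W k a β := by
  refine bilin_ext_single (B := (LinearMap.mul ℝ (PolyForm I W k)).compr₂ (thetaDeriv I W k a))
    (B' := (LinearMap.mul ℝ (PolyForm I W k)) ∘ₗ (thetaDeriv I W k a) +
      (LinearMap.mul ℝ (PolyForm I W k)).compl₂ (thetaDeriv I W k a))
    (fun m η m' η' ↦ ?_) α β
  change thetaDeriv I W k a (single m η * single m' η') =
    thetaDeriv I W k a (single m η) * single m' η' +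
      single m η * thetaDeriv I W k a (single m' η')
  -- Truncated subtraction in the exponent is harmless: where it truncates, the scalar in front is
  -- 0.
  have h : ∀ n n' : Fin k →₀ ℕ, (n a : ℝ) • (single (n + n' - Finsupp.single a 1) (η * η') :
      PolyForm I W k) = (n a : ℝ) • single (n - Finsupp.single a 1 + n') (η * η') := fun n n' ↦ by
    by_cases h0 : n a = 0
    · simp [h0]
    · rw [tsub_add_eq_add_tsub (Finsupp.single_le_iff.2 (Nat.one_le_iff_ne_zero.2 h0))]
  rw [single_mul_single, thetaDeriv_single, thetaDeriv_single, thetaDeriv_single, smul_mul_assoc,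
    mul_smul_comm, single_mul_single, single_mul_single, Finsupp.add_apply, Nat.cast_add, add_smul,
    h m m', add_comm m m', h m' m, add_comm m]

theorem thetaDeriv_polyInv (a : Fin k) (α : PolyForm I W k) :
    thetaDeriv I W k a (polyInv I W k α) = polyInv I W k (thetaDeriv I W k a α) := by
  induction α using AddMonoidAlgebra.induction_linear with
  | zero => simp
  | add α α' e e' => simp only [map_add, e, e']
  | single m η =>
    rw [polyInv, mapCoeff_single, thetaDeriv_single, thetaDeriv_single, map_smul, mapCoeff_single]

end PolynomialAlgebra

/-! ### Polynomials with smooth coefficients and the operator 1 ⊗ d. -/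

section SmoothPolynomials

open AddMonoidAlgebra

variable {E : Type*} [NormedAddCommGroup E] [NormedSpace ℝ E] {H : Type*} [TopologicalSpace H]
  {I : ModelWithCorners ℝ E H} {W : Type*} [TopologicalSpace W] [ChartedSpace H W] {k : ℕ}
  [FiniteDimensional ℝ E]

variable (I W k) in
/-- The space `S(𝔤^*) ⊗ Ω(W)`. -/
def SmoothPolys : Submodule ℝ (PolyForm I W k) where
  carrier := {α | ∀ m, α.coeff m ∈ SmoothForms I}
  zero_mem' m := by simp
  add_mem' {α β} hα hβ m := by simpa using add_mem (hα m) (hβ m)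
  smul_mem' c α hα m := by simpa using Submodule.smul_mem _ c (hα m)

theorem coeff_mul_sum (α β : PolyForm I W k) (m : Fin k →₀ ℕ) :
    (α * β).coeff m = ∑ p ∈ Finset.HasAntidiagonal.antidiagonal m, α.coeff p.1 * β.coeff p.2 :=
  coeff_mul_antidiag α β m _ Finset.HasAntidiagonal.mem_antidiagonal

theorem smoothPolys_mul {α β : PolyForm I W k} (hα : α ∈ SmoothPolys I W k)
    (hβ : β ∈ SmoothPolys I W k) : α * β ∈ SmoothPolys I W k := fun m ↦ by
  rw [coeff_mul_sum]
  exact sum_mem fun p _ ↦ smooth_mul (hα _) (hβ _)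

theorem smoothPolys_single (m : Fin k →₀ ℕ) {η : FormField I W} (hη : η ∈ SmoothForms I) :
    (single m η : PolyForm I W k) ∈ SmoothPolys I W k := fun m' ↦ by
  classical
  rw [coeff_single, Finsupp.single_apply]
  split_ifs
  exacts [hη, zero_mem _]

theorem smoothPolys_const {η : FormField I W} (hη : η ∈ SmoothForms I) :
    (constForm η : PolyForm I W k) ∈ SmoothPolys I W k := smoothPolys_single 0 hη

theorem smoothPolys_polyInv {α : PolyForm I W k} (hα : α ∈ SmoothPolys I W k) :
    polyInv I W k α ∈ SmoothPolys I W k := fun m ↦ by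
  rw [polyInv, mapCoeff_coeff]
  exact smooth_formInv (hα m)

/-- Additivity of `polyD` is available only for smooth coefficients, so the induction carries
smoothness of both summands. -/
theorem smoothPolys_induction_single {P : PolyForm I W k → Prop} (zero : P 0)
    (single : ∀ m, ∀ η ∈ SmoothForms I, P (single m η))
    (add : ∀ α ∈ SmoothPolys I W k, ∀ α' ∈ SmoothPolys I W k, P α → P α' → P (α + α'))
    {α : PolyForm I W k} (hα : α ∈ SmoothPolys I W k) : P α := by
  have h : ∀ s : Finset (Fin k →₀ ℕ), P (∑ m ∈ s, AddMonoidAlgebra.single m (α.coeff m)) := by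
    classical
    intro s
    induction s using Finset.induction_on with
    | empty => simpa using zero
    | insert m s hm ih =>
      rw [Finset.sum_insert hm]
      exact add _ (smoothPolys_single m (hα m)) _
        (sum_mem fun m _ ↦ smoothPolys_single m (hα m)) (single m _ (hα m)) ih
  have := h α.coeff.support
  rwa [show ∑ m ∈ α.coeff.support, AddMonoidAlgebra.single m (α.coeff m) = α from
    sum_coeff_single α] at this

variable (I) in
/-- The operator `1 ⊗ d`. -/
def polyD (α : PolyForm I W k) : PolyForm I W k :=
  .ofCoeff (α.coeff.mapRange (extD I) (extD_zero I))

theorem polyD_coeff (α : PolyForm I W k) (m : Fin k →₀ ℕ) :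
    (polyD I α).coeff m = extD I (α.coeff m) := by simp [polyD]

theorem polyD_single (m : Fin k →₀ ℕ) (η : FormField I W) :
    polyD I (single m η : PolyForm I W k) = single m (extD I η) := by
  simp [polyD]

theorem polyD_zero : polyD I (0 : PolyForm I W k) = 0 := by
  simp [polyD]

theorem polyD_add {α β : PolyForm I W k} (hα : α ∈ SmoothPolys I W k)
    (hβ : β ∈ SmoothPolys I W k) : polyD I (α + β) = polyD I α + polyD I β := by
  ext m : 2
  simpa [polyD] using extD_add I (hα m) (hβ m)

theorem polyD_smul (r : ℝ) {α : PolyForm I W k} (hα : α ∈ SmoothPolys I W k) :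
    polyD I (r • α) = r • polyD I α := by
  ext m : 2
  simpa [polyD] using extD_smul I r (hα m)

theorem mapCoeff_contract_mul (X : ∀ x : W, TangentSpace I x) (α β : PolyForm I W k) :
    mapCoeff (contract X) (α * β) =
      mapCoeff (contract X) α * β + polyInv I W k α * mapCoeff (contract X) β := by
  refine bilin_ext_single (B := (LinearMap.mul ℝ (PolyForm I W k)).compr₂ (mapCoeff (contract X)))
    (B' := (LinearMap.mul ℝ (PolyForm I W k)) ∘ₗ (mapCoeff (contract X)) +
      (LinearMap.mul ℝ (PolyForm I W k)).compl₁₂ (polyInv I W k) (mapCoeff (contract X)))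
    (fun m η m' η' ↦ ?_) α β
  change mapCoeff (contract X) (single m η * single m' η') =
    mapCoeff (contract X) (single m η) * single m' η' +
      mapCoeff (formInv I W).toLinearMap (single m η) * mapCoeff (contract X) (single m' η')
  simp only [single_mul_single, mapCoeff_single, contract_mul, single_add]
  rfl

theorem mapCoeff_contract_polyInv (X : ∀ x : W, TangentSpace I x) (α : PolyForm I W k) :
    mapCoeff (contract X) (polyInv I W k α) = -polyInv I W k (mapCoeff (contract X) α) := by
  ext m : 2
  simp only [polyInv, mapCoeff_coeff, coeff_neg, Finsupp.neg_apply]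
  exact (neg_eq_iff_eq_neg.2 (formInv_contract X (α.coeff m))).symm

variable [IsManifold I ∞ W] [T2Space W] [CompactSpace W]

theorem polyD_mul {α β : PolyForm I W k} (hα : α ∈ SmoothPolys I W k)
    (hβ : β ∈ SmoothPolys I W k) :
    polyD I (α * β) = polyD I α * β + polyInv I W k α * polyD I β := by
  refine smoothPolys_induction_single
    (P := fun α ↦ polyD I (α * β) = polyD I α * β + polyInv I W k α * polyD I β)
    (by simp [polyD_zero]) (fun m η hη ↦ ?_) (fun α h α' h' e e' ↦ ?_) hα
  · refine smoothPolys_induction_single (P := fun β ↦ polyD I (single m η * β) =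
        polyD I (single m η) * β + polyInv I W k (single m η) * polyD I β)
      (by simp [polyD_zero]) (fun m' η' hη' ↦ ?_) (fun β h β' h' e e' ↦ ?_) hβ
    · simp only [polyInv, single_mul_single, polyD_single, mapCoeff_single, extD_mul' hη hη',
        single_add]
      rfl
    · have hs := smoothPolys_single m hη
      rw [mul_add, polyD_add (smoothPolys_mul hs h) (smoothPolys_mul hs h'), e, e',
        polyD_add h h', mul_add, mul_add]
      abel
  · rw [add_mul, polyD_add (smoothPolys_mul h hβ) (smoothPolys_mul h' hβ), e, e', polyD_add h h',
      map_add, add_mul, add_mul]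
    abel

theorem polyD_polyInv {α : PolyForm I W k} (hα : α ∈ SmoothPolys I W k) :
    polyD I (polyInv I W k α) = -polyInv I W k (polyD I α) := by
  ext m : 2
  simp only [polyInv, mapCoeff_coeff, coeff_neg, Finsupp.neg_apply, polyD_coeff]
  exact extD_formInv' (hα m)

theorem smoothPolys_polyD {α : PolyForm I W k} (hα : α ∈ SmoothPolys I W k) :
    polyD I α ∈ SmoothPolys I W k := fun m ↦ by
  rw [polyD_coeff]; exact smooth_extD (hα m)

theorem one_mem_smoothForms : (1 : FormField I W) ∈ SmoothForms I :=
  smooth_fnForm (h := fun _ ↦ 1) contMDiff_const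

theorem smoothPolys_theta (a : Fin k) : (Theta a : PolyForm I W k) ∈ SmoothPolys I W k :=
  smoothPolys_single _ one_mem_smoothForms

/-- The functions, their differentials and the variables generate `S(𝔤^*) ⊗ Ω(W)`. -/
theorem smoothPolys_induction {P : PolyForm I W k → Prop}
    (fn : ∀ h : W → ℝ, ContMDiff I 𝓘(ℝ, ℝ) ∞ h → P (constForm (fnForm I h)))
    (d : ∀ h : W → ℝ, ContMDiff I 𝓘(ℝ, ℝ) ∞ h → P (constForm (extD I (fnForm I h))))
    (theta : ∀ a, P (Theta a))
    (mul : ∀ α ∈ SmoothPolys I W k, ∀ α' ∈ SmoothPolys I W k, P α → P α' → P (α * α'))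
    (add : ∀ α ∈ SmoothPolys I W k, ∀ α' ∈ SmoothPolys I W k, P α → P α' → P (α + α'))
    {α : PolyForm I W k} (hα : α ∈ SmoothPolys I W k) : P α := by
  refine polyForm_induction (S := {η : FormField I W | η ∈ SmoothForms I}) one_mem_smoothForms
    (zero_mem (SmoothForms I)) (fun η hη ↦ ?_) theta
    (fun α α' h h' ↦ mul α h α' h') (fun α α' h h' ↦ add α h α' h') hα
  refine smoothForms_induction (P := fun η ↦ P (constForm η)) fn d
    (fun η η' h h' e e' ↦ ?_) (fun η η' h h' e e' ↦ ?_) hη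
  · rw [constForm_mul]; exact mul _ (smoothPolys_const h) _ (smoothPolys_const h') e e'
  · rw [constForm_add]; exact add _ (smoothPolys_const h) _ (smoothPolys_const h') e e'

end SmoothPolynomials

/-! ### The Cartan differential as an odd derivation. -/

section CartanDifferential

open AddMonoidAlgebra

variable {EG : Type*} [NormedAddCommGroup EG] [NormedSpace ℝ EG]
  {G : Type*} [TopologicalSpace G] [ChartedSpace EG G] [Group G]
  {E : Type*} [NormedAddCommGroup E] [NormedSpace ℝ E] {H : Type*} [TopologicalSpace H]
  {I : ModelWithCorners ℝ E H} {W : Type*} [TopologicalSpace W] [ChartedSpace H W] [MulAction G W]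
  [FiniteDimensional ℝ E] {k : ℕ} {b : Module.Basis (Fin k) ℝ (LieAlg (EG := EG) G)}

theorem cartanD_eq (α : PolyForm I W k) :
    cartanD I b α = polyD I α - ∑ a, Theta a * mapCoeff (iota I b a) α := rfl

theorem cartanD_add {α β : PolyForm I W k} (hα : α ∈ SmoothPolys I W k)
    (hβ : β ∈ SmoothPolys I W k) : cartanD I b (α + β) = cartanD I b α + cartanD I b β := by
  simp only [cartanD_eq, polyD_add hα hβ, map_add, mul_add, Finset.sum_add_distrib]
  abel

theorem cartanD_smul (r : ℝ) {α : PolyForm I W k} (hα : α ∈ SmoothPolys I W k) :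
    cartanD I b (r • α) = r • cartanD I b α := by
  simp only [cartanD_eq, polyD_smul r hα, map_smul, mul_smul_comm, smul_sub, Finset.smul_sum]

theorem cartanD_zero : cartanD I b (0 : PolyForm I W k) = 0 := by
  simp [cartanD_eq, polyD_zero]

theorem cartanD_neg {α : PolyForm I W k} (hα : α ∈ SmoothPolys I W k) :
    cartanD I b (-α) = -cartanD I b α := by
  simpa using cartanD_smul (b := b) (-1) hα

theorem cartanD_sub {α β : PolyForm I W k} (hα : α ∈ SmoothPolys I W k)
    (hβ : β ∈ SmoothPolys I W k) : cartanD I b (α - β) = cartanD I b α - cartanD I b β := by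
  rw [sub_eq_add_neg, cartanD_add hα (neg_mem hβ), cartanD_neg hβ, sub_eq_add_neg]

theorem cartanD_sum {ι : Type*} (s : Finset ι) {α : ι → PolyForm I W k}
    (hα : ∀ i ∈ s, α i ∈ SmoothPolys I W k) :
    cartanD I b (∑ i ∈ s, α i) = ∑ i ∈ s, cartanD I b (α i) := by
  classical
  induction s using Finset.induction_on with
  | empty => simp [cartanD_zero]
  | insert i s hi ih =>
    rw [Finset.sum_insert hi, Finset.sum_insert hi,
      cartanD_add (hα i (Finset.mem_insert_self i s))
        (sum_mem fun j hj ↦ hα j (Finset.mem_insert_of_mem hj)),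
      ih fun j hj ↦ hα j (Finset.mem_insert_of_mem hj)]

theorem cartanD_const (η : FormField I W) :
    cartanD I b (constForm η) =
      constForm (extD I η) - ∑ a, Theta a * constForm (contract (fundField I (b a)) η) := by
  rw [cartanD_eq, constForm, polyD_single]
  simp only [mapCoeff_single]
  rfl

variable [IsManifold I ∞ W] [T2Space W] [CompactSpace W]

/-- Each Θᵃ ι_a is an odd derivation like d, because Θᵃ is central and even. -/
theorem cartanD_mul {α β : PolyForm I W k} (hα : α ∈ SmoothPolys I W k)
    (hβ : β ∈ SmoothPolys I W k) :
    cartanD I b (α * β) = cartanD I b α * β + polyInv I W k α * cartanD I b β := by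
  simp only [cartanD_eq, polyD_mul hα hβ, iota, mapCoeff_contract_mul, mul_add, mul_sub, sub_mul,
    Finset.sum_add_distrib, Finset.sum_mul, Finset.mul_sum, ← mul_assoc,
    Theta_mul_comm _ (polyInv I W k α)]
  abel

theorem cartanD_polyInv {α : PolyForm I W k} (hα : α ∈ SmoothPolys I W k) :
    cartanD I b (polyInv I W k α) = -polyInv I W k (cartanD I b α) := by
  simp only [cartanD_eq, polyD_polyInv hα, iota, mapCoeff_contract_polyInv, map_sub, map_sum,
    polyInv_mul, polyInv_theta, mul_neg, Finset.sum_neg_distrib]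
  abel

theorem cartanD_theta (a : Fin k) : cartanD I b (Theta a : PolyForm I W k) = 0 := by
  have h1 : extD I (1 : FormField I W) = 0 := by
    have : IsManifold I 1 W := .of_le (n := ∞) (by simp)
    funext x
    have h := extD_fnForm (I := I) (h := fun _ : W ↦ (1 : ℝ)) (x := x) mdifferentiableAt_const
    refine (show extD I (1 : FormField I W) x = _ from h).trans ?_
    have h2 : dFn I (fun _ : W ↦ (1 : ℝ)) x = 0 := by
      ext v
      exact DFunLike.congr_fun (mfderiv_const (I := I) (I' := 𝓘(ℝ, ℝ)) (c := (1 : ℝ)) (x := x)) v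
    rw [h2, map_zero]; rfl
  have h2 : ∀ c, iota I b c (1 : FormField I W) = 0 := fun c ↦
    contract_fnForm (fundField I (b c)) fun _ ↦ 1
  rw [cartanD_eq, Theta, polyD_single, h1]
  simp [mapCoeff_single, h2]

variable [LieGroup 𝓘(ℝ, EG) ∞ G] [ContMDiffSMul 𝓘(ℝ, EG) I ∞ G W]

theorem smoothPolys_cartanD {α : PolyForm I W k} (hα : α ∈ SmoothPolys I W k) :
    cartanD I b α ∈ SmoothPolys I W k := by
  refine sub_mem (smoothPolys_polyD hα) (sum_mem fun a _ ↦ smoothPolys_mul (smoothPolys_theta a)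
    fun m ↦ ?_)
  rw [mapCoeff_coeff]
  exact smooth_contract (b a) (hα m)

end CartanDifferential

/-! ### Pullback of forms along v ↦ v − (fω(v))_W. -/

section HorizontalProjection

/-- The formula is exact to first order in `φ` because φ ∧ φ = 0. It identifies a factor 1 − ω_fᵃ
ι_a with a pullback, which is multiplicative. -/
theorem pullExt_sub_smulRight {V V' : Type*} [AddCommGroup V] [Module ℝ V] [AddCommGroup V']
    [Module ℝ V'] (A : V →ₗ[ℝ] V') (φ : Module.Dual ℝ V) (u : V')
    (y : ExteriorAlgebra ℝ (Module.Dual ℝ V')) :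
    pullExt (A - φ.smulRight u) y =
      pullExt A y - ExteriorAlgebra.ι ℝ φ * pullExt A (contractExt u y) := by
  induction y using ExteriorAlgebra.induction with
  | algebraMap r => rw [contractExt_algebraMap, AlgHom.commutes, AlgHom.commutes]; simp
  | ι l =>
    rw [pullExt_ι, pullExt_ι, contractExt_ι, AlgHom.commutes, ← Algebra.commutes,
      ← Algebra.smul_def, ← map_smul, ← map_sub]
    congr 1
    ext v
    simp [mul_comm]
  | mul x y hx hy =>
    rw [map_mul, hx, hy, contractExt_mul, map_add, map_mul, map_mul, map_mul, ← gradInv_pullExt]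
    set p := pullExt A x
    set q := pullExt A y
    set p' := pullExt A (contractExt u x)
    set q' := pullExt A (contractExt u y)
    set e := ExteriorAlgebra.ι ℝ φ
    have h1 : p * e = e * gradInv p := by
      rw [ι_mul_eq, gradInv_gradInv]
    have h2 : e * p' * (e * q') = 0 := by
      rw [mul_assoc, ← mul_assoc p', ← gradInv_gradInv p', ← ι_mul_eq, mul_assoc, ← mul_assoc,
        ExteriorAlgebra.ι_sq_zero, zero_mul]
    rw [sub_mul, mul_sub, mul_sub, h2, ← mul_assoc p, h1]
    noncomm_ring
  | add x y hx hy => rw [map_add, hx, hy, map_add, map_add, map_add]; noncomm_ring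

variable {EG : Type*} [NormedAddCommGroup EG] [NormedSpace ℝ EG]
  {G : Type*} [TopologicalSpace G] [ChartedSpace EG G] [Group G]
  {E : Type*} [NormedAddCommGroup E] [NormedSpace ℝ E] {H : Type*} [TopologicalSpace H]
  (I : ModelWithCorners ℝ E H) {W : Type*} [TopologicalSpace W] [ChartedSpace H W] [MulAction G W]
  {k : ℕ} (b : Module.Basis (Fin k) ℝ (LieAlg (EG := EG) G))
  (f : W → ℝ) (conn : ∀ x : W, TangentSpace I x →ₗ[ℝ] LieAlg (EG := EG) G)

/-- The endomorphism `v ↦ v - ∑_{a ∈ l} f ωᵃ(v) (ξ_a)_W` of `T_xW`. -/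
def partialHorMap (l : List (Fin k)) (x : W) : TangentSpace I x →ₗ[ℝ] TangentSpace I x :=
  LinearMap.id - (l.map fun a ↦
    (f x • (b.coord a ∘ₗ conn x)).smulRight (fundField I (b a) x)).sum

/-- Pullback of forms under the endomorphisms `partialHorMap`. -/
def partialHorForm (l : List (Fin k)) : FormField I W →ₗ[ℝ] FormField I W :=
  LinearMap.pi fun x ↦ (pullExt (partialHorMap I b f conn l x)).toLinearMap ∘ₗ LinearMap.proj x

/-- The endomorphism `v ↦ v - (f ω(v))_W` of `T_xW`. -/
def horMap (x : W) : TangentSpace I x →ₗ[ℝ] TangentSpace I x :=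
  LinearMap.id - f x • (fundLin I x ∘ₗ conn x)

/-- Pullback of forms under the endomorphisms `horMap`. -/
def horForm : FormField I W →ₗ[ℝ] FormField I W :=
  LinearMap.pi fun x ↦ (pullExt (horMap I f conn x)).toLinearMap ∘ₗ LinearMap.proj x

variable {I b f conn}

theorem horForm_mul (η η' : FormField I W) :
    horForm I f conn (η * η') = horForm I f conn η * horForm I f conn η' := by
  funext x; exact map_mul (pullExt (horMap I f conn x)) _ _

theorem horForm_fnForm (h : W → ℝ) : horForm I f conn (fnForm I h) = fnForm I h := by
  funext x; exact AlgHom.commutes _ _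

theorem horForm_one : horForm I f conn (1 : FormField I W) = 1 := horForm_fnForm fun _ ↦ 1

theorem horForm_formInv (η : FormField I W) :
    horForm I f conn (formInv I W η) = formInv I W (horForm I f conn η) := by
  funext x; exact (gradInv_pullExt _ _).symm

variable (b)

theorem horMap_eq (x : W) : horMap I f conn x = partialHorMap I b f conn (List.finRange k) x := by
  ext v
  have h : conn x v = ∑ a, b.coord a (conn x v) • b a := (b.sum_repr (conn x v)).symm
  simp only [horMap, partialHorMap, LinearMap.sub_apply, LinearMap.id_apply, LinearMap.smul_apply,
    LinearMap.comp_apply, ← List.ofFn_eq_map, List.sum_ofFn, LinearMap.sum_apply,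
    LinearMap.smulRight_apply]
  conv_lhs => rw [h, map_sum, Finset.smul_sum]
  simp only [map_smul, smul_smul, smul_eq_mul]
  rfl

theorem horForm_eq : horForm I f conn = partialHorForm I b f conn (List.finRange k) := by
  unfold horForm partialHorForm
  simp only [horMap_eq b]

/-- The recursion matches one factor of Ψ. The pullback for the earlier factors acts on the
contracted form but not on ω_fᵃ, just as the operators in Ψ never contract θᵃ. -/
theorem partialHorForm_append (l : List (Fin k)) (a : Fin k) :
    partialHorForm I b f conn (l ++ [a]) = partialHorForm I b f conn l -
      LinearMap.mulLeft ℝ (omegaF I f conn (b.coord a)) ∘ₗ partialHorForm I b f conn l ∘ₗ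
        iota I b a := by
  refine LinearMap.ext fun η ↦ funext fun x ↦ ?_
  have h : partialHorMap I b f conn (l ++ [a]) x = partialHorMap I b f conn l x -
      (f x • (b.coord a ∘ₗ conn x)).smulRight (fundField I (b a) x) := by
    simp [partialHorMap, sub_sub]
  change pullExt (partialHorMap I b f conn (l ++ [a]) x) (η x) = _
  rw [h, pullExt_sub_smulRight]
  rfl

theorem partialHorForm_nil : partialHorForm I b f conn [] = LinearMap.id := by
  refine LinearMap.ext fun η ↦ funext fun x ↦ ?_
  have h : partialHorMap I b f conn [] x = LinearMap.id := by simp [partialHorMap]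
  change pullExt (partialHorMap I b f conn [] x) (η x) = η x
  rw [h, pullExt_id]

theorem horForm_oneForm (l : ∀ x : W, Module.Dual ℝ (TangentSpace I x)) :
    horForm I f conn (oneForm l) = oneForm l -
      ∑ a, omegaF I f conn (b.coord a) * fnForm I fun x ↦ l x (fundField I (b a) x) := by
  funext x
  change pullExt (horMap I f conn x) (ExteriorAlgebra.ι ℝ (l x)) =
    ExteriorAlgebra.ι ℝ (l x) - (∑ a, omegaF I f conn (b.coord a) *
      fnForm I fun x ↦ l x (fundField I (b a) x)) x
  rw [pullExt_ι, Finset.sum_apply]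
  have h : ∀ a, (omegaF I f conn (b.coord a) *
      fnForm I fun x ↦ l x (fundField I (b a) x)) x =
      ExteriorAlgebra.ι ℝ (l x (fundField I (b a) x) • f x • (b.coord a ∘ₗ conn x)) := fun a ↦ by
    rw [map_smul, Algebra.smul_def]
    exact (Algebra.commutes (R := ℝ) (l x (fundField I (b a) x))
      (ExteriorAlgebra.ι ℝ (f x • (b.coord a ∘ₗ conn x)))).symm
  simp only [h]
  rw [← map_sum, ← map_sub]
  congr 1
  ext v
  have h2 : conn x v = ∑ a, b.coord a (conn x v) • b a := (b.sum_repr (conn x v)).symm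
  have h3 : fundLin I x (conn x v) = ∑ a, b.coord a (conn x v) • fundField I (b a) x := by
    conv_lhs => rw [h2, map_sum]
    simp only [map_smul]; rfl
  simp only [horMap, LinearMap.comp_apply, LinearMap.sub_apply, LinearMap.id_apply,
    LinearMap.smul_apply, map_sub, map_smul, h3, map_sum, Finset.smul_sum, LinearMap.sum_apply,
    smul_eq_mul]
  congr 1
  exact Finset.sum_congr rfl fun a _ ↦ by ring

end HorizontalProjection

/-! ### The map r_f as an algebra homomorphism. -/

section ChernWeilMap

open AddMonoidAlgebra

variable {EG : Type*} [NormedAddCommGroup EG] [NormedSpace ℝ EG]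
  {G : Type*} [TopologicalSpace G] [ChartedSpace EG G] [Group G]
  {E : Type*} [NormedAddCommGroup E] [NormedSpace ℝ E] {H : Type*} [TopologicalSpace H]
  {I : ModelWithCorners ℝ E H} {W : Type*} [TopologicalSpace W] [ChartedSpace H W] [MulAction G W]
  {k : ℕ}

theorem substitute_sub (P : Fin k → PolyForm I W k) (h h' : FormField I W →ₗ[ℝ] FormField I W)
    (α : PolyForm I W k) :
    substitute P (h - h') α = substitute P h α - substitute P h' α := by
  induction α using AddMonoidAlgebra.induction_linear with
  | zero => simp
  | add α α' e e' => simp only [map_add, e, e']; abel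
  | single m η =>
    rw [substitute_single, substitute_single, substitute_single, ← mul_sub, LinearMap.sub_apply,
      sub_eq_add_neg, constForm_add, constForm_neg, ← sub_eq_add_neg]

theorem constForm_mul_substitute {P : Fin k → PolyForm I W k}
    (hP : ∀ a, P a ∈ Subalgebra.center ℝ (PolyForm I W k))
    (η : FormField I W) (h : FormField I W →ₗ[ℝ] FormField I W) (α : PolyForm I W k) :
    constForm η * substitute P h α = substitute P (LinearMap.mulLeft ℝ η ∘ₗ h) α := by
  induction α using AddMonoidAlgebra.induction_linear with
  | zero => simp
  | add α α' e e' => simp only [map_add, mul_add, e, e']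
  | single m ζ =>
    rw [substitute_single, substitute_single, ← mul_assoc,
      Subalgebra.mem_center_iff.1 (monomialOf_mem_center hP m), mul_assoc, ← constForm_mul]
    rfl

variable [FiniteDimensional ℝ E] {b : Module.Basis (Fin k) ℝ (LieAlg (EG := EG) G)}
  {f : W → ℝ} {conn : ∀ x : W, TangentSpace I x →ₗ[ℝ] LieAlg (EG := EG) G}

theorem formInv_omegaF (l : Module.Dual ℝ (LieAlg (EG := EG) G)) :
    formInv I W (omegaF I f conn l) = -omegaF I f conn l := by
  funext x; exact gradInv_ι _

/-- The curvature is even: the differential of a 1-form, products of two 1-forms, and a function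
times Θᵃ. Centrality is what makes the substitution Θ ↦ Ω_f multiplicative. -/
theorem curvF_mem_center (h : IsDegenerateConnection I f conn) (a : Fin k) :
    curvF I b f conn a ∈ Subalgebra.center ℝ (PolyForm I W k) := by
  refine sub_mem (constForm_mem_center ?_) (mul_mem (constForm_mem_center ?_) (Theta_mem_center a))
  · have h1 : formInv I W (extD I (omegaF I f conn (b.coord a))) =
        extD I (omegaF I f conn (b.coord a)) := by
      have h2 := extD_formInv' (h.smooth_omega (b.coord a))
      have h3 := extD_smul I (-1) (h.smooth_omega (b.coord a))
      rw [neg_one_smul, neg_one_smul] at h3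
      rw [formInv_omegaF, h3] at h2
      exact (neg_injective h2).symm
    simp only [map_add, map_smul, map_sum, map_mul, h1, formInv_omegaF, neg_mul_neg]
  · exact formInv_fnForm fun x ↦ -1 + f x

theorem extOmegaF_ι (l : Module.Dual ℝ (LieAlg (EG := EG) G)) :
    (extOmegaF I f conn (ExteriorAlgebra.ι ℝ l) : PolyForm I W k) =
      constForm (omegaF I f conn l) := by
  unfold extOmegaF
  rw [ExteriorAlgebra.lift_ι_apply]
  rfl

/-- The last factor of a product of operators acts first, so the inductions over the basis run from
the right. -/
theorem list_prod_one_sub_append {X ι : Type*} [AddCommGroup X] [Module ℝ X]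
    (T : ι → Module.End ℝ X) (l : List ι) (a : ι) (y : X) :
    ((l ++ [a]).map fun a ↦ 1 - T a).prod y =
      (l.map fun a ↦ 1 - T a).prod y - (l.map fun a ↦ 1 - T a).prod (T a y) := by
  simp [mul_sub]

/-- A general element of Λ(𝔤^*) is carried along because every factor multiplies it by some θᵃ. The
involution in the sign rule lets θᵃ move to its right, next to the forms. -/
theorem chernWeilF_list (h : IsDegenerateConnection I f conn) (l : List (Fin k))
    (w : ExteriorAlgebra ℝ (Module.Dual ℝ (LieAlg (EG := EG) G))) (α : PolyForm I W k) :
    chernWeilF I b f conn ((l.map fun a ↦ 1 - thetaIota I b a).prod (w ⊗ₜ α)) =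
      extOmegaF I f conn w *
        substitute (curvF I b f conn) (partialHorForm I b f conn l) α := by
  induction l using List.reverseRecOn generalizing w α with
  | nil => rw [partialHorForm_nil]; rfl
  | append_singleton l a ih =>
    have h1 : thetaIota I b a (w ⊗ₜ α) =
        (ExteriorAlgebra.ι ℝ (b.coord a) * gradInv w) ⊗ₜ mapCoeff (iota I b a) α := rfl
    rw [list_prod_one_sub_append, h1, map_sub, ih, ih, ι_mul_eq, gradInv_gradInv, map_mul,
      extOmegaF_ι, mul_assoc, constForm_mul_substitute (curvF_mem_center h), substitute_mapCoeff, ← mul_sub,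
      ← substitute_sub, partialHorForm_append]
    rfl

/-- From here on the Weil algebra and Ψ play no role: r_f is known on forms and on Θ, and is
multiplicative. -/
theorem rF_eq (h : IsDegenerateConnection I f conn) :
    (rF I b f conn : PolyForm I W k →ₗ[ℝ] PolyForm I W k) =
      substitute (curvF I b f conn) (horForm I f conn) := by
  refine LinearMap.ext fun α ↦ ?_
  refine (chernWeilF_list h (List.finRange k) 1 α).trans ?_
  rw [map_one, one_mul, ← horForm_eq]

theorem rF_mul (h : IsDegenerateConnection I f conn) (α β : PolyForm I W k) :
    rF I b f conn (α * β) = rF I b f conn α * rF I b f conn β := by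
  rw [rF_eq h]
  exact substitute_mul (curvF_mem_center h) horForm_mul α β

theorem rF_const (h : IsDegenerateConnection I f conn) (η : FormField I W) :
    (rF I b f conn (constForm η) : PolyForm I W k) = constForm (horForm I f conn η) := by
  rw [rF_eq h, substitute_const]

theorem rF_theta (h : IsDegenerateConnection I f conn) (a : Fin k) :
    rF I b f conn (Theta a : PolyForm I W k) = curvF I b f conn a := by
  rw [rF_eq h, substitute_theta _ horForm_one]

end ChernWeilMap

/-! ### The action of G on polynomials. -/

section ActionOnPolynomials

open AddMonoidAlgebra

variable {EG : Type*} [NormedAddCommGroup EG] [NormedSpace ℝ EG]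
  {G : Type*} [TopologicalSpace G] [ChartedSpace EG G] [Group G]
  {E : Type*} [NormedAddCommGroup E] [NormedSpace ℝ E] {H : Type*} [TopologicalSpace H]
  {I : ModelWithCorners ℝ E H} {W : Type*} [TopologicalSpace W] [ChartedSpace H W] [MulAction G W]
  {k : ℕ} {b : Module.Basis (Fin k) ℝ (LieAlg (EG := EG) G)}

theorem actPoly_mul (g : G) (α β : PolyForm I W k) :
    actPoly I b g (α * β) = actPoly I b g α * actPoly I b g β :=
  substitute_mul
    (fun _ ↦ sum_mem fun c _ ↦ Subalgebra.smul_mem _ (Theta_mem_center c) _) (actForm_mul g) α β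

theorem actPoly_const (g : G) (η : FormField I W) :
    (actPoly I b g (constForm η) : PolyForm I W k) = constForm (actForm I g η) :=
  substitute_const _ _ _

theorem actPoly_theta (g : G) (a : Fin k) :
    (actPoly I b g (Theta a) : PolyForm I W k) =
      ∑ c, b.coord a (Ad g⁻¹ (b c)) • Theta c :=
  substitute_theta _ (actForm_one_eq g) a

theorem polyForm_induction_univ {P : PolyForm I W k → Prop} (const : ∀ η, P (constForm η))
    (theta : ∀ a, P (Theta a)) (mul : ∀ α α', P α → P α' → P (α * α'))
    (add : ∀ α α', P α → P α' → P (α + α')) (α : PolyForm I W k) : P α :=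
  polyForm_induction (S := Set.univ) (Set.mem_univ _) (Set.mem_univ _) (fun η _ ↦ const η) theta
    (fun α α' _ _ ↦ mul α α') (fun α α' _ _ ↦ add α α') fun _ ↦ Set.mem_univ _

theorem actPoly_one (α : PolyForm I W k) : actPoly I b (1 : G) α = α := by
  refine polyForm_induction_univ (P := fun α ↦ actPoly I b (1 : G) α = α)
    (fun η ↦ ?_) (fun a ↦ ?_) (fun α α' h h' ↦ ?_) (fun α α' h h' ↦ ?_) α
  · rw [actPoly_const, actForm_one]
  · rw [actPoly_theta, inv_one]
    simp [Ad_one, Finsupp.single_apply]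
  · rw [actPoly_mul, h, h']
  · rw [map_add, h, h']

/-- The derivative with respect to `Θᶜ` intertwines the coadjoint action. -/
theorem thetaDeriv_actPoly (g : G) (c : Fin k) (α : PolyForm I W k) :
    thetaDeriv I W k c (actPoly I b g α) =
      ∑ a, b.coord a (Ad g⁻¹ (b c)) • actPoly I b g (thetaDeriv I W k a α) := by
  refine polyForm_induction_univ (P := fun α ↦ thetaDeriv I W k c (actPoly I b g α) =
      ∑ a, b.coord a (Ad g⁻¹ (b c)) • actPoly I b g (thetaDeriv I W k a α))
    (fun η ↦ ?_) (fun a ↦ ?_) (fun α α' h h' ↦ ?_) (fun α α' h h' ↦ ?_) α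
  · rw [actPoly_const]
    simp only [thetaDeriv_const, map_zero, smul_zero, Finset.sum_const_zero]
  · have h1 : actPoly I b g (1 : PolyForm I W k) = 1 :=
      (actPoly_const g 1).trans (congrArg constForm (actForm_one_eq g))
    simp only [actPoly_theta, map_sum, map_smul, thetaDeriv_theta, apply_ite (actPoly I b g), h1,
      map_zero, smul_ite, smul_zero, Finset.sum_ite_eq, Finset.sum_ite_eq', Finset.mem_univ,
      if_true]
  · simp only [actPoly_mul, thetaDeriv_mul, h, h', map_add, smul_add, Finset.sum_add_distrib,
      Finset.sum_mul, Finset.mul_sum, smul_mul_assoc, mul_smul_comm]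
  · simp only [map_add, h, h', smul_add, Finset.sum_add_distrib]

end ActionOnPolynomials

/-! ### The curvature and the equivariance of r_f. -/

section CurvatureFormula

open AddMonoidAlgebra

variable {EG : Type*} [NormedAddCommGroup EG] [NormedSpace ℝ EG]
  {G : Type*} [TopologicalSpace G] [ChartedSpace EG G] [Group G]
  {E : Type*} [NormedAddCommGroup E] [NormedSpace ℝ E] {H : Type*} [TopologicalSpace H]
  {I : ModelWithCorners ℝ E H} {W : Type*} [TopologicalSpace W] [ChartedSpace H W] [MulAction G W]
  {k : ℕ} [FiniteDimensional ℝ E] {b : Module.Basis (Fin k) ℝ (LieAlg (EG := EG) G)}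
  {f : W → ℝ} {conn : ∀ x : W, TangentSpace I x →ₗ[ℝ] LieAlg (EG := EG) G}

variable (I b f conn) in
/-- The component `f ωᵃ`, as an element of `S(𝔤^*) ⊗ Ω(W)`. -/
def omegaP (a : Fin k) : PolyForm I W k := constForm (omegaF I f conn (b.coord a))

theorem omegaP_mul (a : Fin k) (α : PolyForm I W k) :
    omegaP I b f conn a * α = polyInv I W k α * omegaP I b f conn a :=
  constForm_oneForm_mul _ α

theorem polyInv_omegaP (a : Fin k) :
    polyInv I W k (omegaP I b f conn a) = -omegaP I b f conn a := by
  rw [omegaP, polyInv_const, formInv_omegaF, constForm_neg]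

theorem omegaP_mul_omegaP (a c : Fin k) :
    omegaP I b f conn a * omegaP I b f conn c = -(omegaP I b f conn c * omegaP I b f conn a) := by
  rw [omegaP_mul, polyInv_omegaP, neg_mul]

/-- By verticality ι_c ω_fᵃ = f δᵃ_c, so one term of the contraction sum survives. -/
theorem cartanD_omegaP (h : IsDegenerateConnection I f conn) (a : Fin k) :
    cartanD I b (omegaP I b f conn a) =
      constForm (extD I (omegaF I f conn (b.coord a))) - constForm (fnForm I f) * Theta a := by
  rw [omegaP, cartanD_const]
  congr 1
  have h1 : ∀ c, (Theta c * constForm (contract (fundField I (b c))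
      (omegaF I f conn (b.coord a))) : PolyForm I W k) =
      if a = c then constForm (fnForm I f) * Theta a else 0 := fun c ↦ by
    rw [h.contract_omegaF]
    split_ifs with hc
    · subst hc
      rw [Theta_mul_comm]
      simp
    · have : (fnForm I fun x ↦ b.coord a (b c) * f x) = (0 : FormField I W) := by
        funext x; simp [fnForm, Ne.symm hc]
      rw [this, constForm_zero, mul_zero]
  simp only [h1, Finset.sum_ite_eq, Finset.mem_univ, if_true]

/-- The equivariant curvature is `D ω + ½[ω, ω] + Θ`. -/
theorem curvF_eq (h : IsDegenerateConnection I f conn) (a : Fin k) :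
    curvF I b f conn a = cartanD I b (omegaP I b f conn a) +
      (1 / 2 : ℝ) • ∑ c, ∑ e, b.coord a ⁅b c, b e⁆ •
        (omegaP I b f conn c * omegaP I b f conn e) + Theta a := by
  have h1 : (fun x ↦ algebraMap ℝ _ (-1 + f x) : FormField I W) = -1 + fnForm I f := by
    funext x; simp [fnForm]
  rw [curvF, cartanD_omegaP h, h1, constForm_add, constForm_add, constForm_neg, constForm_one,
    constForm_smul, constForm_sum]
  simp only [constForm_sum, constForm_smul, constForm_mul, omegaP]
  rw [add_mul, neg_mul, one_mul]
  abel

theorem omegaP_smul (t : ℝ) (a : Fin k) :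
    omegaP I b (fun x ↦ t * f x) conn a = t • omegaP I b f conn a := by
  rw [omegaP, omegaF_mul, constForm_smul, omegaP]

theorem smoothPolys_omegaP (h : IsDegenerateConnection I f conn) (a : Fin k) :
    omegaP I b f conn a ∈ SmoothPolys I W k := smoothPolys_const (h.smooth_omega _)

theorem actPoly_omegaP (h : IsDegenerateConnection I f conn) (g : G) (a : Fin k) :
    actPoly I b g (omegaP I b f conn a) =
      ∑ c, b.coord a (Ad g⁻¹ (b c)) • omegaP I b f conn c := by
  rw [omegaP, actPoly_const, h.actForm_omegaF, dual_comp_eq_sum b, map_sum, constForm_sum]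
  simp only [map_smul, constForm_smul, omegaP]

variable [LieGroup 𝓘(ℝ, EG) ∞ G] [ContMDiffSMul 𝓘(ℝ, EG) I ∞ G W] [IsManifold I ∞ W] [T2Space W]
  [CompactSpace W]

/-- The endomorphism v − (fω(v))_W commutes with the derivative of the action, by equivariance of ω,
invariance of f and `actDeriv_fundField`. -/
theorem actForm_horForm (h : IsDegenerateConnection I f conn) (g : G) (η : FormField I W) :
    actForm I g (horForm I f conn η) = horForm I f conn (actForm I g η) := by
  funext x
  change pullExt (actDeriv I g⁻¹ x) (pullExt (horMap I f conn (g⁻¹ • x)) (η (g⁻¹ • x))) =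
    pullExt (horMap I f conn x) (pullExt (actDeriv I g⁻¹ x) (η (g⁻¹ • x)))
  rw [pullExt_pullExt, pullExt_pullExt]
  congr 2
  ext v
  simp only [horMap, LinearMap.comp_apply, LinearMap.sub_apply, LinearMap.id_apply,
    LinearMap.smul_apply, map_sub, map_smul, h.invariant]
  rw [fundLin_apply x, actDeriv_fundField, ← fundLin_apply,
    ← map_smul (fundLin I (g⁻¹ • x)), ← map_smul (fundLin I (g⁻¹ • x)), h.equivariant]

theorem actPoly_cartanD_omegaP (h : IsDegenerateConnection I f conn) (g : G) (a : Fin k) :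
    actPoly I b g (cartanD I b (omegaP I b f conn a)) =
      ∑ c, b.coord a (Ad g⁻¹ (b c)) • cartanD I b (omegaP I b f conn c) := by
  have hG : ∀ g : G, ContMDiff I I ∞ fun z : W ↦ g • z :=
    ContMDiffSMul.contMDiff_const_smul (I := 𝓘(ℝ, EG))
  have h1 : constForm (actForm I g (extD I (omegaF I f conn (b.coord a)))) =
      ∑ c, b.coord a (Ad g⁻¹ (b c)) •
        (constForm (extD I (omegaF I f conn (b.coord c))) : PolyForm I W k) := by
    have h2 := actPoly_omegaP (b := b) h g a
    have h3 : polyD I (actPoly I b g (omegaP I b f conn a)) =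
        constForm (actForm I g (extD I (omegaF I f conn (b.coord a)))) := by
      rw [omegaP, actPoly_const, constForm, polyD_single, extD_actForm hG g (h.smooth_omega _)]
      rfl
    rw [← h3, h2]
    -- `polyD` is not bundled as a linear map; its value on the sum is found by induction, using
    -- smoothness of the summands.
    have h4 : ∀ s : Finset (Fin k), polyD I (∑ c ∈ s, b.coord a (Ad g⁻¹ (b c)) •
        omegaP I b f conn c) = ∑ c ∈ s, b.coord a (Ad g⁻¹ (b c)) •
        (constForm (extD I (omegaF I f conn (b.coord c))) : PolyForm I W k) := fun s ↦ by
      induction s using Finset.induction_on with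
      | empty => simp [polyD_zero]
      | insert c s hc ih =>
        rw [Finset.sum_insert hc, Finset.sum_insert hc, polyD_add
          (Submodule.smul_mem _ _ (smoothPolys_omegaP h c))
          (sum_mem fun e _ ↦ Submodule.smul_mem _ _ (smoothPolys_omegaP h e)), ih,
          polyD_smul _ (smoothPolys_omegaP h c), omegaP, constForm, polyD_single]
        rfl
    exact h4 Finset.univ
  have h5 : (fun x ↦ f (g⁻¹ • x)) = f := funext fun x ↦ h.invariant _ _
  simp only [cartanD_omegaP h]
  rw [map_sub, actPoly_mul, actPoly_const, actPoly_const, actPoly_theta, actForm_fnForm, h5, h1,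
    Finset.mul_sum, ← Finset.sum_sub_distrib]
  simp only [mul_smul_comm, smul_sub]

variable [FiniteDimensional ℝ EG]

/-- `Ad_lie` in coordinates: the structure constants are an invariant tensor. -/
theorem sum_coord_lie_Ad (g : G) (a p q : Fin k) :
    ∑ c, ∑ e, b.coord a ⁅b c, b e⁆ * (b.coord c (Ad g⁻¹ (b p)) * b.coord e (Ad g⁻¹ (b q))) =
      ∑ c, b.coord a (Ad g⁻¹ (b c)) * b.coord c ⁅b p, b q⁆ := by
  have h1 : ∀ v : LieAlg (EG := EG) G, ∑ c, b.coord c v • b c = v := fun v ↦ b.sum_repr v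
  have h2 : b.coord a (lieBilin EG G (∑ c, b.coord c (Ad g⁻¹ (b p)) • b c)
      (∑ e, b.coord e (Ad g⁻¹ (b q)) • b e)) =
      b.coord a (Ad g⁻¹ (∑ c, b.coord c ⁅b p, b q⁆ • b c)) := by
    rw [h1, h1, h1, lieBilin_apply, Ad_lie]
  simp only [map_sum, map_smul, LinearMap.sum_apply, LinearMap.smul_apply, smul_eq_mul,
    Finset.mul_sum, lieBilin_apply] at h2
  rw [Finset.sum_comm] at h2
  refine Eq.trans ?_ (h2.trans ?_)
  · refine Finset.sum_congr rfl fun c _ ↦ Finset.sum_congr rfl fun e _ ↦ ?_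
    ring
  · exact Finset.sum_congr rfl fun c _ ↦ mul_comm _ _

theorem sum_comm_two {X : Type*} [AddCommMonoid X] (F : Fin k → Fin k → Fin k → Fin k → X) :
    ∑ c, ∑ e, ∑ p, ∑ q, F c e p q = ∑ p, ∑ q, ∑ c, ∑ e, F c e p q := by
  have := Finset.sum_comm (s := Finset.univ) (t := Finset.univ)
    (f := fun x y : Fin k × Fin k ↦ F x.1 x.2 y.1 y.2)
  simpa only [Fintype.sum_prod_type] using this

/-- In the form Dω_f + ½[ω_f, ω_f] + Θ every term transforms by the coadjoint representation, the
quadratic one by invariance of the structure constants. -/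
theorem actPoly_curvF (h : IsDegenerateConnection I f conn) (g : G) (a : Fin k) :
    actPoly I b g (curvF I b f conn a) =
      ∑ c, b.coord a (Ad g⁻¹ (b c)) • curvF I b f conn c := by
  have key : ∑ c, ∑ e, b.coord a ⁅b c, b e⁆ •
      ((∑ p, b.coord c (Ad g⁻¹ (b p)) • omegaP I b f conn p) *
        ∑ q, b.coord e (Ad g⁻¹ (b q)) • omegaP I b f conn q) =
      ∑ c, b.coord a (Ad g⁻¹ (b c)) • ∑ p, ∑ q, b.coord c ⁅b p, b q⁆ •
        (omegaP I b f conn p * omegaP I b f conn q) := by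
    have e1 : ∀ p q : Fin k, ∑ c, ∑ e, (b.coord a ⁅b c, b e⁆ * (b.coord c (Ad g⁻¹ (b p)) *
        b.coord e (Ad g⁻¹ (b q)))) • (omegaP I b f conn p * omegaP I b f conn q) =
        ∑ c, (b.coord a (Ad g⁻¹ (b c)) * b.coord c ⁅b p, b q⁆) •
          (omegaP I b f conn p * omegaP I b f conn q) := fun p q ↦ by
      simp only [← Finset.sum_smul]
      rw [sum_coord_lie_Ad]
    have e2 := Finset.sum_congr rfl fun p (_ : p ∈ Finset.univ) ↦
      Finset.sum_congr rfl fun q (_ : q ∈ Finset.univ) ↦ e1 p q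
    simp only [Finset.sum_mul_sum, smul_mul_smul_comm, Finset.smul_sum, smul_smul]
    rw [sum_comm_two, e2]
    refine Eq.symm (Finset.sum_comm.trans (Finset.sum_congr rfl fun p _ ↦ Finset.sum_comm))
  simp only [curvF_eq h, map_add, map_smul, map_sum, actPoly_mul, actPoly_omegaP h,
    actPoly_cartanD_omegaP h, actPoly_theta, smul_add, Finset.sum_add_distrib]
  rw [key]
  congr 2
  rw [Finset.smul_sum]
  exact Finset.sum_congr rfl fun c _ ↦ smul_comm _ _ _

/-- Both sides are multiplicative in `α`, so equivariance of the pullback and of the curvature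
decides. -/
theorem actPoly_rF (h : IsDegenerateConnection I f conn) (g : G) (α : PolyForm I W k) :
    actPoly I b g (rF I b f conn α) = rF I b f conn (actPoly I b g α) := by
  refine polyForm_induction_univ
    (P := fun α ↦ actPoly I b g (rF I b f conn α) = rF I b f conn (actPoly I b g α))
    (fun η ↦ ?_) (fun a ↦ ?_) (fun α α' e e' ↦ ?_) (fun α α' e e' ↦ ?_) α
  · rw [rF_const h, actPoly_const, actPoly_const, rF_const h, actForm_horForm h]
  · rw [rF_theta h, actPoly_curvF h, actPoly_theta, map_sum]
    simp only [map_smul, rF_theta h]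
  · rw [rF_mul h, actPoly_mul, actPoly_mul, rF_mul h, e, e']
  · rw [map_add, map_add, map_add, map_add, e, e']

end CurvatureFormula

/-! ### The infinitesimal action on polynomials. -/

section InfinitesimalAction

open AddMonoidAlgebra

variable {EG : Type*} [NormedAddCommGroup EG] [NormedSpace ℝ EG]
  {G : Type*} [TopologicalSpace G] [ChartedSpace EG G] [Group G]
  {E : Type*} [NormedAddCommGroup E] [NormedSpace ℝ E] {H : Type*} [TopologicalSpace H]
  {I : ModelWithCorners ℝ E H} {W : Type*} [TopologicalSpace W] [ChartedSpace H W] [MulAction G W]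
  {k : ℕ} [FiniteDimensional ℝ E] {b : Module.Basis (Fin k) ℝ (LieAlg (EG := EG) G)}

variable (I b) in
/-- `β` is the derivative of the action of `G` on `α` in the direction `ξ`. -/
def IsLieDeriv (ξ : LieAlg (EG := EG) G) (α β : PolyForm I W k) : Prop :=
  ∀ m x, HasDerivAt (fun t ↦ (actPoly I b (lineCurve ξ t) α).coeff m x) (β.coeff m x) 0

variable {ξ : LieAlg (EG := EG) G}

theorem IsLieDeriv.add {α α' β β' : PolyForm I W k} (h : IsLieDeriv I b ξ α β)
    (h' : IsLieDeriv I b ξ α' β') : IsLieDeriv I b ξ (α + α') (β + β') := fun m x ↦ by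
  simp only [map_add]
  exact (h m x).add (h' m x)

theorem IsLieDeriv.mul {α α' β β' : PolyForm I W k} (h : IsLieDeriv I b ξ α β)
    (h' : IsLieDeriv I b ξ α' β') : IsLieDeriv I b ξ (α * α') (β * α' + α * β') := fun m x ↦ by
  simp only [actPoly_mul, coeff_mul_sum, Finset.sum_apply, Pi.mul_apply]
  have h1 := HasDerivAt.fun_sum (u := Finset.HasAntidiagonal.antidiagonal m)
    fun p _ ↦ hasDerivAt_ext_mul (h p.1 x) (h' p.2 x)
  refine h1.congr_deriv ?_
  simp only [lineCurve_zero, actPoly_one, coeff_add, Finsupp.add_apply, coeff_mul_sum,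
    Finset.sum_add_distrib, Pi.add_apply, Finset.sum_apply, Pi.mul_apply]

/-- This removes the correction terms from the identities below once α is invariant. -/
theorem IsLieDeriv.eq_zero {α β : PolyForm I W k} (h : IsLieDeriv I b ξ α β)
    (hα : ∀ g : G, actPoly I b g α = α) : β = 0 := by
  ext m : 2
  funext x
  have h1 := h m x
  simp only [hα] at h1
  exact h1.unique (hasDerivAt_const 0 _)

variable [LieGroup 𝓘(ℝ, EG) ∞ G] [ContMDiffSMul 𝓘(ℝ, EG) I ∞ G W] [IsManifold I ∞ W] [T2Space W]
  [CompactSpace W] [FiniteDimensional ℝ EG]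

theorem isLieDeriv_const {η : FormField I W} (hη : η ∈ SmoothForms I) :
    IsLieDeriv I b ξ (constForm η : PolyForm I W k) (constForm (lieForm I ξ η)) := fun m x ↦ by
  classical
  simp only [actPoly_const]
  simp only [constForm, coeff_single, Finsupp.single_apply]
  split_ifs
  · exact hasDerivAt_actForm ξ hη x
  · exact hasDerivAt_const (0 : ℝ) _

variable (ξ) in
theorem isLieDeriv_theta (a : Fin k) :
    IsLieDeriv I b ξ (Theta a : PolyForm I W k) (-∑ e, b.coord a ⁅ξ, b e⁆ • Theta e) :=
  fun m x ↦ by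
  have h1 : HasDerivAt (fun t ↦ ∑ e, b.coord a (Ad (lineCurve ξ t)⁻¹ (b e)) •
      (Theta e : PolyForm I W k).coeff m x)
      (∑ e, (-b.coord a ⁅ξ, b e⁆) • (Theta e : PolyForm I W k).coeff m x) 0 :=
    HasDerivAt.fun_sum fun e _ ↦ (hasDerivAt_dual_Ad_inv (b.coord a) ξ (b e)).smul_const _
  have h2 : ∀ r : Fin k → ℝ, (∑ e, r e • (Theta e : PolyForm I W k)).coeff m x =
      ∑ e, r e • (Theta e : PolyForm I W k).coeff m x := fun r ↦ by
    rw [coeff_sum, Finsupp.finsetSum_apply, Finset.sum_apply]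
    rfl
  simp only [actPoly_theta, h2]
  refine h1.congr_deriv ?_
  rw [← Finset.sum_neg_distrib]
  simp only [← neg_smul]
  rw [h2]

end InfinitesimalAction

/-! ### The square of D on ω_f. -/

section SquareOfD

variable {EG : Type*} [NormedAddCommGroup EG] [NormedSpace ℝ EG]
  {G : Type*} [TopologicalSpace G] [ChartedSpace EG G] [Group G]
  {E : Type*} [NormedAddCommGroup E] [NormedSpace ℝ E] {H : Type*} [TopologicalSpace H]
  {I : ModelWithCorners ℝ E H} {W : Type*} [TopologicalSpace W] [ChartedSpace H W] [MulAction G W]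
  {k : ℕ} [FiniteDimensional ℝ E] {b : Module.Basis (Fin k) ℝ (LieAlg (EG := EG) G)}
  {f : W → ℝ} {conn : ∀ x : W, TangentSpace I x →ₗ[ℝ] LieAlg (EG := EG) G}
  [LieGroup 𝓘(ℝ, EG) ∞ G] [ContMDiffSMul 𝓘(ℝ, EG) I ∞ G W] [IsManifold I ∞ W] [T2Space W]
  [CompactSpace W]

theorem smoothPolys_fnForm {h : W → ℝ} (hh : ContMDiff I 𝓘(ℝ, ℝ) ∞ h) :
    (constForm (fnForm I h) : PolyForm I W k) ∈ SmoothPolys I W k :=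
  smoothPolys_const (smooth_fnForm hh)

theorem cartanD_fnForm (h : W → ℝ) :
    cartanD I b (constForm (fnForm I h) : PolyForm I W k) =
      constForm (extD I (fnForm I h)) := by
  rw [cartanD_const]
  simp [contract_fnForm, constForm_zero]

variable [FiniteDimensional ℝ EG]

/-- An instance of D² = −Θᶜ L_c. Since f need not be constant, the contractions of ω_f contribute df
Θᵃ, which cancels against the differential of −f Θᵃ. -/
theorem cartanD_cartanD_omegaP (h : IsDegenerateConnection I f conn) (a : Fin k) :
    cartanD I b (cartanD I b (omegaP I b f conn a)) =
      ∑ c, ∑ e, b.coord a ⁅b c, b e⁆ • (Theta c * omegaP I b f conn e) := by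
  have hs := h.smooth_omega (b.coord a)
  have hd : ∀ c, contract (fundField I (b c)) (extD I (omegaF I f conn (b.coord a))) =
      -(∑ e, b.coord a ⁅b c, b e⁆ • omegaF I f conn (b.coord e)) -
        b.coord a (b c) • extD I (fnForm I f) := fun c ↦ by
    have h1 := h.lieForm_omegaF b (b c) (b.coord a)
    have h2 : (fnForm I fun x ↦ b.coord a (b c) * f x) = b.coord a (b c) • fnForm I f := by
      funext x
      exact (map_mul (algebraMap ℝ _) _ _).trans (Algebra.smul_def _ _).symm
    rw [lieForm, h.contract_omegaF, h2, extD_smul I _ (smooth_fnForm h.smooth)] at h1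
    rw [← h1]; abel
  rw [cartanD_omegaP h, cartanD_sub (smoothPolys_const (smooth_extD hs))
    (smoothPolys_mul (smoothPolys_fnForm h.smooth) (smoothPolys_theta a)),
    cartanD_mul (smoothPolys_fnForm h.smooth) (smoothPolys_theta a), cartanD_theta, mul_zero,
    add_zero, cartanD_fnForm, cartanD_const, extD_extD hs, constForm_zero, zero_sub]
  simp only [hd, sub_eq_add_neg, constForm_add, constForm_neg, constForm_smul, constForm_sum,
    mul_add, mul_neg, Finset.sum_add_distrib, Finset.sum_neg_distrib, Finset.mul_sum,
    mul_smul_comm, neg_add, neg_neg]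
  have h3 : ∑ c, b.coord a (b c) • (Theta c * constForm (extD I (fnForm I f)) : PolyForm I W k) =
      constForm (extD I (fnForm I f)) * Theta a := by
    simp [Finsupp.single_apply, Theta_mul_comm]
  rw [h3, add_assoc, add_neg_cancel, add_zero]
  rfl

end SquareOfD

/-! ### The Bianchi identity for the equivariant curvature. -/

section Bianchi

variable {EG : Type*} [NormedAddCommGroup EG] [NormedSpace ℝ EG]
  {G : Type*} [TopologicalSpace G] [ChartedSpace EG G] [Group G]
  {E : Type*} [NormedAddCommGroup E] [NormedSpace ℝ E] {H : Type*} [TopologicalSpace H]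
  {I : ModelWithCorners ℝ E H} {W : Type*} [TopologicalSpace W] [ChartedSpace H W] [MulAction G W]
  {k : ℕ} [FiniteDimensional ℝ E] {b : Module.Basis (Fin k) ℝ (LieAlg (EG := EG) G)}
  {f : W → ℝ} {conn : ∀ x : W, TangentSpace I x →ₗ[ℝ] LieAlg (EG := EG) G}
  [IsManifold I ∞ W] [T2Space W] [CompactSpace W]

theorem polyInv_cartanD_omegaP (h : IsDegenerateConnection I f conn) (a : Fin k) :
    polyInv I W k (cartanD I b (omegaP I b f conn a)) = cartanD I b (omegaP I b f conn a) := by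
  have h1 := cartanD_polyInv (b := b) (smoothPolys_omegaP (b := b) h a)
  rw [polyInv_omegaP, cartanD_neg (smoothPolys_omegaP h a)] at h1
  exact (neg_injective h1).symm

variable [LieGroup 𝓘(ℝ, EG) ∞ G] [ContMDiffSMul 𝓘(ℝ, EG) I ∞ G W]

theorem smoothPolys_curvF (h : IsDegenerateConnection I f conn) (a : Fin k) :
    curvF I b f conn a ∈ SmoothPolys I W k := by
  rw [curvF_eq h]
  exact add_mem (add_mem (smoothPolys_cartanD (smoothPolys_omegaP h a))
    (Submodule.smul_mem _ _ (sum_mem fun c _ ↦ sum_mem fun e _ ↦ Submodule.smul_mem _ _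
      (smoothPolys_mul (smoothPolys_omegaP h c) (smoothPolys_omegaP h e))))) (smoothPolys_theta a)

variable [FiniteDimensional ℝ EG]

theorem coord_lie_skew (a c e : Fin k) : b.coord a ⁅b c, b e⁆ = -b.coord a ⁅b e, b c⁆ := by
  rw [← lieAlg_skew, map_neg]

theorem sum_coord_lie_lie (a c p q : Fin k) :
    ∑ e, b.coord a ⁅b c, b e⁆ * b.coord e ⁅b p, b q⁆ = b.coord a ⁅b c, ⁅b p, b q⁆⁆ := by
  have h1 : ∑ e, b.coord e ⁅b p, b q⁆ • b e = ⁅b p, b q⁆ := b.sum_repr _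
  have h2 := congrArg (fun v ↦ b.coord a (lieBilin EG G (b c) v)) h1
  simp only [map_sum, map_smul, smul_eq_mul, lieBilin_apply] at h2
  rw [← h2]
  exact Finset.sum_congr rfl fun e _ ↦ mul_comm _ _

/-- The 1-forms anticommute, so a product of three is invariant under cyclic permutation; adding the
three rotations of the indices brings in the Jacobi identity, and three times the sum is 0. -/
theorem sum_jacobi_omegaP (a : Fin k) :
    ∑ c, ∑ p, ∑ q, b.coord a ⁅b c, ⁅b p, b q⁆⁆ •
      (omegaP I b f conn c * (omegaP I b f conn p * omegaP I b f conn q)) = 0 := by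
  set w := omegaP I b f conn
  have hcyc : ∀ c p q, w p * (w q * w c) = w c * (w p * w q) := fun c p q ↦ by
    rw [omegaP_mul_omegaP q c, mul_neg, ← mul_assoc, omegaP_mul_omegaP p c, neg_mul, neg_neg,
      mul_assoc]
  have e1 : ∑ c, ∑ p, ∑ q, b.coord a ⁅b c, ⁅b p, b q⁆⁆ • (w c * (w p * w q)) =
      ∑ c, ∑ p, ∑ q, b.coord a ⁅b p, ⁅b q, b c⁆⁆ • (w c * (w p * w q)) := by
    rw [Finset.sum_comm]
    refine (Finset.sum_congr rfl fun p _ ↦ Finset.sum_comm).trans ?_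
    rw [Finset.sum_comm]
    refine Finset.sum_congr rfl fun q _ ↦ ?_
    rw [Finset.sum_comm]
    refine Finset.sum_congr rfl fun c _ ↦ Finset.sum_congr rfl fun p _ ↦ ?_
    rw [hcyc q c p]
  have e2 : ∑ c, ∑ p, ∑ q, b.coord a ⁅b c, ⁅b p, b q⁆⁆ • (w c * (w p * w q)) =
      ∑ c, ∑ p, ∑ q, b.coord a ⁅b q, ⁅b c, b p⁆⁆ • (w c * (w p * w q)) := by
    rw [Finset.sum_comm]
    refine Finset.sum_congr rfl fun p _ ↦ ?_
    rw [Finset.sum_comm]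
    refine Finset.sum_congr rfl fun q _ ↦ Finset.sum_congr rfl fun c _ ↦ ?_
    rw [hcyc c p q]
  set S := ∑ c, ∑ p, ∑ q, b.coord a ⁅b c, ⁅b p, b q⁆⁆ • (w c * (w p * w q)) with hS
  have h3 : S + S + S = 0 := by
    conv_lhs => enter [2]; rw [e2]
    conv_lhs => enter [1, 2]; rw [e1]
    rw [hS]
    simp only [← Finset.sum_add_distrib, ← add_smul, ← map_add]
    simp only [lieAlg_jacobi, map_zero, zero_smul, Finset.sum_const_zero]
  have h4 : (3 : ℝ) • S = 0 := by rw [← h3]; module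
  exact (smul_eq_zero.1 h4).resolve_left (by norm_num)

/-- The Bianchi identity. -/
theorem cartanD_curvF (h : IsDegenerateConnection I f conn) (a : Fin k) :
    cartanD I b (curvF I b f conn a) =
      -∑ c, ∑ e, b.coord a ⁅b c, b e⁆ • (omegaP I b f conn c * curvF I b f conn e) := by
  have hw := fun c ↦ smoothPolys_omegaP (b := b) h c
  have hww : ∀ c e, b.coord a ⁅b c, b e⁆ • (omegaP I b f conn c * omegaP I b f conn e) ∈
      SmoothPolys I W k := fun c e ↦ Submodule.smul_mem _ _ (smoothPolys_mul (hw c) (hw e))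
  have hsum : (∑ c, ∑ e, b.coord a ⁅b c, b e⁆ • (omegaP I b f conn c * omegaP I b f conn e)) ∈
      SmoothPolys I W k := sum_mem fun c _ ↦ sum_mem fun e _ ↦ hww c e
  -- Dω_f is even and the structure constants are antisymmetric, so the two halves of D[ω_f, ω_f]
  -- coincide and use up the factor ½.
  have h1 : ∑ c, ∑ e, b.coord a ⁅b c, b e⁆ •
      (cartanD I b (omegaP I b f conn c) * omegaP I b f conn e) =
      -∑ c, ∑ e, b.coord a ⁅b c, b e⁆ •
        (omegaP I b f conn c * cartanD I b (omegaP I b f conn e)) := by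
    rw [Finset.sum_comm, ← Finset.sum_neg_distrib]
    refine Finset.sum_congr rfl fun c _ ↦ ?_
    rw [← Finset.sum_neg_distrib]
    refine Finset.sum_congr rfl fun e _ ↦ ?_
    rw [omegaP_mul, polyInv_cartanD_omegaP h, coord_lie_skew, neg_smul]
  have h2 : ∑ c, ∑ e, b.coord a ⁅b c, b e⁆ • (Theta c * omegaP I b f conn e) =
      -∑ c, ∑ e, b.coord a ⁅b c, b e⁆ • (omegaP I b f conn c * Theta e) := by
    rw [Finset.sum_comm, ← Finset.sum_neg_distrib]
    refine Finset.sum_congr rfl fun c _ ↦ ?_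
    rw [← Finset.sum_neg_distrib]
    refine Finset.sum_congr rfl fun e _ ↦ ?_
    rw [Theta_mul_comm, coord_lie_skew, neg_smul]
  -- The cubic term [ω_f, [ω_f, ω_f]] vanishes, so the quadratic part of the curvature contributes
  -- nothing on the right-hand side.
  have h3 : ∑ c, ∑ e, b.coord a ⁅b c, b e⁆ • (omegaP I b f conn c * ∑ p, ∑ q,
      b.coord e ⁅b p, b q⁆ • (omegaP I b f conn p * omegaP I b f conn q)) = 0 := by
    rw [← sum_jacobi_omegaP (b := b) (f := f) (conn := conn) a]
    refine Finset.sum_congr rfl fun c _ ↦ ?_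
    simp only [Finset.mul_sum, Finset.smul_sum, mul_smul_comm, smul_smul, ← sum_coord_lie_lie,
      Finset.sum_smul]
    rw [Finset.sum_comm]
    exact Finset.sum_congr rfl fun p _ ↦ Finset.sum_comm
  rw [curvF_eq h, cartanD_add (add_mem (smoothPolys_cartanD (hw a))
    (Submodule.smul_mem _ _ hsum)) (smoothPolys_theta a), cartanD_theta, add_zero,
    cartanD_add (smoothPolys_cartanD (hw a)) (Submodule.smul_mem _ _ hsum), cartanD_smul _ hsum,
    cartanD_cartanD_omegaP h, h2, cartanD_sum _ fun c _ ↦ sum_mem fun e _ ↦ hww c e]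
  have h4 : ∀ c, cartanD I b (∑ e, b.coord a ⁅b c, b e⁆ •
      (omegaP I b f conn c * omegaP I b f conn e)) = ∑ e, b.coord a ⁅b c, b e⁆ •
      (cartanD I b (omegaP I b f conn c) * omegaP I b f conn e) -
      ∑ e, b.coord a ⁅b c, b e⁆ •
        (omegaP I b f conn c * cartanD I b (omegaP I b f conn e)) := fun c ↦ by
    rw [cartanD_sum _ fun e _ ↦ hww c e, ← Finset.sum_sub_distrib]
    refine Finset.sum_congr rfl fun e _ ↦ ?_
    rw [cartanD_smul _ (smoothPolys_mul (hw c) (hw e)), cartanD_mul (hw c) (hw e), polyInv_omegaP,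
      neg_mul, ← sub_eq_add_neg, smul_sub]
  simp only [h4, Finset.sum_sub_distrib, h1, curvF_eq h, mul_add, mul_smul_comm, smul_add,
    Finset.sum_add_distrib, smul_comm _ (1 / 2 : ℝ)]
  simp only [← Finset.smul_sum, h3, smul_zero, add_zero]
  module

end Bianchi

/-! ### The commutator of r_f with D. -/

section ChainMap

variable {EG : Type*} [NormedAddCommGroup EG] [NormedSpace ℝ EG]
  {G : Type*} [TopologicalSpace G] [ChartedSpace EG G] [Group G]
  {E : Type*} [NormedAddCommGroup E] [NormedSpace ℝ E] {H : Type*} [TopologicalSpace H]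
  {I : ModelWithCorners ℝ E H} {W : Type*} [TopologicalSpace W] [ChartedSpace H W] [MulAction G W]
  {k : ℕ} [FiniteDimensional ℝ E] {b : Module.Basis (Fin k) ℝ (LieAlg (EG := EG) G)}
  {f : W → ℝ} {conn : ∀ x : W, TangentSpace I x →ₗ[ℝ] LieAlg (EG := EG) G}
  [IsManifold I ∞ W] [T2Space W] [CompactSpace W]

variable (I b) in
/-- The derivative of the function `h` along `(ξ_a)_W`. -/
def fnDeriv (h : W → ℝ) (a : Fin k) (x : W) : ℝ := dFn I h x (fundField I (b a) x)

theorem polyInv_curvF (h : IsDegenerateConnection I f conn) (a : Fin k) :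
    polyInv I W k (curvF I b f conn a) = curvF I b f conn a := by
  rw [curvF_eq h]
  simp only [map_add, map_smul, map_sum, polyInv_mul, polyInv_omegaP, neg_mul_neg, polyInv_theta,
    polyInv_cartanD_omegaP h]

theorem polyInv_rF (h : IsDegenerateConnection I f conn) (α : PolyForm I W k) :
    polyInv I W k (rF I b f conn α) = rF I b f conn (polyInv I W k α) := by
  refine polyForm_induction_univ
    (P := fun α ↦ polyInv I W k (rF I b f conn α) = rF I b f conn (polyInv I W k α))
    (fun η ↦ ?_) (fun a ↦ ?_) (fun α α' e e' ↦ ?_) (fun α α' e e' ↦ ?_) α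
  · rw [rF_const h, polyInv_const, polyInv_const, rF_const h, horForm_formInv]
  · rw [rF_theta h, polyInv_theta, rF_theta h, polyInv_curvF h]
  · rw [rF_mul h, polyInv_mul, polyInv_mul, rF_mul h, e, e']
  · rw [map_add, map_add, map_add, map_add, e, e']

theorem horForm_extD_fnForm {h : W → ℝ} (hh : ContMDiff I 𝓘(ℝ, ℝ) ∞ h) :
    horForm I f conn (extD I (fnForm I h)) = extD I (fnForm I h) -
      ∑ a, omegaF I f conn (b.coord a) * fnForm I (fnDeriv I b h a) := by
  have : IsManifold I 1 W := .of_le (n := ∞) (by simp)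
  have h1 : extD I (fnForm I h) = oneForm (dFn I h) :=
    funext fun x ↦ extD_fnForm (mdifferentiable_of_contMDiff hh x)
  rw [h1]
  exact horForm_oneForm b _

theorem rF_extD_fnForm (hc : IsDegenerateConnection I f conn) {h : W → ℝ}
    (hh : ContMDiff I 𝓘(ℝ, ℝ) ∞ h) :
    rF I b f conn (constForm (extD I (fnForm I h)) : PolyForm I W k) =
      constForm (extD I (fnForm I h)) -
        ∑ a, omegaP I b f conn a * constForm (fnForm I (fnDeriv I b h a)) := by
  rw [rF_const hc, horForm_extD_fnForm (b := b) hh, sub_eq_add_neg, constForm_add, constForm_neg,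
    constForm_sum, ← sub_eq_add_neg]
  simp only [constForm_mul, omegaP]

theorem rF_fnForm (hc : IsDegenerateConnection I f conn) (h : W → ℝ) :
    rF I b f conn (constForm (fnForm I h) : PolyForm I W k) = constForm (fnForm I h) := by
  rw [rF_const hc, horForm_fnForm]

variable [LieGroup 𝓘(ℝ, EG) ∞ G] [ContMDiffSMul 𝓘(ℝ, EG) I ∞ G W]

theorem contMDiff_fnDeriv {h : W → ℝ} (hh : ContMDiff I 𝓘(ℝ, ℝ) ∞ h) (a : Fin k) :
    ContMDiff I 𝓘(ℝ, ℝ) ∞ (fnDeriv I b h a) := contMDiff_dFn_fundField hh (b a)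

theorem contract_extD_fnForm_eq {h : W → ℝ} (hh : ContMDiff I 𝓘(ℝ, ℝ) ∞ h) (a : Fin k) :
    contract (fundField I (b a)) (extD I (fnForm I h)) = fnForm I (fnDeriv I b h a) := by
  have : IsManifold I 1 W := .of_le (n := ∞) (by simp)
  exact contract_extD_fnForm _ (mdifferentiable_of_contMDiff hh)

theorem lieForm_fnForm {h : W → ℝ} (hh : ContMDiff I 𝓘(ℝ, ℝ) ∞ h) (a : Fin k) :
    lieForm I (b a) (fnForm I h) = fnForm I (fnDeriv I b h a) := by
  rw [lieForm, contract_fnForm, extD_zero, zero_add, contract_extD_fnForm_eq hh]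

theorem lieForm_extD_fnForm {h : W → ℝ} (hh : ContMDiff I 𝓘(ℝ, ℝ) ∞ h) (a : Fin k) :
    lieForm I (b a) (extD I (fnForm I h)) = extD I (fnForm I (fnDeriv I b h a)) := by
  rw [lieForm, contract_extD_fnForm_eq hh, extD_extD_fnForm hh, map_zero, add_zero]

theorem cartanD_extD_fnForm {h : W → ℝ} (hh : ContMDiff I 𝓘(ℝ, ℝ) ∞ h) :
    cartanD I b (constForm (extD I (fnForm I h)) : PolyForm I W k) =
      -∑ a, Theta a * constForm (fnForm I (fnDeriv I b h a)) := by
  rw [cartanD_const, extD_extD_fnForm hh, constForm_zero, zero_sub]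
  simp only [contract_extD_fnForm_eq hh]

theorem smoothPolys_rF (hc : IsDegenerateConnection I f conn) {α : PolyForm I W k}
    (hα : α ∈ SmoothPolys I W k) : rF I b f conn α ∈ SmoothPolys I W k := by
  have : IsManifold I 1 W := .of_le (n := ∞) (by simp)
  refine smoothPolys_induction (P := fun α ↦ rF I b f conn α ∈ SmoothPolys I W k)
    (fun h hh ↦ ?_) (fun h hh ↦ ?_) (fun a ↦ ?_) (fun α _ α' _ e e' ↦ ?_)
    (fun α _ α' _ e e' ↦ ?_) hα
  · rw [rF_fnForm hc]; exact smoothPolys_fnForm hh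
  · rw [rF_extD_fnForm hc hh]
    exact sub_mem (smoothPolys_const (smooth_extD_fnForm hh)) (sum_mem fun a _ ↦
      smoothPolys_mul (smoothPolys_omegaP hc a) (smoothPolys_fnForm (contMDiff_fnDeriv hh a)))
  · rw [rF_theta hc]; exact smoothPolys_curvF hc a
  · rw [rF_mul hc]; exact smoothPolys_mul e e'
  · rw [map_add]; exact add_mem e e'

variable [FiniteDimensional ℝ EG]

/-- The commutator of two derivatives along fundamental vector fields. -/
theorem fnForm_commutator {h : W → ℝ} (hh : ContMDiff I 𝓘(ℝ, ℝ) ∞ h) (c e : Fin k) :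
    fnForm I (fnDeriv I b (fnDeriv I b h c) e) =
      fnForm I (fnDeriv I b (fnDeriv I b h e) c) +
        ∑ a, b.coord a ⁅b e, b c⁆ • fnForm I (fnDeriv I b h a) := by
  have : IsManifold I 1 W := .of_le (n := ∞) (by simp)
  -- The commutator [L_ξ, ι_ξ'] = ι_[ξ,ξ'] is applied to dh.
  have h1 := lieForm_contract (b e) (b c) (smooth_extD_fnForm (I := I) hh)
  rw [contract_extD_fnForm_eq hh, lieForm_fnForm (contMDiff_fnDeriv hh c), lieForm_extD_fnForm hh,
    contract_extD_fnForm_eq (contMDiff_fnDeriv hh e),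
    contract_extD_fnForm _ (mdifferentiable_of_contMDiff hh)] at h1
  rw [h1]
  congr 1
  funext x
  have h2 : ⁅b e, b c⁆ = ∑ a, b.coord a ⁅b e, b c⁆ • b a := (b.sum_repr _).symm
  have h3 : fundField I ⁅b e, b c⁆ x = ∑ a, b.coord a ⁅b e, b c⁆ • fundField I (b a) x := by
    rw [← fundLin_apply]
    conv_lhs => rw [h2, map_sum]
    simp only [map_smul]; rfl
  change algebraMap ℝ _ (dFn I h x (fundField I ⁅b e, b c⁆ x)) = _
  rw [h3, Finset.sum_apply, map_sum, map_sum]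
  refine Finset.sum_congr rfl fun a _ ↦ ?_
  rw [map_smul, smul_eq_mul, map_mul, ← Algebra.smul_def]
  rfl

/-- The products ω_fᶜ ω_fᵉ are antisymmetric, so only half the commutator of the second derivatives
remains. -/
theorem sum_omegaP_mul_fnForm {h : W → ℝ} (hh : ContMDiff I 𝓘(ℝ, ℝ) ∞ h) :
    ∑ c, ∑ e, omegaP I b f conn c * omegaP I b f conn e *
        constForm (fnForm I (fnDeriv I b (fnDeriv I b h c) e)) =
      -∑ a, ((1 / 2 : ℝ) • ∑ c, ∑ e, b.coord a ⁅b c, b e⁆ •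
        (omegaP I b f conn c * omegaP I b f conn e)) * constForm (fnForm I (fnDeriv I b h a)) := by
  set w := omegaP I b f conn
  set V : Fin k → Fin k → PolyForm I W k := fun c e ↦
    constForm (fnForm I (fnDeriv I b (fnDeriv I b h c) e)) with hV
  set U : Fin k → PolyForm I W k := fun a ↦ constForm (fnForm I (fnDeriv I b h a)) with hU
  have h1 : ∀ c e, V c e = V e c + ∑ a, b.coord a ⁅b e, b c⁆ • U a := fun c e ↦ by
    simp only [hV, hU, fnForm_commutator hh c e, constForm_add, constForm_sum, constForm_smul]
  set S := ∑ c, ∑ e, w c * w e * V c e with hS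
  have h2 : S = -∑ c, ∑ e, w c * w e * V e c := by
    rw [hS, Finset.sum_comm, ← Finset.sum_neg_distrib]
    refine Finset.sum_congr rfl fun c _ ↦ ?_
    rw [← Finset.sum_neg_distrib]
    refine Finset.sum_congr rfl fun e _ ↦ ?_
    rw [omegaP_mul_omegaP, neg_mul]
  have h3 : S = ∑ c, ∑ e, w c * w e * V e c +
      ∑ c, ∑ e, w c * w e * ∑ a, b.coord a ⁅b e, b c⁆ • U a := by
    rw [hS, ← Finset.sum_add_distrib]
    refine Finset.sum_congr rfl fun c _ ↦ ?_
    rw [← Finset.sum_add_distrib]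
    refine Finset.sum_congr rfl fun e _ ↦ ?_
    rw [h1 c e, mul_add]
  have h4 : ∑ c, ∑ e, w c * w e * ∑ a, b.coord a ⁅b e, b c⁆ • U a =
      -∑ a, ∑ c, ∑ e, (b.coord a ⁅b c, b e⁆ • (w c * w e)) * U a := by
    simp only [Finset.mul_sum, mul_smul_comm, smul_mul_assoc]
    refine (Finset.sum_congr rfl fun c _ ↦ Finset.sum_comm).trans ?_
    rw [Finset.sum_comm, ← Finset.sum_neg_distrib]
    refine Finset.sum_congr rfl fun a _ ↦ ?_
    rw [← Finset.sum_neg_distrib]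
    refine Finset.sum_congr rfl fun c _ ↦ ?_
    rw [← Finset.sum_neg_distrib]
    refine Finset.sum_congr rfl fun e _ ↦ ?_
    rw [coord_lie_skew, neg_smul]
  have h5 : ∑ a, ((1 / 2 : ℝ) • ∑ c, ∑ e, b.coord a ⁅b c, b e⁆ • (w c * w e)) * U a =
      (1 / 2 : ℝ) • ∑ a, ∑ c, ∑ e, (b.coord a ⁅b c, b e⁆ • (w c * w e)) * U a := by
    simp only [smul_mul_assoc, Finset.sum_mul, Finset.smul_sum]
  rw [h5]
  rw [h4] at h3
  set T := ∑ a, ∑ c, ∑ e, (b.coord a ⁅b c, b e⁆ • (w c * w e)) * U a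
  set S' := ∑ c, ∑ e, w c * w e * V e c
  have h6 : (2 : ℝ) • S = -T := by
    rw [two_smul]
    conv_lhs => enter [2]; rw [h3]
    conv_lhs => enter [1]; rw [h2]
    abel
  calc S = (1 / 2 : ℝ) • (2 : ℝ) • S := by rw [smul_smul]; norm_num
    _ = -((1 / 2 : ℝ) • T) := by rw [h6, smul_neg]

variable (I b f conn) in
/-- The elements `β` are the derivatives of `α` under the action, and measure the failure of the
map `r_f` to commute with `D` on `α`. -/
structure IsLieDerivFamily (α : PolyForm I W k) (β : Fin k → PolyForm I W k) : Prop where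
  isLieDeriv : ∀ c, IsLieDeriv I b (b c) α (β c)
  comm : cartanD I b (rF I b f conn α) = rF I b f conn (cartanD I b α) +
    ∑ c, omegaP I b f conn c * rF I b f conn (β c)

theorem isLieDerivFamily_fnForm (hc : IsDegenerateConnection I f conn) {h : W → ℝ}
    (hh : ContMDiff I 𝓘(ℝ, ℝ) ∞ h) :
    IsLieDerivFamily I b f conn (constForm (fnForm I h))
      fun c ↦ constForm (fnForm I (fnDeriv I b h c)) := by
  have : IsManifold I 1 W := .of_le (n := ∞) (by simp)
  refine ⟨fun c ↦ ?_, ?_⟩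
  · rw [← lieForm_fnForm hh]; exact isLieDeriv_const (smooth_fnForm hh)
  · simp only [rF_fnForm hc, cartanD_fnForm, rF_extD_fnForm hc hh, sub_add_cancel]

/-- The bracket part of Ω_f, which enters through D(dh) = −Θᵃ ξ_a h, cancels against the second
derivatives of `h` by `sum_omegaP_mul_fnForm`. -/
theorem isLieDerivFamily_extD_fnForm (hc : IsDegenerateConnection I f conn) {h : W → ℝ}
    (hh : ContMDiff I 𝓘(ℝ, ℝ) ∞ h) :
    IsLieDerivFamily I b f conn (constForm (extD I (fnForm I h)))
      fun c ↦ constForm (extD I (fnForm I (fnDeriv I b h c))) := by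
  have : IsManifold I 1 W := .of_le (n := ∞) (by simp)
  refine ⟨fun c ↦ ?_, ?_⟩
  · rw [← lieForm_extD_fnForm hh]; exact isLieDeriv_const (smooth_extD_fnForm hh)
  have hU := fun a ↦ smoothPolys_fnForm (k := k) (contMDiff_fnDeriv (b := b) hh a)
  have hw := fun a ↦ smoothPolys_omegaP (b := b) hc a
  have h1 := sum_omegaP_mul_fnForm (b := b) (f := f) (conn := conn) hh
  have h2 : ∀ c, rF I b f conn (constForm (extD I (fnForm I (fnDeriv I b h c))) :
      PolyForm I W k) = _ := fun c ↦ rF_extD_fnForm hc (contMDiff_fnDeriv hh c)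
  rw [rF_extD_fnForm hc hh, cartanD_sub (smoothPolys_const (smooth_extD_fnForm hh))
    (sum_mem fun a _ ↦ smoothPolys_mul (hw a) (hU a)), cartanD_extD_fnForm hh,
    cartanD_sum _ fun a _ ↦ smoothPolys_mul (hw a) (hU a)]
  simp only [h2, cartanD_mul (hw _) (hU _), polyInv_omegaP, cartanD_fnForm, map_neg, map_sum,
    rF_mul hc, rF_theta hc, rF_fnForm hc, curvF_eq hc, add_mul, mul_sub, Finset.sum_add_distrib,
    Finset.sum_sub_distrib, Finset.mul_sum, ← mul_assoc, h1, neg_mul, Finset.sum_neg_distrib]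
  abel

/-- As DΘᵃ = 0, this is exactly the Bianchi identity. -/
theorem isLieDerivFamily_theta (hc : IsDegenerateConnection I f conn) (a : Fin k) :
    IsLieDerivFamily I b f conn (Theta a)
      fun c ↦ -∑ e, b.coord a ⁅b c, b e⁆ • Theta e := by
  refine ⟨fun c ↦ isLieDeriv_theta (b c) a, ?_⟩
  rw [rF_theta hc, cartanD_curvF hc, cartanD_theta, map_zero, zero_add]
  simp only [map_neg, map_sum, map_smul, rF_theta hc, mul_neg, Finset.mul_sum, mul_smul_comm,
    Finset.sum_neg_distrib]

/-- D r_f and r_f D are odd derivations along r_f. The correction is one too: the Lie derivative is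
an even derivation, and moving ω_fᶜ past r_f(α) produces the required involution. -/
theorem IsLieDerivFamily.mul (hc : IsDegenerateConnection I f conn) {α α' : PolyForm I W k}
    {β β' : Fin k → PolyForm I W k} (hα : α ∈ SmoothPolys I W k) (hα' : α' ∈ SmoothPolys I W k)
    (h : IsLieDerivFamily I b f conn α β) (h' : IsLieDerivFamily I b f conn α' β') :
    IsLieDerivFamily I b f conn (α * α') fun c ↦ β c * α' + α * β' c := by
  refine ⟨fun c ↦ (h.isLieDeriv c).mul (h'.isLieDeriv c), ?_⟩
  have e1 : ∀ c, polyInv I W k (rF I b f conn α) * (omegaP I b f conn c * rF I b f conn (β' c)) =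
      omegaP I b f conn c * (rF I b f conn α * rF I b f conn (β' c)) := fun c ↦ by
    rw [← mul_assoc, ← omegaP_mul, mul_assoc]
  rw [rF_mul hc, cartanD_mul (smoothPolys_rF hc hα) (smoothPolys_rF hc hα'), h.comm, h'.comm,
    cartanD_mul hα hα', map_add, rF_mul hc, rF_mul hc, ← polyInv_rF hc]
  simp only [map_add, rF_mul hc, add_mul, mul_add, Finset.sum_mul, Finset.mul_sum, e1, mul_assoc,
    Finset.sum_add_distrib]
  abel

theorem IsLieDerivFamily.add (hc : IsDegenerateConnection I f conn) {α α' : PolyForm I W k}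
    {β β' : Fin k → PolyForm I W k} (hα : α ∈ SmoothPolys I W k) (hα' : α' ∈ SmoothPolys I W k)
    (h : IsLieDerivFamily I b f conn α β) (h' : IsLieDerivFamily I b f conn α' β') :
    IsLieDerivFamily I b f conn (α + α') (β + β') := by
  refine ⟨fun c ↦ (h.isLieDeriv c).add (h'.isLieDeriv c), ?_⟩
  rw [map_add, cartanD_add (smoothPolys_rF hc hα) (smoothPolys_rF hc hα'), h.comm, h'.comm,
    cartanD_add hα hα', map_add]
  simp only [Pi.add_apply, map_add, mul_add, Finset.sum_add_distrib]
  abel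

/-- Existence of the derivatives is enough, so no Lie derivative operator on polynomials has to be
defined; on invariants `IsLieDeriv.eq_zero` determines them. -/
theorem exists_isLieDerivFamily (hc : IsDegenerateConnection I f conn) {α : PolyForm I W k}
    (hα : α ∈ SmoothPolys I W k) : ∃ β, IsLieDerivFamily I b f conn α β :=
  smoothPolys_induction (P := fun α ↦ ∃ β, IsLieDerivFamily I b f conn α β)
    (fun _ hh ↦ ⟨_, isLieDerivFamily_fnForm hc hh⟩)
    (fun _ hh ↦ ⟨_, isLieDerivFamily_extD_fnForm hc hh⟩) (fun a ↦ ⟨_, isLieDerivFamily_theta hc a⟩)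
    (fun _ hα _ hα' ⟨_, e⟩ ⟨_, e'⟩ ↦ ⟨_, e.mul hc hα hα' e'⟩)
    (fun _ hα _ hα' ⟨_, e⟩ ⟨_, e'⟩ ↦ ⟨_, e.add hc hα hα' e'⟩) hα

/-- `r_f` is a chain map on the equivariant forms. -/
theorem isChainMap_rF (hc : IsDegenerateConnection I f conn) : IsChainMap I b (rF I b f conn) where
  mapsTo α hα := ⟨smoothPolys_rF hc hα.1, fun g ↦ by rw [actPoly_rF hc, hα.2]⟩
  comm α hα := by
    obtain ⟨β, hβ⟩ := exists_isLieDerivFamily (b := b) hc hα.1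
    rw [hβ.comm]
    simp [fun c ↦ (hβ.isLieDeriv c).eq_zero hα.2]

end ChainMap

/-! ### Polynomial paths in an algebra and their integrals. -/

section PolynomialPaths

open Polynomial

variable {X : Type*} [Ring X] [Algebra ℝ X]

/-- Evaluation of a polynomial with coefficients in a real algebra at a real number. -/
def pathEval (t : ℝ) : X[X] →+* X :=
  eval₂RingHom' (RingHom.id X) (algebraMap ℝ X t) fun a ↦ (Algebra.commutes t a).symm

theorem pathEval_monomial (t : ℝ) (n : ℕ) (a : X) : pathEval t (monomial n a) = t ^ n • a := by
  change eval₂ _ _ _ = _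
  rw [eval₂_monomial, RingHom.id_apply, ← map_pow, ← Algebra.commutes, ← Algebra.smul_def]

theorem pathEval_eq_sum (t : ℝ) (p : X[X]) :
    pathEval t p = ∑ n ∈ p.support, t ^ n • p.coeff n := by
  conv_lhs => rw [p.as_sum_support, map_sum]
  simp only [pathEval_monomial]

/-- `u` is a polynomial path in the algebra `X`, with derivative `v`. -/
def IsPolyPath (u v : ℝ → X) : Prop :=
  ∃ p : X[X], ∀ t, u t = pathEval t p ∧ v t = pathEval t (derivative p)

theorem IsPolyPath.congr {u v u' v' : ℝ → X} (h : IsPolyPath u v) (hu : ∀ t, u' t = u t)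
    (hv : ∀ t, v' t = v t) : IsPolyPath u' v' := by
  rwa [funext hu, funext hv]

theorem isPolyPath_pow (n : ℕ) (a : X) :
    IsPolyPath (fun t ↦ t ^ n • a) fun t ↦ (n * t ^ (n - 1)) • a := by
  refine ⟨monomial n a, fun t ↦ ⟨(pathEval_monomial t n a).symm, ?_⟩⟩
  dsimp only
  rw [derivative_monomial, pathEval_monomial, mul_comm (n : ℝ), mul_smul, ← nsmul_eq_mul',
    Nat.cast_smul_eq_nsmul]

theorem isPolyPath_const (a : X) : IsPolyPath (fun _ ↦ a) fun _ ↦ 0 :=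
  (isPolyPath_pow 0 a).congr (by simp) (by simp)

theorem isPolyPath_smul (a : X) : IsPolyPath (fun t ↦ t • a) fun _ ↦ a :=
  (isPolyPath_pow 1 a).congr (by simp) (by simp)

theorem isPolyPath_sq (a : X) : IsPolyPath (fun t ↦ (t * t) • a) fun t ↦ (2 * t) • a :=
  (isPolyPath_pow 2 a).congr (by simp [sq]) (by simp)

theorem IsPolyPath.add {u v u' v' : ℝ → X} (h : IsPolyPath u v) (h' : IsPolyPath u' v') :
    IsPolyPath (fun t ↦ u t + u' t) fun t ↦ v t + v' t := by
  obtain ⟨p, hp⟩ := h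
  obtain ⟨p', hp'⟩ := h'
  refine ⟨p + p', fun t ↦ ?_⟩
  dsimp only
  rw [map_add, map_add, map_add, (hp t).1, (hp t).2, (hp' t).1, (hp' t).2]
  exact ⟨rfl, rfl⟩

theorem IsPolyPath.mul {u v u' v' : ℝ → X} (h : IsPolyPath u v) (h' : IsPolyPath u' v') :
    IsPolyPath (fun t ↦ u t * u' t) fun t ↦ v t * u' t + u t * v' t := by
  obtain ⟨p, hp⟩ := h
  obtain ⟨p', hp'⟩ := h'
  refine ⟨p * p', fun t ↦ ?_⟩
  dsimp only
  rw [map_mul, derivative_mul, map_add, map_mul, map_mul, (hp t).1, (hp t).2, (hp' t).1, (hp' t).2]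
  exact ⟨rfl, rfl⟩

theorem exists_isPolyPath_sum {ι : Type*} (s : Finset ι) {u : ι → ℝ → X}
    (h : ∀ i, ∃ v, IsPolyPath (u i) v) : ∃ v, IsPolyPath (fun t ↦ ∑ i ∈ s, u i t) v := by
  classical
  induction s using Finset.induction_on with
  | empty => exact ⟨_, (isPolyPath_const (0 : X)).congr (by simp) fun _ ↦ rfl⟩
  | insert i s hi ih =>
    obtain ⟨v, hv⟩ := h i
    obtain ⟨v', hv'⟩ := ih
    exact ⟨_, (hv.add hv').congr (fun t ↦ Finset.sum_insert hi) fun _ ↦ rfl⟩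

/-- If the values of a polynomial are in a subspace, then so are its coefficients. -/
theorem coeff_mem_of_pathEval_mem (S : Submodule ℝ X) {p : X[X]} (h : ∀ t, pathEval t p ∈ S)
    (n : ℕ) : p.coeff n ∈ S := by
  -- The coefficients are tested modulo `S` by linear functionals. Each functional gives a real
  -- polynomial that vanishes at every t, hence is zero.
  rw [← Submodule.Quotient.mk_eq_zero, ← Module.forall_dual_apply_eq_zero_iff ℝ]
  intro φ
  have h1 : (∑ n ∈ p.support, monomial n (φ (Submodule.Quotient.mk (p.coeff n))) : ℝ[X]) = 0 := by
    refine Polynomial.funext fun t ↦ ?_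
    have h2 : φ (S.mkQ (pathEval t p)) = 0 := by
      rw [Submodule.mkQ_apply, (Submodule.Quotient.mk_eq_zero S).2 (h t), map_zero]
    rw [pathEval_eq_sum] at h2
    simp only [map_sum, map_smul, smul_eq_mul, Submodule.mkQ_apply] at h2
    rw [eval_finsetSum, eval_zero, ← h2]
    exact Finset.sum_congr rfl fun n _ ↦ by rw [eval_monomial, mul_comm]
  by_cases hn : n ∈ p.support
  · have h3 := congrArg (fun r : ℝ[X] ↦ r.coeff n) h1
    simpa [finsetSum_coeff, coeff_monomial, hn] using h3
  · rw [notMem_support_iff.1 hn]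
    simp

/-- Integration of a polynomial path over `[0, 1]`. -/
theorem sub_mem_range_of_isPolyPath {S : Submodule ℝ X} (L : S →ₗ[ℝ] X) {u v K K' : ℝ → X}
    (h : IsPolyPath u v) (hK : IsPolyPath K K') (hS : ∀ t, K t ∈ S)
    (hv : ∀ t, v t = L ⟨K t, hS t⟩) : u 1 - u 0 ∈ LinearMap.range L := by
  obtain ⟨p, hp⟩ := h
  obtain ⟨q, hq⟩ := hK
  have hq' : ∀ n, q.coeff n ∈ S := coeff_mem_of_pathEval_mem S fun t ↦ by
    rw [← (hq t).1]; exact hS t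
  -- The derivative of `p` and `L` applied to the coefficients of `q` have equal values at every t;
  -- `coeff_mem_of_pathEval_mem` with the zero subspace makes them equal as polynomials.
  have h1 : derivative p - ∑ n ∈ q.support, monomial n (L ⟨q.coeff n, hq' n⟩) = 0 := by
    ext n
    have := coeff_mem_of_pathEval_mem (⊥ : Submodule ℝ X)
      (p := derivative p - ∑ n ∈ q.support, monomial n (L ⟨q.coeff n, hq' n⟩)) (fun t ↦ by
        have h2 : (⟨K t, hS t⟩ : S) = ∑ n ∈ q.support, t ^ n • ⟨q.coeff n, hq' n⟩ := by
          ext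
          refine ((hq t).1.trans (pathEval_eq_sum t q)).trans ?_
          simp
        rw [map_sub, ← (hp t).2, hv, h2, map_sum, map_sum, Submodule.mem_bot, sub_eq_zero]
        simp only [map_smul, pathEval_monomial]) n
    exact this
  -- Integration of t ^ n: the coefficient of degree n + 1 is `L` of that of `q` in degree n,
  -- divided by n + 1.
  have h3 : ∀ n, p.coeff (n + 1) ∈ LinearMap.range L := fun n ↦ by
    have h4 := congrArg (fun r : X[X] ↦ r.coeff n) (sub_eq_zero.1 h1)
    simp only [coeff_derivative, finsetSum_coeff, coeff_monomial, Finset.sum_ite_eq'] at h4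
    have h5 : p.coeff (n + 1) * (n + 1) = L ⟨q.coeff n, hq' n⟩ := by
      rw [h4]
      split_ifs with hn
      · rfl
      · have : (⟨q.coeff n, hq' n⟩ : S) = 0 := by
          ext; exact notMem_support_iff.1 hn
        rw [this, map_zero]
    have h6 : p.coeff (n + 1) = ((n : ℝ) + 1)⁻¹ • (p.coeff (n + 1) * (n + 1)) := by
      have h7 : p.coeff (n + 1) * (n + 1) = ((n : ℝ) + 1) • p.coeff (n + 1) := by
        rw [mul_add, mul_one, add_smul, one_smul, ← nsmul_eq_mul', Nat.cast_smul_eq_nsmul]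
      rw [h7, smul_smul, inv_mul_cancel₀ (by positivity), one_smul]
    rw [h6, h5]
    exact Submodule.smul_mem _ _ ⟨_, rfl⟩
  have h8 : pathEval 1 p - pathEval 0 p = ∑ n ∈ Finset.range p.natDegree, p.coeff (n + 1) := by
    conv_lhs => rw [p.as_sum_range, map_sum, map_sum]
    simp only [pathEval_monomial]
    rw [Finset.sum_range_succ', Finset.sum_range_succ']
    simp
  rw [(hp 1).1, (hp 0).1, h8]
  exact sum_mem fun n _ ↦ h3 n

end PolynomialPaths

/-! ### The homotopy from the identity to r_f. -/

section Homotopy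

variable {EG : Type*} [NormedAddCommGroup EG] [NormedSpace ℝ EG]
  {G : Type*} [TopologicalSpace G] [ChartedSpace EG G] [Group G]
  {E : Type*} [NormedAddCommGroup E] [NormedSpace ℝ E] {H : Type*} [TopologicalSpace H]
  {I : ModelWithCorners ℝ E H} {W : Type*} [TopologicalSpace W] [ChartedSpace H W] [MulAction G W]
  {k : ℕ} [FiniteDimensional ℝ E] {b : Module.Basis (Fin k) ℝ (LieAlg (EG := EG) G)}
  {f : W → ℝ} {conn : ∀ x : W, TangentSpace I x →ₗ[ℝ] LieAlg (EG := EG) G}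

variable (I b f conn) in
/-- The map `r_{tf}`. -/
def rPath (t : ℝ) : PolyForm I W k →ₗ[ℝ] PolyForm I W k := rF I b (fun x ↦ t * f x) conn

variable (I b f conn) in
/-- The homotopy operator `∑_a f ωᵃ r_{tf}(∂α/∂Θᵃ)`. -/
def homotopyOp (t : ℝ) : PolyForm I W k →ₗ[ℝ] PolyForm I W k :=
  ∑ a, LinearMap.mulLeft ℝ (omegaP I b f conn a) ∘ₗ rPath I b f conn t ∘ₗ thetaDeriv I W k a

theorem homotopyOp_apply (t : ℝ) (α : PolyForm I W k) :
    homotopyOp I b f conn t α =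
      ∑ a, omegaP I b f conn a * rPath I b f conn t (thetaDeriv I W k a α) := by
  simp [homotopyOp]

theorem homotopyOp_const (t : ℝ) (η : FormField I W) :
    homotopyOp I b f conn t (constForm η) = 0 := by
  rw [homotopyOp_apply]
  simp [thetaDeriv_const]

theorem rPath_mul (hc : IsDegenerateConnection I f conn) (t : ℝ) (α α' : PolyForm I W k) :
    rPath I b f conn t (α * α') = rPath I b f conn t α * rPath I b f conn t α' :=
  rF_mul (hc.mul t) α α'

theorem rPath_one (hc : IsDegenerateConnection I f conn) (t : ℝ) :
    rPath I b f conn t (1 : PolyForm I W k) = 1 :=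
  (rF_const (hc.mul t) 1).trans (congrArg constForm horForm_one)

theorem homotopyOp_theta (hc : IsDegenerateConnection I f conn) (t : ℝ) (a : Fin k) :
    homotopyOp I b f conn t (Theta a) = omegaP I b f conn a := by
  rw [homotopyOp_apply]
  simp [thetaDeriv_theta, apply_ite (rPath I b f conn t), rPath_one hc]

variable [IsManifold I ∞ W] [T2Space W] [CompactSpace W]

/-- Each ∂/∂Θᵃ is an even derivation and the factor ω_fᵃ makes the operator odd, so it is an odd
derivation along r_{tf}. -/
theorem homotopyOp_mul (hc : IsDegenerateConnection I f conn) (t : ℝ) (α α' : PolyForm I W k) :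
    homotopyOp I b f conn t (α * α') =
      homotopyOp I b f conn t α * rPath I b f conn t α' +
        polyInv I W k (rPath I b f conn t α) * homotopyOp I b f conn t α' := by
  have e : ∀ a (β : PolyForm I W k), polyInv I W k (rPath I b f conn t α) *
      (omegaP I b f conn a * β) = omegaP I b f conn a * (rPath I b f conn t α * β) := fun a β ↦ by
    rw [← mul_assoc, ← omegaP_mul, mul_assoc]
  simp only [homotopyOp_apply, thetaDeriv_mul, map_add, rPath_mul hc, mul_add,
    Finset.sum_add_distrib, Finset.sum_mul, Finset.mul_sum, e, mul_assoc]

theorem polyInv_rPath (hc : IsDegenerateConnection I f conn) (t : ℝ) (α : PolyForm I W k) :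
    polyInv I W k (rPath I b f conn t α) = rPath I b f conn t (polyInv I W k α) :=
  polyInv_rF (hc.mul t) α

theorem homotopyOp_polyInv (hc : IsDegenerateConnection I f conn) (t : ℝ) (α : PolyForm I W k) :
    homotopyOp I b f conn t (polyInv I W k α) = -polyInv I W k (homotopyOp I b f conn t α) := by
  simp only [homotopyOp_apply, thetaDeriv_polyInv, map_sum, polyInv_mul, polyInv_omegaP, neg_mul,
    Finset.sum_neg_distrib, neg_neg, polyInv_rPath hc]

theorem smoothPolys_thetaDeriv (a : Fin k) {α : PolyForm I W k} (hα : α ∈ SmoothPolys I W k) :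
    thetaDeriv I W k a α ∈ SmoothPolys I W k := by
  refine smoothPolys_induction_single (P := fun α ↦ thetaDeriv I W k a α ∈ SmoothPolys I W k)
    (by rw [map_zero]; exact zero_mem _) (fun m η hη ↦ ?_) (fun α _ α' _ h h' ↦ ?_) hα
  · rw [thetaDeriv_single]
    exact Submodule.smul_mem _ _ (smoothPolys_single _ hη)
  · rw [map_add]; exact add_mem h h'

variable [LieGroup 𝓘(ℝ, EG) ∞ G] [ContMDiffSMul 𝓘(ℝ, EG) I ∞ G W]

theorem smoothPolys_rPath (hc : IsDegenerateConnection I f conn) (t : ℝ) {α : PolyForm I W k}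
    (hα : α ∈ SmoothPolys I W k) : rPath I b f conn t α ∈ SmoothPolys I W k :=
  smoothPolys_rF (hc.mul t) hα

theorem smoothPolys_homotopyOp (hc : IsDegenerateConnection I f conn) (t : ℝ)
    {α : PolyForm I W k} (hα : α ∈ SmoothPolys I W k) :
    homotopyOp I b f conn t α ∈ SmoothPolys I W k := by
  rw [homotopyOp_apply]
  exact sum_mem fun a _ ↦ smoothPolys_mul (smoothPolys_omegaP hc a)
    (smoothPolys_rPath hc t (smoothPolys_thetaDeriv a hα))

variable (I b f conn) in
/-- The derivative of `t ↦ r_{tf}(α)`, where `β` is the family of derivatives of `α` under the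
action. -/
def rPathDeriv (α : PolyForm I W k) (β : Fin k → PolyForm I W k) (t : ℝ) : PolyForm I W k :=
  cartanD I b (homotopyOp I b f conn t α) + homotopyOp I b f conn t (cartanD I b α) -
    t • ∑ c, omegaP I b f conn c * homotopyOp I b f conn t (β c)

variable [FiniteDimensional ℝ EG]

variable (I b f conn) in
/-- The infinitesimal homotopy formula for `α`. -/
structure HomotopyFormula (α : PolyForm I W k) (β : Fin k → PolyForm I W k) : Prop where
  family : ∀ t : ℝ, IsLieDerivFamily I b (fun x ↦ t * f x) conn α β
  path : IsPolyPath (fun t ↦ rPath I b f conn t α) (rPathDeriv I b f conn α β)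

theorem HomotopyFormula.comm {α : PolyForm I W k} {β : Fin k → PolyForm I W k}
    (h : HomotopyFormula I b f conn α β) (t : ℝ) :
    cartanD I b (rPath I b f conn t α) = rPath I b f conn t (cartanD I b α) +
      t • ∑ c, omegaP I b f conn c * rPath I b f conn t (β c) := by
  have h1 := (h.family t).comm
  simp only [omegaP_smul, smul_mul_assoc, ← Finset.smul_sum] at h1
  exact h1

theorem homotopyFormula_fnForm (hc : IsDegenerateConnection I f conn) {h : W → ℝ}
    (hh : ContMDiff I 𝓘(ℝ, ℝ) ∞ h) :
    HomotopyFormula I b f conn (constForm (fnForm I h))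
      fun c ↦ constForm (fnForm I (fnDeriv I b h c)) := by
  refine ⟨fun t ↦ isLieDerivFamily_fnForm (hc.mul t) hh,
    (isPolyPath_const (constForm (fnForm I h))).congr (fun t ↦ rF_fnForm (hc.mul t) h) fun t ↦ ?_⟩
  simp [rPathDeriv, homotopyOp_const, cartanD_fnForm, cartanD_zero]

/-- The path r_{tf}(dh) is affine in t. Its slope is the homotopy operator on D(dh) = −Θᵃ ξ_a h; the
other terms vanish because dh contains no Θ. -/
theorem homotopyFormula_extD_fnForm (hc : IsDegenerateConnection I f conn) {h : W → ℝ}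
    (hh : ContMDiff I 𝓘(ℝ, ℝ) ∞ h) :
    HomotopyFormula I b f conn (constForm (extD I (fnForm I h)))
      fun c ↦ constForm (extD I (fnForm I (fnDeriv I b h c))) := by
  have h1 : ∀ t a, rPath I b f conn t (constForm (fnForm I (fnDeriv I b h a)) : PolyForm I W k) =
      constForm (fnForm I (fnDeriv I b h a)) := fun t a ↦ rF_fnForm (hc.mul t) _
  refine ⟨fun t ↦ isLieDerivFamily_extD_fnForm (hc.mul t) hh,
    ((isPolyPath_const (constForm (extD I (fnForm I h)))).add (isPolyPath_smul
      (-∑ a, omegaP I b f conn a * constForm (fnForm I (fnDeriv I b h a))))).congr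
      (fun t ↦ ?_) fun t ↦ ?_⟩
  · refine (rF_extD_fnForm (hc.mul t) hh).trans ?_
    simp only [omegaP_smul, smul_mul_assoc, ← Finset.smul_sum, smul_neg, sub_eq_add_neg]
  · simp only [rPathDeriv, homotopyOp_const, cartanD_zero, cartanD_extD_fnForm hh, map_neg,
      map_sum, homotopyOp_mul hc, homotopyOp_theta hc, mul_zero, Finset.sum_const_zero, smul_zero,
      sub_zero, add_zero, zero_add, h1]

/-- The curvature of tω_f is quadratic in t. Its linear coefficient is D of ω_fᵃ = K_t Θᵃ, and the
derivative of the bracket term is the correction term. -/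
theorem homotopyFormula_theta (hc : IsDegenerateConnection I f conn) (a : Fin k) :
    HomotopyFormula I b f conn (Theta a) fun c ↦ -∑ e, b.coord a ⁅b c, b e⁆ • Theta e := by
  set S := ∑ c, ∑ e, b.coord a ⁅b c, b e⁆ • (omegaP I b f conn c * omegaP I b f conn e) with hS
  refine ⟨fun t ↦ isLieDerivFamily_theta (hc.mul t) a,
    (((isPolyPath_smul (cartanD I b (omegaP I b f conn a))).add
      (isPolyPath_sq ((1 / 2 : ℝ) • S))).add (isPolyPath_const (Theta a))).congr
      (fun t ↦ ?_) fun t ↦ ?_⟩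
  · refine (rF_theta (hc.mul t) a).trans ?_
    rw [curvF_eq (hc.mul t)]
    simp only [omegaP_smul, cartanD_smul t (smoothPolys_omegaP hc a), smul_mul_smul_comm,
      smul_comm _ (t * t), ← Finset.smul_sum, hS]
  · have h1 : ∑ c, omegaP I b f conn c *
        homotopyOp I b f conn t (-∑ e, b.coord a ⁅b c, b e⁆ • Theta e) = -S := by
      simp only [map_neg, map_sum, map_smul, homotopyOp_theta hc, mul_neg, Finset.mul_sum,
        mul_smul_comm, Finset.sum_neg_distrib, hS]
    simp only [rPathDeriv, h1, homotopyOp_theta hc, cartanD_theta, map_zero, add_zero]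
    module

theorem HomotopyFormula.add (hc : IsDegenerateConnection I f conn) {α α' : PolyForm I W k}
    {β β' : Fin k → PolyForm I W k} (hα : α ∈ SmoothPolys I W k) (hα' : α' ∈ SmoothPolys I W k)
    (h : HomotopyFormula I b f conn α β) (h' : HomotopyFormula I b f conn α' β') :
    HomotopyFormula I b f conn (α + α') (β + β') := by
  refine ⟨fun t ↦ (h.family t).add (hc.mul t) hα hα' (h'.family t),
    (h.path.add h'.path).congr (fun t ↦ map_add _ _ _) fun t ↦ ?_⟩
  simp only [rPathDeriv, map_add, cartanD_add hα hα', Pi.add_apply,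
    cartanD_add (smoothPolys_homotopyOp hc t hα) (smoothPolys_homotopyOp hc t hα'), mul_add,
    Finset.sum_add_distrib, smul_add]
  abel

/-- Expanding D K_t + K_t D by the twisted Leibniz rules leaves the commutators of D with r_{tf},
which `HomotopyFormula.comm` evaluates; they cancel the mixed terms of the correction for the
product. -/
theorem HomotopyFormula.mul (hc : IsDegenerateConnection I f conn) {α α' : PolyForm I W k}
    {β β' : Fin k → PolyForm I W k} (hα : α ∈ SmoothPolys I W k) (hα' : α' ∈ SmoothPolys I W k)
    (h : HomotopyFormula I b f conn α β) (h' : HomotopyFormula I b f conn α' β') :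
    HomotopyFormula I b f conn (α * α') fun c ↦ β c * α' + α * β' c := by
  refine ⟨fun t ↦ (h.family t).mul (hc.mul t) hα hα' (h'.family t),
    (h.path.mul h'.path).congr (fun t ↦ rPath_mul hc t α α') fun t ↦ ?_⟩
  have hK := smoothPolys_homotopyOp (b := b) hc t hα
  have hK' := smoothPolys_homotopyOp (b := b) hc t hα'
  have hR := smoothPolys_rPath (b := b) hc t hα
  have hR' := smoothPolys_rPath (b := b) hc t hα'
  have e1 : ∀ c, polyInv I W k (homotopyOp I b f conn t α) *
      (omegaP I b f conn c * rPath I b f conn t (β' c)) =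
      omegaP I b f conn c * (homotopyOp I b f conn t α * rPath I b f conn t (β' c)) := fun c ↦ by
    rw [← mul_assoc, ← omegaP_mul, mul_assoc]
  have e2 : ∀ c, rPath I b f conn t α *
      (omegaP I b f conn c * homotopyOp I b f conn t (β' c)) =
      omegaP I b f conn c *
        (polyInv I W k (rPath I b f conn t α) * homotopyOp I b f conn t (β' c)) := fun c ↦ by
    rw [← mul_assoc, ← mul_assoc, omegaP_mul, polyInv_polyInv]
  have e3 : homotopyOp I b f conn t (cartanD I b (α * α')) =
      homotopyOp I b f conn t (cartanD I b α) * rPath I b f conn t α' +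
        polyInv I W k (rPath I b f conn t (cartanD I b α)) * homotopyOp I b f conn t α' +
      (-polyInv I W k (homotopyOp I b f conn t α) * rPath I b f conn t (cartanD I b α') +
        rPath I b f conn t α * homotopyOp I b f conn t (cartanD I b α')) := by
    rw [cartanD_mul hα hα', map_add, homotopyOp_mul hc, homotopyOp_mul hc,
      homotopyOp_polyInv hc, ← polyInv_rPath hc t α, polyInv_polyInv]
  simp only [rPathDeriv, e3]
  rw [homotopyOp_mul hc, cartanD_add (smoothPolys_mul hK hR')
    (smoothPolys_mul (smoothPolys_polyInv hR) hK'), cartanD_mul hK hR',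
    cartanD_mul (smoothPolys_polyInv hR) hK', polyInv_polyInv, cartanD_polyInv hR, h.comm t,
    h'.comm t]
  simp only [map_add, map_smul, map_sum, polyInv_mul, polyInv_omegaP, homotopyOp_mul hc, mul_add,
    add_mul, sub_mul, mul_sub, neg_mul, neg_add, smul_mul_assoc, mul_smul_comm, Finset.sum_mul,
    Finset.mul_sum, e1, e2, mul_assoc, Finset.sum_add_distrib, smul_add, Finset.sum_neg_distrib,
    smul_neg, neg_neg]
  abel

theorem exists_homotopyFormula (hc : IsDegenerateConnection I f conn) {α : PolyForm I W k}
    (hα : α ∈ SmoothPolys I W k) : ∃ β, HomotopyFormula I b f conn α β :=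
  smoothPolys_induction (P := fun α ↦ ∃ β, HomotopyFormula I b f conn α β)
    (fun _ hh ↦ ⟨_, homotopyFormula_fnForm hc hh⟩)
    (fun _ hh ↦ ⟨_, homotopyFormula_extD_fnForm hc hh⟩) (fun a ↦ ⟨_, homotopyFormula_theta hc a⟩)
    (fun _ hα _ hα' ⟨_, e⟩ ⟨_, e'⟩ ↦ ⟨_, e.mul hc hα hα' e'⟩)
    (fun _ hα _ hα' ⟨_, e⟩ ⟨_, e'⟩ ↦ ⟨_, e.add hc hα hα' e'⟩) hα

/-- The integral of K_t α is formed coefficient by coefficient in t, so this path has to be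
polynomial too. -/
theorem exists_isPolyPath_homotopyOp (hc : IsDegenerateConnection I f conn) {α : PolyForm I W k}
    (hα : α ∈ SmoothPolys I W k) :
    ∃ K', IsPolyPath (fun t ↦ homotopyOp I b f conn t α) K' := by
  obtain ⟨K', hK'⟩ := exists_isPolyPath_sum Finset.univ (u := fun (a : Fin k) t ↦
      omegaP I b f conn a * rPath I b f conn t (thetaDeriv I W k a α)) fun a ↦ by
    obtain ⟨β, hβ⟩ := exists_homotopyFormula (b := b) hc (smoothPolys_thetaDeriv a hα)
    exact ⟨_, (isPolyPath_const _).mul hβ.path⟩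
  exact ⟨K', hK'.congr (fun t ↦ homotopyOp_apply t α) fun _ ↦ rfl⟩

/-- The factors ω_fᵃ and ∂/∂Θᵃ transform contragrediently and r_{tf} is equivariant, so the sum over
`a` is invariant. -/
theorem homotopyOp_mem_equivForms (hc : IsDegenerateConnection I f conn) (t : ℝ)
    {α : PolyForm I W k} (hα : α ∈ EquivForms I b (W := W)) :
    homotopyOp I b f conn t α ∈ EquivForms I b (W := W) := by
  refine ⟨smoothPolys_homotopyOp hc t hα.1, fun g ↦ ?_⟩
  have h1 : ∀ c, thetaDeriv I W k c α =
      ∑ a, b.coord a (Ad g⁻¹ (b c)) • actPoly I b g (thetaDeriv I W k a α) := fun c ↦ by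
    rw [← thetaDeriv_actPoly, hα.2]
  have h2 : ∀ β : PolyForm I W k, actPoly I b g (rPath I b f conn t β) =
      rPath I b f conn t (actPoly I b g β) := actPoly_rF (hc.mul t) g
  rw [homotopyOp_apply, map_sum]
  conv_rhs => enter [2, c]; rw [h1 c]
  simp only [actPoly_mul, actPoly_omegaP hc, h2, map_sum, map_smul, Finset.sum_mul,
    Finset.mul_sum, smul_mul_assoc, mul_smul_comm]
  exact Finset.sum_comm

/-- With tf = 0 the endomorphism of TW is the identity and the curvature is Θ: this is what the term
−(−1 + f)Θ in Ω_f achieves. -/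
theorem rPath_zero (hc : IsDegenerateConnection I f conn) (α : PolyForm I W k) :
    rPath I b f conn 0 α = α := by
  refine polyForm_induction_univ (P := fun α ↦ rPath I b f conn 0 α = α)
    (fun η ↦ ?_) (fun a ↦ ?_) (fun α α' e e' ↦ ?_) (fun α α' e e' ↦ ?_) α
  · refine (rF_const (hc.mul 0) η).trans (congrArg constForm (funext fun x ↦ ?_))
    change pullExt (horMap I (fun x ↦ 0 * f x) conn x) (η x) = η x
    have : horMap I (fun x ↦ 0 * f x) conn x = LinearMap.id := by simp [horMap]
    rw [this, pullExt_id]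
  · refine (rF_theta (hc.mul 0) a).trans ?_
    rw [curvF_eq (hc.mul 0)]
    have h0 : ∀ c, omegaP I b (fun x ↦ 0 * f x) conn c = 0 := fun c ↦ by
      rw [omegaP_smul, zero_smul]
    simp only [h0, cartanD_zero, mul_zero, smul_zero, Finset.sum_const_zero, zero_add]
  · rw [rPath_mul hc, e, e']
  · rw [map_add, e, e']

theorem rPath_eq_rF (α : PolyForm I W k) : rPath I b f conn 1 α = rF I b f conn α := by
  simp only [rPath, one_mul]

/-- On closed equivariant forms, `r_f` differs from the identity by exact forms. -/
theorem rF_sub_mem_range (hc : IsDegenerateConnection I f conn) {α : PolyForm I W k}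
    (hα : α ∈ Closed I b (W := W)) :
    rF I b f conn α - α ∈ LinearMap.range (cartanDLin I b (W := W)) := by
  obtain ⟨β, hβ⟩ := exists_homotopyFormula (b := b) hc hα.1.1
  obtain ⟨K', hK'⟩ := exists_isPolyPath_homotopyOp (b := b) hc hα.1.1
  have h1 := sub_mem_range_of_isPolyPath (cartanDLin I b (W := W)) hβ.path hK'
    (fun t ↦ homotopyOp_mem_equivForms hc t hα.1) fun t ↦ by
      -- Invariance removes the correction term and closedness removes K_t D, which leaves d/dt
      -- r_{tf} α = D K_t α.
      have h2 : ∀ c, β c = 0 := fun c ↦ ((hβ.family t).isLieDeriv c).eq_zero hα.1.2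
      simp only [rPathDeriv, h2, hα.2, map_zero, add_zero, mul_zero, Finset.sum_const_zero,
        smul_zero, sub_zero]
      rfl
  simpa only [rPath_zero hc, rPath_eq_rF] using h1

end Homotopy

end DegenerateChernWeil

end

theorem theorem2p5
    {EG : Type*} [NormedAddCommGroup EG] [NormedSpace ℝ EG] [FiniteDimensional ℝ EG]
    {G : Type*} [TopologicalSpace G] [ChartedSpace EG G] [Group G] [LieGroup 𝓘(ℝ, EG) ∞ G]
    [T2Space G] [CompactSpace G] [ConnectedSpace G]
    {E : Type*} [NormedAddCommGroup E] [NormedSpace ℝ E] [FiniteDimensional ℝ E]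
    {H : Type*} [TopologicalSpace H] (I : ModelWithCorners ℝ E H)
    {W : Type*} [TopologicalSpace W] [ChartedSpace H W] [IsManifold I ∞ W]
    [T2Space W] [CompactSpace W]
    [MulAction G W] [ContMDiffSMul 𝓘(ℝ, EG) I ∞ G W]
    (hW : ∃ U : Set W, IsOpen U ∧ I.boundary W ⊆ U ∧
      U ⊆ DegenerateChernWeil.locallyFreeLocus G W)
    {k : ℕ} (b : Module.Basis (Fin k) ℝ (DegenerateChernWeil.LieAlg (EG := EG) G))
    (f : W → ℝ) (hf : DegenerateChernWeil.IsCutoff G I f)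
    (conn : ∀ x : W, TangentSpace I x →ₗ[ℝ] DegenerateChernWeil.LieAlg (EG := EG) G)
    (hω : DegenerateChernWeil.IsConnection I conn) :
    ∃ h : DegenerateChernWeil.IsChainMap I b (DegenerateChernWeil.rF I b f conn),
      h.induced = LinearMap.id := by
  have hc := hω.isDegenerateConnection hf
  refine ⟨DegenerateChernWeil.isChainMap_rF hc, Submodule.linearMap_qext _ ?_⟩
  -- Equality of classes in cohomology means that r_f α − α is D of an equivariant form.
  refine LinearMap.ext fun α ↦ (Submodule.Quotient.eq _).2 ?_
  exact DegenerateChernWeil.rF_sub_mem_range hc α.2
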